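/- **Setting.** For $f\in L^2(\mathbb R)$ let $\hat f(\xi)=\int_{\mathbb R}e^{-ix\xi}f(x)\,dx$, $\langle f,g\rangle=\int_{\mathbb R} f\bar g$, $D=-i\partial_x$. Let $L^2_+(\mathbb R)$ (resp. $H^s_+(\mathbb R)$) be the space of $f\in L^2(\mathbb R)$ (resp. $H^s(\mathbb R)$) with $\operatorname{supp}\hat f\subset[0,\infty)$, let $\Pi_+$ be the orthogonal projection of $L^2(\mathbb R)$ onto $L^2_+(\mathbb R)$, and $T_bf=\Pi_+(bf)$. For $u\in H^1_+(\mathbb R)$ the Lax operator is $L_u=D-T_uT_{\bar u}$ on $L^2_+(\mathbb R)$ with domain $H^1_+(\mathbb R)$. Let $G$ be the infinitesimal generator of the semigroup $S(\eta)^*f=\Pi_+(e^{-i\eta x}f)$ on $L^2_+(\mathbb R)$, $S(\eta)^*=e^{-i\eta G}$, i.e. $Gf=\lim_{\eta\to0^+}\frac{i}{\eta}(S(\eta)^*f-f)$ in $L^2$. For $N\ge1$, an *$N$-soliton potential* is a function $u=P/Q$ with $P,Q\in\mathbb C[x]$, $\deg Q=N$, $\deg P\le N-1$, all zeros of $Q$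 in $\{\operatorname{Im}z<0\}$, and $P\bar P=i(Q'\bar Q-\bar Q'Q)$. A function $f\in H^1_+(\mathbb R)$ is extended to $\operatorname{Im}x\ge0$ by $f(x)=\frac1{2\pi}\int_0^\infty e^{ix\xi}\hat f(\xi)\,d\xi$. The equation (CM-DNLS) is $$i\partial_tu+\partial_{xx}u+(D+|D|)(|u|^2)\,u=0 .$$ **Proposition (inverse spectral formula).** Let $N\ge1$ and let $\lambda_1=0,\lambda_2,\dots,\lambda_N$ be pairwise distinct real numbers. (a) Let $u$ be an $N$-soliton potential such that $\lambda_1,\dots,\lambda_N$ are eigenvalues of $L_u$. Then there exist $\psi_j\in H^1_+(\mathbb R)$ with $L_u\psi_j=\lambda_j\psi_j$, $\|\psi_j\|_{L^2}=1$, $\langle u,\psi_j\rangle=\sqrt{2\pi}$ ($1\le j\le N$), the limit $\hat u(0^+)$ exists and is nonzero, and there are $\varphi\in\mathbb R$, $\rho>0$ and $\gamma_1,\dots,\gamma_N\in\mathbb R$ such that $\sqrt{2\rho}\,e^{i\varphi}=\hat u(0^+)/(2\pi i)$ and, for every such choice of $(\psi_j)$, every $\psi_k$ lies in the domain of $G$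 and the matrix $M_{jk}=\langle G\psi_k,\psi_j\rangle$ is given by $$M_{jk}=\frac{i}{\lambda_j-\lambda_k}\quad(j\ne k),\qquad M_{jj}=\gamma_j-i\rho\,\delta_{j1}.$$ Moreover, for every $x$ with $\operatorname{Im}x\ge0$ the matrix $M-xI$ is invertible and $$u(x)=\sqrt{2\rho}\,e^{i\varphi}\,\big\langle(M-xI)^{-1}X,Y\big\rangle_{\mathbb C^N},\qquad X=(1,\dots,1)^T,\quad Y=(1,0,\dots,0)^T .$$ (b) Let $J\subset\mathbb R$ be an interval, let $u\in C(J;H^2_+(\mathbb R))$ be a solution of (CM-DNLS), and suppose that for some $t_0\in J$ the function $u(t_0)$ is an $N$-soliton potential such that $\lambda_1,\dots,\lambda_N$ are eigenvalues of $L_{u(t_0)}$. Then there are functions $\varphi,\rho,\gamma_1,\dots,\gamma_N:J\to\mathbb R$ such that for every $t\in J$ all conclusions of (a) hold for $u(t)$ with the same $\lambda_1,\dots,\lambda_N$ and with $\varphi(t),\rho(t),\gamma_j(t)$, and $$\frac{d\varphi}{dt}=0,\qquad \frac{d\rho}{dt}=0,\qquad \frac{d\gamma_j}{dt}=2\lambda_j\quad(1\le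 j\le N).$$ -/

import Mathlib

open MeasureTheory Filter Topology Complex
open scoped FourierTransform SchwartzMap

noncomputable section

namespace CMDNLS

/-- The complex Hilbert space `L²(ℝ)`. -/
abbrev LTwo : Type := Lp ℂ 2 (volume : Measure ℝ)

open Classical in
/-- Pointwise product `b · f` of a function `b` with an `L²` function `f`, whenever this product is
again in `L²`; it is only used in that case (and is set to `0` otherwise). -/
def mulL2 (b : ℝ → ℂ) (f : LTwo) : LTwo :=
  if h : MemLp (fun x => b x * f x) 2 (volume : Measure ℝ) then h.toLp _ else 0

/-- Fourier multiplier `m(D)`, `D = -i∂ₓ`, where `m` is a function of the angular frequency `ξ`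
dual to `e^{iξx}`. As `𝓕` uses the characters `e^{2πiηx}`, the symbol is read at `ξ = 2πη`. It is only
used for `f` in the domain of `m(D)`. -/
def fourierMul (m : ℝ → ℂ) (f : LTwo) : LTwo :=
  𝓕⁻ (mulL2 (fun η => m (2 * Real.pi * η)) (𝓕 f))

/-- The Cauchy–Szegő projection `Π₊` of `L²(ℝ)` onto the Hardy space `L²₊(ℝ)`. -/
def szegoProj (f : LTwo) : LTwo :=
  fourierMul ((Set.Ici (0 : ℝ)).indicator 1) f

/-- `D = -i∂ₓ`. -/
def opD (f : LTwo) : LTwo := fourierMul (fun ξ => (ξ : ℂ)) f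

/-- `∂ₓₓ`. -/
def opDxx (f : LTwo) : LTwo := fourierMul (fun ξ => -(ξ : ℂ) ^ 2) f

/-- `D + |D|`. -/
def opDAbsD (f : LTwo) : LTwo := fourierMul (fun ξ => ((ξ + |ξ| : ℝ) : ℂ)) f

/-- Membership in the Hardy space `L²₊(ℝ)`: the Fourier transform is supported in `[0, ∞)`. -/
def MemHardy (f : LTwo) : Prop :=
  ∀ᵐ η : ℝ, η < 0 → (𝓕 f : LTwo) η = 0

/-- Membership in the Hardy–Sobolev space `Hˢ₊(ℝ)`. -/
def MemHardySobolev (s : ℝ) (f : LTwo) : Prop :=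
  MemHardy f ∧ TemperedDistribution.MemSobolev s 2 (f : 𝓢'(ℝ, ℂ))

/-- The complex conjugate of a function. -/
def conjFun (f : ℝ → ℂ) : ℝ → ℂ := fun x => starRingEnd ℂ (f x)

/-- Toeplitz operator `T_b f = Π₊(b f)`. -/
def toeplitz (b : ℝ → ℂ) (f : LTwo) : LTwo := szegoProj (mulL2 b f)

/-- The Lax operator `L_u = D - T_u T_{ū}`; its domain is `H¹₊(ℝ)`. -/
def laxOp (u f : LTwo) : LTwo := opD f - toeplitz u (toeplitz (conjFun u) f)

/-- `ψ` lies in the domain `H¹₊(ℝ)` of `L_u` and `L_u ψ = μ ψ`. -/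
def SolvesEigenEq (u : LTwo) (μ : ℝ) (ψ : LTwo) : Prop :=
  MemHardySobolev 1 ψ ∧ laxOp u ψ = (μ : ℂ) • ψ

/-- `μ` is an eigenvalue of `L_u`. -/
def IsLaxEigenvalue (u : LTwo) (μ : ℝ) : Prop :=
  ∃ ψ : LTwo, ψ ≠ 0 ∧ SolvesEigenEq u μ ψ

/-- `N`-soliton potentials: `u = P / Q` with `deg Q = N`, `deg P ≤ N - 1`, all zeros of `Q` in the
open lower half-plane, and `P P̄ = i (Q' Q̄ - Q̄' Q)`. -/
def IsMultiSolitonPotential (N : ℕ) (u : LTwo) : Prop :=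
  ∃ P Q : Polynomial ℂ, Q.degree = N ∧ P.degree < N ∧ (∀ z : ℂ, Q.IsRoot z → z.im < 0) ∧
    P * P.map (starRingEnd ℂ) =
      Polynomial.C I * (Q.derivative * Q.map (starRingEnd ℂ) -
        (Q.map (starRingEnd ℂ)).derivative * Q) ∧
    ∀ᵐ x : ℝ, u x = P.eval (x : ℂ) / Q.eval (x : ℂ)

/-- The adjoint Lax–Beurling semigroup `S(η)* f = Π₊(e^{-iηx} f)`. -/
def adjSemigroup (η : ℝ) (f : LTwo) : LTwo :=
  szegoProj (mulL2 (fun x => Complex.exp (-(I * η * x))) f)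

/-- `f ∈ dom G` and `G f = g`, where `G` is the infinitesimal generator of the adjoint Lax–Beurling
semigroup on `L²₊(ℝ)`, `S(η)* = e^{-iηG}`. -/
def GeneratorMaps (f g : LTwo) : Prop :=
  MemHardy f ∧
    Tendsto (fun η : ℝ => (I / (η : ℂ)) • (adjSemigroup η f - f)) (𝓝[>] 0) (𝓝 g)

/-- Normalised eigenfunctions of `L_u` for the eigenvalues `lam j`:
`L_u ψ_j = λ_j ψ_j`, `‖ψ_j‖ = 1`, `⟨u, ψ_j⟩ = √(2π)`. -/
def IsNormalizedEigenbasis {N : ℕ} (u : LTwo) (lam : Fin N → ℝ) (ψ : Fin N → LTwo) : Prop :=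
  ∀ j, SolvesEigenEq u (lam j) (ψ j) ∧ ‖ψ j‖ = 1 ∧
    inner ℂ (ψ j) u = ((Real.sqrt (2 * Real.pi) : ℝ) : ℂ)

/-- `M` is the matrix `(⟨G ψ_k, ψ_j⟩)_{j,k}` of `G` in the normalised eigenbasis of `L_u`. -/
def IsGeneratorMatrix {N : ℕ} (u : LTwo) (lam : Fin N → ℝ) (M : Matrix (Fin N) (Fin N) ℂ) : Prop :=
  (∃ ψ, IsNormalizedEigenbasis u lam ψ) ∧
    ∀ ψ, IsNormalizedEigenbasis u lam ψ →
      ∀ j k, ∃ g, GeneratorMaps (ψ k) g ∧ inner ℂ (ψ j) g = M j k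

/-- `û(0⁺) = c`, as an essential one-sided limit, where `û(ξ) = ∫ e^{-ixξ} u(x) dx`. -/
def FourierAtZeroPlus (u : LTwo) (c : ℂ) : Prop :=
  Tendsto (fun η : ℝ => (𝓕 u : LTwo) η) (𝓝[>] (0 : ℝ) ⊓ ae volume) (𝓝 c)

/-- Values of a function of `H¹₊(ℝ)` on the closed upper half-plane,
`f(z) = (1/2π) ∫_0^∞ e^{izξ} f̂(ξ) dξ` (written with `ξ = 2πη`). -/
def hardyEval (f : LTwo) (z : ℂ) : ℂ :=
  ∫ η in Set.Ioi (0 : ℝ), Complex.exp (2 * Real.pi * I * z * η) * (𝓕 f : LTwo) η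

/-- The matrix with entries `i / (λ_j - λ_k)` off the diagonal and `γ_j - i ρ δ_{j1}` on it. The
index `1` of the mathematical notation is `0 : Fin N`. -/
def spectralMatrix {N : ℕ} [NeZero N] (lam γ : Fin N → ℝ) (ρ : ℝ) : Matrix (Fin N) (Fin N) ℂ :=
  Matrix.of fun j k =>
    if j = k then (γ j : ℂ) - (if j = 0 then I * ρ else 0) else I / ((lam j : ℂ) - lam k)

/-- `√(2ρ) e^{iφ} ⟨(M - z)⁻¹ X, Y⟩` with `X = (1, …, 1)ᵀ` and `Y = (1, 0, …, 0)ᵀ`. -/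
def inverseFormula {N : ℕ} [NeZero N] (lam γ : Fin N → ℝ) (ρ φ : ℝ) (z : ℂ) : ℂ :=
  ((Real.sqrt (2 * ρ) : ℝ) : ℂ) * Complex.exp (I * φ) *
    (((spectralMatrix lam γ ρ - z • (1 : Matrix (Fin N) (Fin N) ℂ))⁻¹.mulVec (fun _ => 1)) ⬝ᵥ
      star (Pi.single (0 : Fin N) (1 : ℂ)))

/-- `φ, ρ, γ` are the spectral parameters of `u`: `√(2ρ) e^{iφ} = û(0⁺) / (2πi)` with `ρ > 0`, and
`⟨G ψ_k, ψ_j⟩` is given by `spectralMatrix`; in particular `γ_j = Re ⟨G ψ_j, ψ_j⟩`. -/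
def HasSpectralParameters {N : ℕ} [NeZero N] (u : LTwo) (lam γ : Fin N → ℝ) (ρ φ : ℝ) : Prop :=
  0 < ρ ∧
    FourierAtZeroPlus u
      (2 * Real.pi * I * (((Real.sqrt (2 * ρ) : ℝ) : ℂ) * Complex.exp (I * φ))) ∧
    IsGeneratorMatrix u lam (spectralMatrix lam γ ρ)

/-- `u` is recovered from the parameters on the closed upper half-plane: `M - z` is invertible and
`u(z)` is given by `inverseFormula`; on the real line this also holds almost everywhere for `u`
itself. -/
def RecoveredFrom {N : ℕ} [NeZero N] (u : LTwo) (lam γ : Fin N → ℝ) (ρ φ : ℝ) : Prop :=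
  (∀ z : ℂ, 0 ≤ z.im →
    IsUnit (spectralMatrix lam γ ρ - z • (1 : Matrix (Fin N) (Fin N) ℂ)) ∧
      hardyEval u z = inverseFormula lam γ ρ φ z) ∧
  ∀ᵐ x : ℝ, u x = inverseFormula lam γ ρ φ (x : ℂ)

/-- `u ∈ C(J; H²₊(ℝ))` solves `i ∂ₜu + ∂ₓₓu + (D + |D|)(|u|²) u = 0` on the time interval `J`, with
`∂ₜu` taken in `L²` (one-sided at an endpoint of `J`). Continuity in `H²` is continuity of `u` and
of `∂ₓₓu` in `L²`. -/
def IsSolutionOn (u : ℝ → LTwo) (J : Set ℝ) : Prop :=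
  (∀ t ∈ J, MemHardySobolev 2 (u t)) ∧ ContinuousOn u J ∧ ContinuousOn (fun t => opDxx (u t)) J ∧
    ∀ t ∈ J, ∃ v : LTwo, HasDerivWithinAt u v J t ∧
      I • v + opDxx (u t) + mulL2 (opDAbsD (mulL2 (conjFun (u t)) (u t))) (u t) = 0

end CMDNLS

end

open MeasureTheory Filter Topology Complex
open scoped FourierTransform SchwartzMap

noncomputable section

/-! Part (a) rests on three facts about `L_u`. First, commuting `L_u` with the modulation `e^{-isx}`
and letting `s → 0⁺` gives `|⟨u, ψ⟩|² = 2π ‖ψ‖²` for every eigenfunction (`norm_inner_sq_eq`). An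
eigenfunction orthogonal to `u` is therefore zero, so eigenvalues are simple and the normalisation
`⟨u, ψ_j⟩ = √(2π)` leaves no freedom. Second, for `u = P / Q` the identity for `P P̄` makes the
`N`-dimensional space `V = {A / Q}` invariant under `L_u` (`laxOp_mem_ratSpace`). The component of
an eigenfunction orthogonal to `V ∋ u` is again an eigenfunction or zero, hence zero, so the `ψ_j`
form an orthonormal basis of `V`. Third, on rational functions `G f = x f - ℓ` with `ℓ = lim x f`,
and an eigenfunction `f` for `μ` satisfies `μ ℓ = 0` and `L_u G f = μ G f - i f + (i / 2π) ⟨f, u⟩ u`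
(`ConjMulDecomp.laxOp_shift`). Pairing with `ψ_j` gives the off-diagonal entries of `M`; the tail
`ℓ_k` of `ψ_k` vanishes unless `λ_k = 0`; and the boundary term `⟨G f, f⟩ - ⟨f, G f⟩ = -2πi |ℓ|²`
gives the imaginary part of the diagonal, with `ρ = π |ℓ_1|²`. The row `(ψ_1(x), …, ψ_N(x))` then
solves `ψ (M - x) = -ℓ_1 Yᵀ`, so it is a multiple of the first row of `R = (M - x)⁻¹`, and expanding
`u` in the basis gives `u = c Yᵀ R X` with `|c|² = 2ρ`.

Conversely, for distinct `λ_j` with `λ_1 = 0`, any real `γ_j`, any `ρ > 0` and `|c|² = 2ρ`, the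
function `c Yᵀ R X` has exactly these spectral data. This is matrix algebra: with `Λ = diag(λ_j)`,
everything follows from `[Λ, M] = i (X Xᵀ - 1)`, `M* = M + 2iρ Y Yᵀ` and `Λ Y = 0`. The conclusions
of (a) are checked on this explicit family, which serves (b) as well.

For (b), let `γ_j` move with speed `2λ_j`. Then `M(t) = M(0) + 2tΛ` and `∂ₜR = -2 R Λ R`, while `(D
+ |D|)(|u|²) = -2 tr R²` and `∂ₓₓu = 2c Yᵀ R³ X`. The equation reduces to `Yᵀ R Λ R X = i (Yᵀ R X ·
tr R² - Yᵀ R³ X)`, which follows from the commutator identity and its trace `tr R² = Xᵀ R² X`. So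
the explicit family solves (CM-DNLS), and the given solution coincides with it by uniqueness in
`C(J; H²₊)` (`IsSolutionOn.unique`): in the `L²` energy estimate the only term with a derivative on
the difference drops out because `D + |D|` is self-adjoint, and Gronwall concludes. -/

namespace CMDNLS

/-! ### The `L²` Fourier transform and the Szegő projection -/

section

-- Smooth compactly supported functions are Schwartz, so the fundamental lemma of the calculus of
-- variations applies. Identities between `L²` transforms and Fourier integrals are all obtained by
-- this duality.
open scoped ContDiff in
theorem ae_eq_of_forall_schwartz {f g : ℝ → ℂ} (hf : LocallyIntegrable f)
    (hg : LocallyIntegrable g) (h : ∀ φ : 𝓢(ℝ, ℂ), ∫ x, φ x * f x = ∫ x, φ x * g x) :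
    f =ᵐ[volume] g := by
  apply ae_eq_of_integral_contDiff_smul_eq hf hg
  intro φ hφ hs
  have h1 : HasCompactSupport (fun x => (φ x : ℂ)) := hs.comp_left (g := Complex.ofReal) rfl
  have h2 : ContDiff ℝ ∞ fun x => (φ x : ℂ) := Complex.ofRealCLM.contDiff.comp hφ
  simpa using h (h1.toSchwartzMap h2)

theorem locallyIntegrable_lTwo (f : LTwo) : LocallyIntegrable f :=
  (Lp.memLp f).locallyIntegrable (by norm_num)

theorem integral_schwartz_mul_fourier (f : LTwo) (φ : 𝓢(ℝ, ℂ)) :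
    ∫ x, φ x * (𝓕 f : LTwo) x = ∫ x, (𝓕 φ) x * f x := by
  have := congrArg (fun T : 𝓢'(ℝ, ℂ) => T φ) (Lp.fourier_toTemperedDistribution_eq f)
  simpa [TemperedDistribution.fourier_apply] using this.symm

theorem integral_schwartz_mul_fourierInv (f : LTwo) (φ : 𝓢(ℝ, ℂ)) :
    ∫ x, φ x * (𝓕⁻ f : LTwo) x = ∫ x, (𝓕⁻ φ) x * f x := by
  have := congrArg (fun T : 𝓢'(ℝ, ℂ) => T φ) (Lp.fourierInv_toTemperedDistribution_eq f)
  simpa [TemperedDistribution.fourierInv_apply] using this.symm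

theorem integral_schwartz_mul_fourier_of_integrable {h : ℝ → ℂ} (hh : Integrable h)
    (φ : 𝓢(ℝ, ℂ)) : ∫ x, φ x * 𝓕 h x = ∫ x, (𝓕 φ) x * h x := by
  have := VectorFourier.integral_fourierIntegral_smul_eq_flip (μ := volume) (ν := volume)
    (L := innerₗ ℝ) (e := Real.fourierChar) Real.continuous_fourierChar
    (by exact continuous_inner) φ.integrable hh
  have h2 : VectorFourier.fourierIntegral Real.fourierChar volume (innerₗ ℝ).flip h = 𝓕 h := by
    rw [flip_innerₗ]; rfl
  rw [h2] at this
  exact this.symm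

theorem continuous_fourier {h : ℝ → ℂ} (hh : Integrable h) : Continuous (𝓕 h) :=
  VectorFourier.fourierIntegral_continuous Real.continuous_fourierChar
    (by exact continuous_inner) hh

theorem continuous_fourierInv {h : ℝ → ℂ} (hh : Integrable h) : Continuous (𝓕⁻ h) := by
  have : (𝓕⁻ h) = fun x => 𝓕 h (-x) := funext fun x => Real.fourierInv_eq_fourier_neg h x
  rw [this]
  exact (continuous_fourier hh).comp continuous_neg

theorem norm_fourierInv_le {h : ℝ → ℂ} (x : ℝ) : ‖𝓕⁻ h x‖ ≤ ∫ y, ‖h y‖ := by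
  rw [Real.fourierInv_eq_fourier_neg]
  exact VectorFourier.norm_fourierIntegral_le_integral_norm _ _ _ _ _

theorem integral_schwartz_mul_fourierInv_of_integrable {h : ℝ → ℂ} (hh : Integrable h)
    (φ : 𝓢(ℝ, ℂ)) : ∫ x, φ x * 𝓕⁻ h x = ∫ x, (𝓕⁻ φ) x * h x := by
  have := VectorFourier.integral_fourierIntegral_smul_eq_flip (μ := volume) (ν := volume)
    (L := -innerₗ ℝ) (e := Real.fourierChar) Real.continuous_fourierChar
    (by exact continuous_inner.neg) φ.integrable hh
  have h2 : VectorFourier.fourierIntegral Real.fourierChar volume (-innerₗ ℝ).flip h = 𝓕⁻ h := by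
    have : (-innerₗ ℝ).flip = -innerₗ ℝ := by
      ext; simp
    rw [this]; rfl
  rw [h2] at this
  rw [SchwartzMap.fourierInv_coe]
  exact this.symm

/-- An `L²` function with Fourier transform `a ∈ L¹` is the inverse Fourier integral of `a`. -/
theorem fourier_ae_eq_iff {a : ℝ → ℂ} (ha : Integrable a) (f : LTwo) :
    (𝓕 f : LTwo) =ᵐ[volume] a ↔ f =ᵐ[volume] 𝓕⁻ a := by
  constructor
  · intro h
    apply ae_eq_of_forall_schwartz (locallyIntegrable_lTwo f)
      (continuous_fourierInv ha).locallyIntegrable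
    intro φ
    rw [integral_schwartz_mul_fourierInv_of_integrable ha]
    have := integral_schwartz_mul_fourierInv (𝓕 f) φ
    rw [FourierTransform.fourierInv_fourier_eq] at this
    rw [this]
    apply integral_congr_ae
    filter_upwards [h] with x hx
    rw [hx]
  · intro h
    apply ae_eq_of_forall_schwartz (locallyIntegrable_lTwo _) ha.locallyIntegrable
    intro φ
    rw [integral_schwartz_mul_fourier]
    have := integral_schwartz_mul_fourierInv_of_integrable ha (𝓕 φ)
    rw [FourierTransform.fourierInv_fourier_eq] at this
    rw [← this]
    apply integral_congr_ae
    filter_upwards [h] with x hx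
    rw [hx]

/-- On `L¹ ∩ L²` the two Fourier transforms agree. -/
theorem fourier_ae_eq_of_integrable (f : LTwo) (hf : Integrable f) :
    (𝓕 f : LTwo) =ᵐ[volume] 𝓕 (f : ℝ → ℂ) := by
  apply ae_eq_of_forall_schwartz (locallyIntegrable_lTwo _)
    (continuous_fourier hf).locallyIntegrable
  intro φ
  rw [integral_schwartz_mul_fourier, integral_schwartz_mul_fourier_of_integrable hf]

theorem coeFn_mulL2 {b : ℝ → ℂ} {f : LTwo} (h : MemLp (fun x => b x * f x) 2) :
    mulL2 b f =ᵐ[volume] fun x => b x * f x := by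
  rw [mulL2, dif_pos h]
  exact h.coeFn_toLp

theorem fourier_fourierMul {m : ℝ → ℂ} {f : LTwo}
    (h : MemLp (fun η => m (2 * Real.pi * η) * (𝓕 f : LTwo) η) 2) :
    (𝓕 (fourierMul m f) : LTwo) =ᵐ[volume] fun η => m (2 * Real.pi * η) * (𝓕 f : LTwo) η := by
  rw [fourierMul, FourierTransform.fourier_fourierInv_eq]
  exact coeFn_mulL2 h

theorem lTwo_ext {f g : LTwo} (h : (𝓕 f : LTwo) =ᵐ[volume] (𝓕 g : LTwo)) : f = g :=
  (Lp.fourierTransformₗᵢ ℝ ℂ).injective (Lp.ext h)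

theorem fourier_szegoProj (f : LTwo) :
    (𝓕 (szegoProj f) : LTwo) =ᵐ[volume] (Set.Ici (0 : ℝ)).indicator (𝓕 f : LTwo) := by
  have key : (fun η => (Set.Ici (0 : ℝ)).indicator (1 : ℝ → ℂ) (2 * Real.pi * η) *
      (𝓕 f : LTwo) η) = (Set.Ici (0 : ℝ)).indicator (𝓕 f : LTwo) := by
    ext η
    by_cases h : 0 ≤ η
    · have : 0 ≤ 2 * Real.pi * η := by positivity
      simp [Set.indicator, h, this]
    · have : ¬ 0 ≤ 2 * Real.pi * η := by
        intro h'
        exact h (nonneg_of_mul_nonneg_right h' (by positivity))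
      simp [Set.indicator, h, this]
  have h := fourier_fourierMul (m := (Set.Ici (0 : ℝ)).indicator 1) (f := f)
    (by rw [key]; exact (Lp.memLp _).indicator measurableSet_Ici)
  rw [key] at h
  exact h

theorem memHardy_szegoProj (f : LTwo) : MemHardy (szegoProj f) := by
  filter_upwards [fourier_szegoProj f] with η h hη
  rw [h]
  simp [hη]

theorem szegoProj_of_memHardy {f : LTwo} (hf : MemHardy f) : szegoProj f = f := by
  apply lTwo_ext
  filter_upwards [fourier_szegoProj f, hf] with η h h2
  rw [h]
  by_cases h3 : 0 ≤ η
  · simp [h3]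
  · simp [h3, h2 (not_le.1 h3)]

end

/-! ### Functions with integrable Fourier transform: products, conjugates, modulations -/

section

/-- Functions of the Wiener algebra: `L²` functions with integrable Fourier transform. -/
def IsWiener (f : LTwo) : Prop := Integrable (𝓕 f : LTwo)

theorem IsWiener.ae_eq {f : LTwo} (hf : IsWiener f) : f =ᵐ[volume] 𝓕⁻ ((𝓕 f : LTwo) : ℝ → ℂ) :=
  (fourier_ae_eq_iff hf f).1 EventuallyEq.rfl

theorem isWiener_of_ae_eq {f : LTwo} {a : ℝ → ℂ} (ha : Integrable a)
    (h : (𝓕 f : LTwo) =ᵐ[volume] a) : IsWiener f :=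
  ha.congr h.symm

theorem IsWiener.norm_le {f : LTwo} (hf : IsWiener f) :
    ∀ᵐ x, ‖f x‖ ≤ ∫ η, ‖(𝓕 f : LTwo) η‖ := by
  filter_upwards [hf.ae_eq] with x hx
  rw [hx]
  exact norm_fourierInv_le x

theorem IsWiener.memLp_mul {f : LTwo} (hf : IsWiener f) (g : LTwo) :
    MemLp (fun x => f x * g x) 2 := by
  have h1 : MemLp f ⊤ (volume : Measure ℝ) :=
    memLp_top_of_bound (Lp.memLp f).1 _ hf.norm_le
  exact (Lp.memLp g).mul h1

/-- Convolution of functions on the line. -/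
def conv (a b : ℝ → ℂ) (η : ℝ) : ℂ := ∫ s, a s * b (η - s)

theorem conv_eq_convolution (a b : ℝ → ℂ) :
    conv a b = convolution a b (ContinuousLinearMap.mul ℂ ℂ) volume := rfl

theorem integrable_conv {a b : ℝ → ℂ} (ha : Integrable a) (hb : Integrable b) :
    Integrable (conv a b) := by
  rw [conv_eq_convolution]
  exact ha.integrable_convolution _ hb

theorem fourierInv_conv {a b : ℝ → ℂ} (ha : Integrable a) (hb : Integrable b) (x : ℝ) :
    𝓕⁻ (conv a b) x = 𝓕⁻ a x * 𝓕⁻ b x := by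
  simp only [Real.fourierInv_eq_fourier_neg]
  exact Real.fourier_mul_convolution_eq ha hb (-x)

theorem conv_congr_ae {a a' b b' : ℝ → ℂ} (h : a =ᵐ[volume] a') (h' : b =ᵐ[volume] b') :
    conv a b = conv a' b' := by
  ext η
  apply integral_congr_ae
  have h2 : (fun s => b (η - s)) =ᵐ[volume] fun s => b' (η - s) :=
    (Measure.measurePreserving_sub_left volume η).quasiMeasurePreserving.ae_eq_comp h'
  filter_upwards [h, h2] with s h3 h4
  rw [h3, h4]

theorem fourier_of_ae_eq_mul {f g F : LTwo} (hf : IsWiener f) (hg : IsWiener g)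
    (hF : F =ᵐ[volume] fun x => f x * g x) :
    (𝓕 F : LTwo) =ᵐ[volume] conv (𝓕 f : LTwo) (𝓕 g : LTwo) := by
  rw [fourier_ae_eq_iff (integrable_conv hf hg)]
  filter_upwards [hF, hf.ae_eq, hg.ae_eq] with x h1 h2 h3
  rw [h1, h2, h3, fourierInv_conv hf hg]

theorem isWiener_of_ae_eq_mul {f g F : LTwo} (hf : IsWiener f) (hg : IsWiener g)
    (hF : F =ᵐ[volume] fun x => f x * g x) : IsWiener F :=
  isWiener_of_ae_eq (integrable_conv hf hg) (fourier_of_ae_eq_mul hf hg hF)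

theorem integrable_conj_neg {a : ℝ → ℂ} (ha : Integrable a) :
    Integrable fun η => starRingEnd ℂ (a (-η)) :=
  (Complex.conjCLE.toContinuousLinearMap.integrable_comp ha).comp_neg

theorem fourierInv_conj_neg {a : ℝ → ℂ} (x : ℝ) :
    𝓕⁻ (fun η => starRingEnd ℂ (a (-η))) x = starRingEnd ℂ (𝓕⁻ a x) := by
  rw [Real.fourierInv_eq', Real.fourierInv_eq', ← integral_conj, ← integral_neg_eq_self]
  congr 1
  ext η
  simp [← Complex.exp_conj, Complex.conj_ofNat]

theorem fourier_of_ae_eq_conj {f F : LTwo} (hf : IsWiener f)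
    (hF : F =ᵐ[volume] fun x => starRingEnd ℂ (f x)) :
    (𝓕 F : LTwo) =ᵐ[volume] fun η => starRingEnd ℂ ((𝓕 f : LTwo) (-η)) := by
  rw [fourier_ae_eq_iff (integrable_conj_neg hf)]
  filter_upwards [hF, hf.ae_eq] with x h1 h2
  rw [h1, h2, fourierInv_conj_neg]

theorem star_ae_eq (f : LTwo) : (star f : LTwo) =ᵐ[volume] fun x => starRingEnd ℂ (f x) :=
  Lp.coeFn_star f

theorem fourier_star {f : LTwo} (hf : IsWiener f) :
    (𝓕 (star f) : LTwo) =ᵐ[volume] fun η => starRingEnd ℂ ((𝓕 f : LTwo) (-η)) :=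
  fourier_of_ae_eq_conj hf (star_ae_eq f)

theorem IsWiener.star {f : LTwo} (hf : IsWiener f) : IsWiener (star f) :=
  isWiener_of_ae_eq (integrable_conj_neg hf) (fourier_star hf)

theorem mulL2_congr {b c : ℝ → ℂ} (h : b =ᵐ[volume] c) (f : LTwo) : mulL2 b f = mulL2 c f := by
  have h2 : (fun x => b x * f x) =ᵐ[volume] fun x => c x * f x := by
    filter_upwards [h] with x hx
    rw [hx]
  by_cases h3 : MemLp (fun x => b x * f x) 2
  · have h4 := (memLp_congr_ae h2).1 h3
    rw [mulL2, mulL2, dif_pos h3, dif_pos h4]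
    exact MemLp.toLp_congr _ _ h2
  · have h4 : ¬ MemLp (fun x => c x * f x) 2 := fun h => h3 ((memLp_congr_ae h2).2 h)
    rw [mulL2, mulL2, dif_neg h3, dif_neg h4]

theorem coeFn_mulL2_wiener {f : LTwo} (hf : IsWiener f) (g : LTwo) :
    mulL2 f g =ᵐ[volume] fun x => f x * g x :=
  coeFn_mulL2 (hf.memLp_mul g)

theorem conjFun_ae_eq (f : LTwo) : conjFun f =ᵐ[volume] (star f : LTwo) :=
  (star_ae_eq f).symm

theorem mulL2_conjFun (f g : LTwo) : mulL2 (conjFun f) g = mulL2 (star f : LTwo) g :=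
  mulL2_congr (conjFun_ae_eq f) g

theorem coeFn_mulL2_conjFun {f : LTwo} (hf : IsWiener f) (g : LTwo) :
    mulL2 (conjFun f) g =ᵐ[volume] fun x => starRingEnd ℂ (f x) * g x := by
  rw [mulL2_conjFun]
  filter_upwards [coeFn_mulL2_wiener hf.star g, star_ae_eq f] with x h1 h2
  rw [h1, h2]

theorem IsWiener.mulL2 {f g : LTwo} (hf : IsWiener f) (hg : IsWiener g) :
    IsWiener (mulL2 f g) :=
  isWiener_of_ae_eq_mul hf hg (coeFn_mulL2_wiener hf g)

theorem fourier_mulL2 {f g : LTwo} (hf : IsWiener f) (hg : IsWiener g) :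
    (𝓕 (CMDNLS.mulL2 f g) : LTwo) =ᵐ[volume] conv (𝓕 f : LTwo) (𝓕 g : LTwo) :=
  fourier_of_ae_eq_mul hf hg (coeFn_mulL2_wiener hf g)

theorem IsWiener.szegoProj {f : LTwo} (hf : IsWiener f) : IsWiener (szegoProj f) :=
  isWiener_of_ae_eq (hf.indicator measurableSet_Ici) (fourier_szegoProj f)

/-- The character `x ↦ e^{-iηx}`. -/
def expChar (η : ℝ) (x : ℝ) : ℂ := Complex.exp (-(I * η * x))

theorem norm_expChar (η x : ℝ) : ‖expChar η x‖ = 1 := by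
  rw [expChar, Complex.norm_exp]
  simp

theorem memLp_expChar_mul (η : ℝ) (f : LTwo) : MemLp (fun x => expChar η x * f x) 2 := by
  have h1 : MemLp (expChar η) ⊤ (volume : Measure ℝ) := by
    refine memLp_top_of_bound ?_ 1 (ae_of_all _ fun x => (norm_expChar η x).le)
    apply Continuous.aestronglyMeasurable
    unfold expChar
    fun_prop
  exact (Lp.memLp f).mul h1

theorem coeFn_mulL2_expChar (η : ℝ) (f : LTwo) :
    mulL2 (expChar η) f =ᵐ[volume] fun x => expChar η x * f x :=
  coeFn_mulL2 (memLp_expChar_mul η f)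

theorem fourierInv_comp_add (a : ℝ → ℂ) (s x : ℝ) :
    𝓕⁻ (fun η => a (η + s / (2 * Real.pi))) x = expChar s x * 𝓕⁻ a x := by
  rw [Real.fourierInv_eq', Real.fourierInv_eq', ← integral_const_mul]
  rw [← integral_sub_right_eq_self _ (s / (2 * Real.pi))]
  congr 1
  ext η
  simp only [sub_add_cancel, smul_eq_mul, expChar, ← mul_assoc, ← Complex.exp_add]
  congr 2
  have : (Real.pi : ℂ) ≠ 0 := by exact_mod_cast Real.pi_ne_zero
  simp
  field_simp
  ring

theorem fourier_mulL2_expChar {f : LTwo} (hf : IsWiener f) (s : ℝ) :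
    (𝓕 (mulL2 (expChar s) f) : LTwo) =ᵐ[volume]
      fun η => (𝓕 f : LTwo) (η + s / (2 * Real.pi)) := by
  rw [fourier_ae_eq_iff (Integrable.comp_add_right hf _)]
  filter_upwards [coeFn_mulL2_expChar s f, hf.ae_eq] with x h1 h2
  rw [h1, h2, fourierInv_comp_add]

theorem conv_eq_zero_of_neg {a b : ℝ → ℂ} (ha : ∀ᵐ η : ℝ, η < 0 → a η = 0)
    (hb : ∀ᵐ η : ℝ, η < 0 → b η = 0) {η : ℝ} (hη : η < 0) : conv a b η = 0 := by
  apply integral_eq_zero_of_ae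
  have h2 : ∀ᵐ s : ℝ, η - s < 0 → b (η - s) = 0 :=
    (Measure.measurePreserving_sub_left volume η).quasiMeasurePreserving.ae hb
  filter_upwards [ha, h2] with s h3 h4
  by_cases h : s < 0
  · simp [h3 h]
  · simp [h4 (by linarith)]

theorem MemHardy.mulL2 {f g : LTwo} (hf : IsWiener f) (hg : IsWiener g) (hf' : MemHardy f)
    (hg' : MemHardy g) : MemHardy (mulL2 f g) := by
  filter_upwards [fourier_mulL2 hf hg] with η h hη
  rw [h, conv_eq_zero_of_neg hf' hg' hη]

theorem inner_eq_fourier (f g : LTwo) :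
    inner ℂ f g = ∫ η, starRingEnd ℂ ((𝓕 f : LTwo) η) * (𝓕 g : LTwo) η := by
  rw [← Lp.inner_fourier_eq, L2.inner_def]
  simp [RCLike.inner_apply, mul_comm]

theorem inner_eq_integral (f g : LTwo) :
    inner ℂ f g = ∫ x, starRingEnd ℂ (f x) * g x := by
  rw [L2.inner_def]
  simp [RCLike.inner_apply, mul_comm]

theorem inner_szegoProj_left (f g : LTwo) :
    inner ℂ (szegoProj f) g = inner ℂ (szegoProj f) (szegoProj g) := by
  rw [inner_eq_fourier, inner_eq_fourier]
  apply integral_congr_ae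
  filter_upwards [fourier_szegoProj f, fourier_szegoProj g] with η h1 h2
  rw [h1, h2]
  by_cases h : η ∈ Set.Ici (0 : ℝ) <;> simp [h]

theorem inner_szegoProj (f g : LTwo) : inner ℂ (szegoProj f) g = inner ℂ f (szegoProj g) := by
  rw [inner_szegoProj_left f g, ← inner_conj_symm f, inner_szegoProj_left g f, inner_conj_symm]

theorem inner_mulL2_left {f : LTwo} (hf : IsWiener f) (g h : LTwo) :
    inner ℂ (mulL2 f g) h = inner ℂ g (mulL2 (conjFun f) h) := by
  rw [inner_eq_integral, inner_eq_integral]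
  apply integral_congr_ae
  filter_upwards [coeFn_mulL2_wiener hf g, coeFn_mulL2_conjFun hf h] with x h1 h2
  rw [h1, h2, map_mul]
  ring

theorem integrable_conj_mul (f g : LTwo) :
    Integrable fun x => starRingEnd ℂ (f x) * g x := by
  have := L2.integrable_inner (𝕜 := ℂ) f g
  simpa [RCLike.inner_apply, mul_comm] using this

end

/-! ### Sobolev regularity on the Fourier side -/

section

/-- Both conditions ask the weighted transform to be an `L²` function. As distributions they are
compared by moving the weight onto the test function; local integrability of the weighted transform
upgrades equality of distributions to equality almost everywhere. -/
theorem memSobolev_iff (s : ℝ) (f : LTwo) :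
    TemperedDistribution.MemSobolev s 2 (f : 𝓢'(ℝ, ℂ)) ↔
      MemLp (fun η : ℝ => (((1 + η ^ 2) ^ (s / 2) : ℝ) : ℂ) * (𝓕 f : LTwo) η) 2 := by
  have hg : Function.HasTemperateGrowth
      fun x : ℝ => (((1 + ‖x‖ ^ 2) ^ (s / 2) : ℝ) : ℂ) := by fun_prop
  have hcont : Continuous fun x : ℝ => (((1 + x ^ 2) ^ (s / 2) : ℝ) : ℂ) := by
    simpa using hg.1.continuous
  have hloc : LocallyIntegrable
      (fun η : ℝ => (((1 + η ^ 2) ^ (s / 2) : ℝ) : ℂ) * (𝓕 f : LTwo) η) := by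
    rw [locallyIntegrable_iff]
    intro K hK
    exact ((locallyIntegrable_lTwo (𝓕 f)).integrableOn_isCompact hK).continuousOn_mul
      hcont.continuousOn hK
  rw [TemperedDistribution.memSobolev_iff_exists_smulLeftCLM_fourier,
    Lp.fourier_toTemperedDistribution_eq]
  have key : ∀ f' : LTwo, (TemperedDistribution.smulLeftCLM ℂ
      (fun x : ℝ => (((1 + ‖x‖ ^ 2) ^ (s / 2) : ℝ) : ℂ))) ((𝓕 f : LTwo) : 𝓢'(ℝ, ℂ)) =
        (f' : 𝓢'(ℝ, ℂ)) ↔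
      (fun η : ℝ => (((1 + η ^ 2) ^ (s / 2) : ℝ) : ℂ) * (𝓕 f : LTwo) η) =ᵐ[volume] f' := by
    intro f'
    have h1 : ∀ φ : 𝓢(ℝ, ℂ), (TemperedDistribution.smulLeftCLM ℂ
      (fun x : ℝ => (((1 + ‖x‖ ^ 2) ^ (s / 2) : ℝ) : ℂ))) ((𝓕 f : LTwo) : 𝓢'(ℝ, ℂ)) φ =
        ∫ η, φ η * ((((1 + η ^ 2) ^ (s / 2) : ℝ) : ℂ) * (𝓕 f : LTwo) η) := by
      intro φ
      rw [TemperedDistribution.smulLeftCLM_apply_apply, Lp.toTemperedDistribution_apply]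
      congr 1
      ext η
      rw [SchwartzMap.smulLeftCLM_apply_apply hg]
      simp only [smul_eq_mul, Real.norm_eq_abs, sq_abs]
      ring
    constructor
    · intro h
      apply ae_eq_of_forall_schwartz hloc (locallyIntegrable_lTwo f')
      intro φ
      rw [← h1, h, Lp.toTemperedDistribution_apply]
      simp
    · intro h
      ext φ
      rw [h1, Lp.toTemperedDistribution_apply]
      apply integral_congr_ae
      filter_upwards [h] with η hη
      rw [hη, smul_eq_mul]
  constructor
  · rintro ⟨f', hf'⟩
    exact (memLp_congr_ae ((key f').1 hf')).2 (Lp.memLp f')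
  · intro h
    exact ⟨h.toLp _, (key _).2 h.coeFn_toLp.symm⟩

theorem memLp_of_norm_le {f g : ℝ → ℂ} (hg : MemLp g 2) (hf : AEStronglyMeasurable f)
    (C : ℝ) (h : ∀ x, ‖f x‖ ≤ C * ‖g x‖) : MemLp f 2 :=
  hg.of_le_mul hf (ae_of_all _ h)

theorem aestronglyMeasurable_mul_fourier {m : ℝ → ℂ} (hm : Continuous m) (f : LTwo) :
    AEStronglyMeasurable fun η => m η * (𝓕 f : LTwo) η :=
  hm.aestronglyMeasurable.mul (Lp.memLp _).1

theorem memSobolev_one_iff (f : LTwo) :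
    TemperedDistribution.MemSobolev 1 2 (f : 𝓢'(ℝ, ℂ)) ↔
      MemLp (fun η : ℝ => (η : ℂ) * (𝓕 f : LTwo) η) 2 := by
  rw [memSobolev_iff]
  have hs : ∀ η : ℝ, (1 + η ^ 2) ^ ((1 : ℝ) / 2) = √(1 + η ^ 2) := fun η =>
    (Real.sqrt_eq_rpow _).symm
  simp only [hs]
  constructor
  · intro h
    refine memLp_of_norm_le h (aestronglyMeasurable_mul_fourier continuous_ofReal f) 1 ?_
    intro η
    rw [one_mul, norm_mul, norm_mul, norm_real, norm_real, Real.norm_eq_abs,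
      Real.norm_of_nonneg (Real.sqrt_nonneg _)]
    gcongr
    apply Real.le_sqrt_of_sq_le
    rw [sq_abs]
    linarith
  · intro h
    have h1 : MemLp (fun η : ℝ => ((1 + |η| : ℝ) : ℂ) * (𝓕 f : LTwo) η) 2 := by
      have h2 : MemLp (fun η : ℝ => ((|η| : ℝ) : ℂ) * (𝓕 f : LTwo) η) 2 := by
        refine memLp_of_norm_le h (aestronglyMeasurable_mul_fourier (by fun_prop) f) 1 ?_
        intro η
        simp
      refine ((Lp.memLp (𝓕 f : LTwo)).add h2).ae_eq (ae_of_all _ fun η => ?_)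
      simp only [Pi.add_apply]
      push_cast
      ring
    refine memLp_of_norm_le h1 (aestronglyMeasurable_mul_fourier (by fun_prop) f) 1 ?_
    intro η
    rw [one_mul, norm_mul, norm_mul, norm_real, norm_real,
      Real.norm_of_nonneg (Real.sqrt_nonneg _), Real.norm_of_nonneg (by positivity)]
    gcongr
    rw [Real.sqrt_le_left (by positivity)]
    nlinarith [abs_nonneg η, sq_abs η]

theorem memSobolev_two_iff (f : LTwo) :
    TemperedDistribution.MemSobolev 2 2 (f : 𝓢'(ℝ, ℂ)) ↔
      MemLp (fun η : ℝ => (η : ℂ) ^ 2 * (𝓕 f : LTwo) η) 2 := by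
  rw [memSobolev_iff]
  simp only [show (2 : ℝ) / 2 = 1 by norm_num, Real.rpow_one]
  constructor
  · intro h
    refine (h.sub (Lp.memLp (𝓕 f : LTwo))).ae_eq (ae_of_all _ fun η => ?_)
    simp only [Pi.sub_apply]
    push_cast
    ring
  · intro h
    refine ((Lp.memLp (𝓕 f : LTwo)).add h).ae_eq (ae_of_all _ fun η => ?_)
    simp only [Pi.add_apply]
    push_cast
    ring

theorem memLp_inv_sqrt : MemLp (fun η : ℝ => (((√(1 + η ^ 2))⁻¹ : ℝ) : ℂ)) 2 := by
  rw [memLp_two_iff_integrable_sq_norm]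
  · refine integrable_inv_one_add_sq.congr (ae_of_all _ fun η => ?_)
    simp only [norm_real, norm_inv, Real.norm_eq_abs, inv_pow, sq_abs]
    rw [Real.sq_sqrt (by positivity)]
  · apply Continuous.aestronglyMeasurable
    have : ∀ η : ℝ, √(1 + η ^ 2) ≠ 0 := fun η => by positivity
    fun_prop (disch := assumption)

/-- The function `(1 + η²)^{-1/2}`, an element of `L²`. -/
def invSqrt : LTwo := memLp_inv_sqrt.toLp _

theorem norm_sq_eq_integral (f : LTwo) : ‖f‖ ^ 2 = ∫ x, ‖f x‖ ^ 2 := by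
  have h := inner_self_eq_norm_sq_to_K (𝕜 := ℂ) f
  rw [inner_eq_integral] at h
  have h2 : ∀ x, starRingEnd ℂ (f x) * f x = ((‖f x‖ ^ 2 : ℝ) : ℂ) := by
    intro x
    rw [mul_comm, mul_conj, normSq_eq_norm_sq]
  simp only [h2] at h
  rw [integral_complex_ofReal] at h
  exact Complex.ofReal_injective (by rw [h]; exact Complex.ofReal_pow _ _)

theorem integrable_norm_mul_norm (f g : LTwo) : Integrable fun x => ‖f x‖ * ‖g x‖ := by
  refine (integrable_conj_mul f g).norm.congr (ae_of_all _ fun x => ?_)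
  simp

theorem integral_norm_mul_norm_le (f g : LTwo) : ∫ x, ‖f x‖ * ‖g x‖ ≤ ‖f‖ * ‖g‖ := by
  have h := integral_mul_norm_le_Lp_mul_Lq (μ := (volume : Measure ℝ)) (f := f) (g := g)
    Real.HolderConjugate.two_two (by simpa using Lp.memLp f) (by simpa using Lp.memLp g)
  refine h.trans (le_of_eq ?_)
  simp only [Real.rpow_two, ← norm_sq_eq_integral]
  rw [← Real.sqrt_eq_rpow, ← Real.sqrt_eq_rpow, Real.sqrt_sq (norm_nonneg _),
    Real.sqrt_sq (norm_nonneg _)]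

/-- Cauchy–Schwarz against `(1 + η²)^{-1/2} ∈ L²`. One Sobolev derivative thus gives boundedness and
the convolution formula for products. -/
theorem isWiener_of_memSobolev_one {f : LTwo}
    (hf : TemperedDistribution.MemSobolev 1 2 (f : 𝓢'(ℝ, ℂ))) : IsWiener f := by
  rw [memSobolev_iff] at hf
  have h := memLp_inv_sqrt.integrable_mul hf
  refine h.congr (ae_of_all _ fun η => ?_)
  simp only [Pi.mul_apply]
  rw [← Real.sqrt_eq_rpow, ← mul_assoc, ← ofReal_mul, inv_mul_cancel₀ (by positivity)]
  simp

theorem MemHardySobolev.isWiener {f : LTwo} (hf : MemHardySobolev 1 f) : IsWiener f :=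
  isWiener_of_memSobolev_one hf.2

theorem MemHardySobolev.one_of_two {f : LTwo} (hf : MemHardySobolev 2 f) : MemHardySobolev 1 f :=
  ⟨hf.1, hf.2.mono (by norm_num)⟩

theorem fourier_opD {f : LTwo} (hf : MemHardySobolev 1 f) :
    (𝓕 (opD f) : LTwo) =ᵐ[volume] fun η => ((2 * Real.pi * η : ℝ) : ℂ) * (𝓕 f : LTwo) η := by
  have h := (memSobolev_one_iff f).1 hf.2
  apply fourier_fourierMul
  refine (h.const_mul (2 * Real.pi : ℂ)).ae_eq (ae_of_all _ fun η => ?_)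
  simp only
  push_cast
  ring

theorem fourier_opDxx {f : LTwo} (hf : MemHardySobolev 2 f) :
    (𝓕 (opDxx f) : LTwo) =ᵐ[volume]
      fun η => -((2 * Real.pi * η : ℝ) : ℂ) ^ 2 * (𝓕 f : LTwo) η := by
  have h := (memSobolev_two_iff f).1 hf.2
  apply fourier_fourierMul
  refine (h.const_mul (-(2 * Real.pi : ℂ) ^ 2)).ae_eq (ae_of_all _ fun η => ?_)
  simp only
  push_cast
  ring

theorem inner_opD {f g : LTwo} (hf : MemHardySobolev 1 f) (hg : MemHardySobolev 1 g) :
    inner ℂ (opD f) g = inner ℂ f (opD g) := by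
  rw [inner_eq_fourier, inner_eq_fourier]
  apply integral_congr_ae
  filter_upwards [fourier_opD hf, fourier_opD hg] with η h1 h2
  rw [h1, h2, map_mul, conj_ofReal]
  ring

/-- Cauchy–Schwarz for `√(1 + η²) |f̂| = (1 + η²)^{-1/2} · (1 + η²) |f̂|`. The bounds are explicit
in `‖f‖ + ‖∂ₓₓf‖` because they must be locally uniform in time when they enter Gronwall's
inequality. -/
theorem MemHardySobolev.integrable_mul_fourier {f : LTwo} (hf : MemHardySobolev 2 f) :
    Integrable (fun η : ℝ => (η : ℂ) * (𝓕 f : LTwo) η) ∧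
      ∫ η : ℝ, ‖(𝓕 f : LTwo) η‖ ≤ ‖invSqrt‖ * (‖f‖ + ‖opDxx f‖) ∧
      ∫ η : ℝ, ‖(η : ℂ) * (𝓕 f : LTwo) η‖ ≤ ‖invSqrt‖ * (‖f‖ + ‖opDxx f‖) := by
  -- `g` is `(1 + η²) f̂`; the scalar undoes the factor `-(2π)²` that `∂ₓₓ` carries in the variable
  -- `η`.
  set g : LTwo := 𝓕 f + (-((2 * Real.pi : ℝ) : ℂ) ^ 2)⁻¹ • 𝓕 (opDxx f) with hg
  have hpi : ((2 * Real.pi : ℝ) : ℂ) ≠ 0 := by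
    exact_mod_cast (by positivity : (2 * Real.pi : ℝ) ≠ 0)
  have hgae : g =ᵐ[volume] fun η => ((1 + η ^ 2 : ℝ) : ℂ) * (𝓕 f : LTwo) η := by
    rw [hg]
    filter_upwards [Lp.coeFn_add (𝓕 f : LTwo) ((-((2 * Real.pi : ℝ) : ℂ) ^ 2)⁻¹ • 𝓕 (opDxx f)),
      Lp.coeFn_smul (-((2 * Real.pi : ℝ) : ℂ) ^ 2)⁻¹ (𝓕 (opDxx f) : LTwo), fourier_opDxx hf]
      with η h1 h2 h3
    rw [h1, Pi.add_apply, h2, Pi.smul_apply, h3, smul_eq_mul]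
    rw [ofReal_mul (2 * Real.pi) η]
    field_simp
    push_cast
    ring
  have hnorm : ‖g‖ ≤ ‖f‖ + ‖opDxx f‖ := by
    refine (norm_add_le _ _).trans ?_
    rw [norm_smul, Lp.norm_fourier_eq, Lp.norm_fourier_eq]
    gcongr
    refine mul_le_of_le_one_left (norm_nonneg _) ?_
    rw [norm_inv, norm_neg, norm_pow, norm_real]
    apply inv_le_one_of_one_le₀
    apply one_le_pow₀
    rw [Real.norm_of_nonneg (by positivity)]
    linarith [Real.pi_gt_three]
  have hI := integral_norm_mul_norm_le invSqrt g
  have hI2 := integrable_norm_mul_norm invSqrt g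
  have hprod : (fun x => ‖invSqrt x‖ * ‖g x‖) =ᵐ[volume]
      fun η => √(1 + η ^ 2) * ‖(𝓕 f : LTwo) η‖ := by
    filter_upwards [hgae, memLp_inv_sqrt.coeFn_toLp] with η h1 h2
    rw [invSqrt, h2, h1, norm_mul, norm_real, norm_real, Real.norm_of_nonneg (by positivity),
      Real.norm_of_nonneg (by positivity), ← mul_assoc]
    congr 1
    rw [inv_mul_eq_div, div_eq_iff (by positivity), Real.mul_self_sqrt (by positivity)]
  have hle : ∫ η, √(1 + η ^ 2) * ‖(𝓕 f : LTwo) η‖ ≤ ‖invSqrt‖ * (‖f‖ + ‖opDxx f‖) := by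
    rw [← integral_congr_ae hprod]
    exact hI.trans (by gcongr)
  have hint := hI2.congr hprod
  have b1 : ∀ η : ℝ, ‖(𝓕 f : LTwo) η‖ ≤ √(1 + η ^ 2) * ‖(𝓕 f : LTwo) η‖ := by
    intro η
    refine le_mul_of_one_le_left (norm_nonneg _) ?_
    rw [Real.one_le_sqrt]
    nlinarith [sq_nonneg η]
  have b2 : ∀ η : ℝ, ‖(η : ℂ) * (𝓕 f : LTwo) η‖ ≤ √(1 + η ^ 2) * ‖(𝓕 f : LTwo) η‖ := by
    intro η
    rw [norm_mul, norm_real, Real.norm_eq_abs]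
    gcongr
    apply Real.le_sqrt_of_sq_le
    rw [sq_abs]
    linarith
  have i2 : Integrable (fun η : ℝ => (η : ℂ) * (𝓕 f : LTwo) η) :=
    hint.mono' (aestronglyMeasurable_mul_fourier continuous_ofReal f) (ae_of_all _ b2)
  refine ⟨i2, ?_, ?_⟩
  · exact (integral_mono hf.one_of_two.isWiener.norm hint b1).trans hle
  · exact (integral_mono i2.norm hint b2).trans hle

end

/-! ### The Lax operator: symmetry, simplicity of eigenvalues, normalisation -/

section

theorem toeplitz_of_memHardy {u h : LTwo} (hu : IsWiener u) (hu' : MemHardy u) (hh : IsWiener h)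
    (hh' : MemHardy h) : toeplitz u h = mulL2 u h :=
  szegoProj_of_memHardy (MemHardy.mulL2 hu hh hu' hh')

theorem isWiener_mulL2_conjFun {u f : LTwo} (hu : IsWiener u) (hf : IsWiener f) :
    IsWiener (mulL2 (conjFun u) f) := by
  rw [mulL2_conjFun]
  exact hu.star.mulL2 hf

/-- The outer projection is superfluous: a product of two Hardy functions is Hardy. -/
theorem laxOp_eq {u f : LTwo} (hu : IsWiener u) (hu' : MemHardy u) (hf : IsWiener f) :
    laxOp u f = opD f - mulL2 u (szegoProj (mulL2 (conjFun u) f)) := by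
  rw [laxOp, show toeplitz (conjFun u) f = szegoProj (mulL2 (conjFun u) f) from rfl,
    toeplitz_of_memHardy hu hu' (isWiener_mulL2_conjFun hu hf).szegoProj (memHardy_szegoProj _)]

theorem inner_mulL2_right {u : LTwo} (hu : IsWiener u) (k h : LTwo) :
    inner ℂ k (mulL2 u h) = inner ℂ (mulL2 (conjFun u) k) h := by
  rw [← inner_conj_symm, inner_mulL2_left hu, inner_conj_symm]

theorem inner_laxOp {u f g : LTwo} (hu : IsWiener u) (hu' : MemHardy u)
    (hf : MemHardySobolev 1 f) (hg : MemHardySobolev 1 g) :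
    inner ℂ (laxOp u f) g = inner ℂ f (laxOp u g) := by
  rw [laxOp_eq hu hu' hf.isWiener, laxOp_eq hu hu' hg.isWiener, inner_sub_left, inner_sub_right,
    inner_opD hf hg, inner_mulL2_left hu, inner_mulL2_right hu, inner_szegoProj]

theorem mulL2_conjFun_expChar {u : LTwo} (hu : IsWiener u) (s : ℝ) (f : LTwo) :
    mulL2 (conjFun u) (mulL2 (expChar s) f) = mulL2 (expChar s) (mulL2 (conjFun u) f) := by
  apply Lp.ext
  filter_upwards [coeFn_mulL2_conjFun hu (mulL2 (expChar s) f), coeFn_mulL2_expChar s f,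
    coeFn_mulL2_conjFun hu f, coeFn_mulL2_expChar s (mulL2 (conjFun u) f)] with x h1 h2 h3 h4
  rw [h1, h2, h4, h3]
  ring

theorem conj_expChar (s x : ℝ) : starRingEnd ℂ (expChar s x) = expChar (-s) x := by
  simp [expChar, ← Complex.exp_conj]

theorem inner_expChar_neg (s : ℝ) (f g : LTwo) :
    inner ℂ (mulL2 (expChar (-s)) f) g = inner ℂ f (mulL2 (expChar s) g) := by
  rw [inner_eq_integral, inner_eq_integral]
  apply integral_congr_ae
  filter_upwards [coeFn_mulL2_expChar (-s) f, coeFn_mulL2_expChar s g] with x h1 h2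
  rw [h1, h2, map_mul, conj_expChar, neg_neg]
  ring

/-- Weak form of `D e^{-isx} = e^{-isx} (D - s)`, proved by translating frequencies by `σ = s / 2π`.
-/
theorem inner_opD_expChar {f : LTwo} (hf : MemHardySobolev 1 f) (s : ℝ) :
    inner ℂ (mulL2 (expChar (-s)) f) (opD f) - inner ℂ (opD f) (mulL2 (expChar s) f) =
      s * inner ℂ f (mulL2 (expChar s) f) := by
  set b := (𝓕 f : LTwo) with hb
  set σ := s / (2 * Real.pi) with hσ
  have hs : s = 2 * Real.pi * σ := by rw [hσ]; field_simp
  have hD := fourier_opD hf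
  have hm : mulL2 (expChar (-s)) f = mulL2 (expChar (-s)) f := rfl
  have e1 : inner ℂ (mulL2 (expChar (-s)) f) (opD f) =
      ∫ η : ℝ, starRingEnd ℂ (b η) * (((2 * Real.pi * (η + σ) : ℝ) : ℂ) * b (η + σ)) := by
    rw [inner_eq_fourier, ← integral_add_right_eq_self _ σ]
    apply integral_congr_ae
    have h1 := (measurePreserving_add_right volume σ).quasiMeasurePreserving.ae
      (fourier_mulL2_expChar hf.isWiener (-s))
    have h2 := (measurePreserving_add_right volume σ).quasiMeasurePreserving.ae hD
    filter_upwards [h1, h2] with η h3 h4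
    rw [h3, h4, neg_div, ← hσ, add_neg_cancel_right]
  have e2 : inner ℂ (opD f) (mulL2 (expChar s) f) =
      ∫ η : ℝ, starRingEnd ℂ (b η) * (((2 * Real.pi * η : ℝ) : ℂ) * b (η + σ)) := by
    rw [inner_eq_fourier]
    apply integral_congr_ae
    filter_upwards [fourier_mulL2_expChar hf.isWiener s, hD] with η h3 h4
    rw [h3, h4, map_mul, conj_ofReal]
    ring
  have e3 : inner ℂ f (mulL2 (expChar s) f) =
      ∫ η : ℝ, starRingEnd ℂ (b η) * b (η + σ) := by
    rw [inner_eq_fourier]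
    apply integral_congr_ae
    filter_upwards [fourier_mulL2_expChar hf.isWiener s] with η h3
    rw [h3]
  have i3 : Integrable fun η : ℝ => starRingEnd ℂ (b η) * b (η + σ) := by
    refine (integrable_conj_mul (𝓕 f : LTwo) (𝓕 (mulL2 (expChar s) f))).congr ?_
    filter_upwards [fourier_mulL2_expChar hf.isWiener s] with η h3
    rw [h3]
  have i2 : Integrable fun η : ℝ =>
      starRingEnd ℂ (b η) * (((2 * Real.pi * η : ℝ) : ℂ) * b (η + σ)) := by
    refine (integrable_conj_mul (𝓕 (opD f) : LTwo) (𝓕 (mulL2 (expChar s) f))).congr ?_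
    filter_upwards [fourier_mulL2_expChar hf.isWiener s, hD] with η h3 h4
    rw [h3, h4, map_mul, conj_ofReal]
    ring
  have e4 : ∀ η : ℝ, starRingEnd ℂ (b η) * (((2 * Real.pi * (η + σ) : ℝ) : ℂ) * b (η + σ)) =
      starRingEnd ℂ (b η) * (((2 * Real.pi * η : ℝ) : ℂ) * b (η + σ)) +
        (s : ℂ) * (starRingEnd ℂ (b η) * b (η + σ)) := by
    intro η
    rw [hs]
    push_cast
    ring
  rw [e1, e2, e3]
  simp only [e4]
  rw [integral_add i2 (i3.const_mul _), integral_const_mul]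
  ring

/-- The two inner products integrate the same function over `[0, ∞)` and `[σ, ∞)`. The commutator of
`Π₊` with a modulation therefore only sees the short frequency window `[0, σ]`. -/
theorem inner_szegoProj_expChar {g : LTwo} (hg : IsWiener g) {c : ℝ → ℂ}
    (hc : (𝓕 g : LTwo) =ᵐ[volume] c) {s : ℝ} (hs : 0 ≤ s) :
    inner ℂ (mulL2 (expChar (-s)) g) (szegoProj g) -
      inner ℂ (szegoProj g) (mulL2 (expChar s) g) =
      ∫ η in (0 : ℝ)..(s / (2 * Real.pi)), starRingEnd ℂ (c (η - s / (2 * Real.pi))) * c η := by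
  set σ := s / (2 * Real.pi) with hσ
  have hσ0 : 0 ≤ σ := by positivity
  have s1 := fourier_mulL2_expChar hg (-s)
  have s2 := fourier_mulL2_expChar hg s
  have c1 : ∀ τ : ℝ, ∀ᵐ η : ℝ, (𝓕 g : LTwo) (η + τ) = c (η + τ) := fun τ =>
    (measurePreserving_add_right volume τ).quasiMeasurePreserving.ae hc
  have e1 : inner ℂ (mulL2 (expChar (-s)) g) (szegoProj g) =
      ∫ η in Set.Ici (0 : ℝ), starRingEnd ℂ (c (η - σ)) * c η := by
    rw [inner_eq_fourier, ← integral_indicator measurableSet_Ici]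
    apply integral_congr_ae
    filter_upwards [s1, fourier_szegoProj g, hc, c1 (-σ)] with η h1 h2 h3 h4
    rw [h1, h2, neg_div, ← hσ, h4, ← sub_eq_add_neg]
    by_cases h : η ∈ Set.Ici (0 : ℝ) <;> simp [h, h3]
  have i1 : IntegrableOn (fun η => starRingEnd ℂ (c (η - σ)) * c η) (Set.Ici 0) := by
    rw [← integrable_indicator_iff measurableSet_Ici]
    refine (integrable_conj_mul (𝓕 (mulL2 (expChar (-s)) g) : LTwo) (𝓕 (szegoProj g))).congr ?_
    filter_upwards [s1, fourier_szegoProj g, hc, c1 (-σ)] with η h1 h2 h3 h4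
    rw [h1, h2, neg_div, ← hσ, h4, ← sub_eq_add_neg]
    by_cases h : η ∈ Set.Ici (0 : ℝ) <;> simp [h, h3]
  have e2 : inner ℂ (szegoProj g) (mulL2 (expChar s) g) =
      ∫ η in Set.Ici σ, starRingEnd ℂ (c (η - σ)) * c η := by
    rw [inner_eq_fourier, ← integral_indicator measurableSet_Ici,
      ← integral_add_right_eq_self
        ((Set.Ici σ).indicator fun η => starRingEnd ℂ (c (η - σ)) * c η) σ]
    apply integral_congr_ae
    filter_upwards [s2, fourier_szegoProj g, hc, c1 σ] with η h1 h2 h3 h4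
    rw [h1, h2, ← hσ, h4]
    by_cases h : 0 ≤ η <;> simp [Set.indicator, h, h3]
  have hdis : Disjoint (Set.Ico 0 σ) (Set.Ici σ) :=
    Set.disjoint_left.2 fun x h1 h2 => absurd h1.2 (not_lt.2 h2)
  rw [e1, e2, intervalIntegral.integral_of_le hσ0, ← integral_Ico_eq_integral_Ioc,
    ← Set.Ico_union_Ici_eq_Ici hσ0, setIntegral_union hdis measurableSet_Ici]
  · ring
  · exact i1.mono_set Set.Ico_subset_Ici_self
  · exact i1.mono_set (Set.Ici_subset_Ici.2 hσ0)

theorem continuous_inner_expChar (f g : LTwo) :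
    Continuous fun s : ℝ => inner ℂ f (mulL2 (expChar s) g) := by
  have h : ∀ s : ℝ, inner ℂ f (mulL2 (expChar s) g) =
      ∫ x, expChar s x * (starRingEnd ℂ (f x) * g x) := by
    intro s
    rw [inner_eq_integral]
    apply integral_congr_ae
    filter_upwards [coeFn_mulL2_expChar s g] with x h1
    rw [h1]
    ring
  simp only [h]
  refine continuous_of_dominated (bound := fun x => ‖starRingEnd ℂ (f x) * g x‖) ?_ ?_
    (integrable_conj_mul f g).norm ?_
  · intro s
    refine Continuous.aestronglyMeasurable ?_ |>.mul (integrable_conj_mul f g).1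
    unfold expChar
    fun_prop
  · intro s
    refine ae_of_all _ fun x => ?_
    rw [norm_mul, norm_expChar, one_mul]
  · refine ae_of_all _ fun x => ?_
    unfold expChar
    fun_prop

theorem mulL2_expChar_zero (f : LTwo) : mulL2 (expChar 0) f = f := by
  apply Lp.ext
  filter_upwards [coeFn_mulL2_expChar 0 f] with x h
  simp [h, expChar]

/-- The Fourier transform of `ū ψ` as a continuous function. -/
theorem exists_fourier_conj_mul {u f : LTwo} (hu : IsWiener u) :
    ∃ c : ℝ → ℂ, Continuous c ∧ (𝓕 (mulL2 (conjFun u) f) : LTwo) =ᵐ[volume] c ∧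
      c 0 = inner ℂ u f := by
  have h1 := coeFn_mulL2_conjFun hu f
  have h2 : Integrable (mulL2 (conjFun u) f) := (integrable_conj_mul u f).congr h1.symm
  refine ⟨_, continuous_fourier h2, fourier_ae_eq_of_integrable _ h2, ?_⟩
  rw [Real.fourier_real_eq, inner_eq_integral, ← integral_congr_ae h1]
  simp

/-- An eigenfunction `ψ` of `L_u` satisfies `|⟨u, ψ⟩|² = 2π ‖ψ‖²`. -/
theorem norm_inner_sq_eq {u ψ : LTwo} {μ : ℝ} (hu : IsWiener u) (hu' : MemHardy u)
    (hψ : SolvesEigenEq u μ ψ) : ‖inner ℂ u ψ‖ ^ 2 = 2 * Real.pi * ‖ψ‖ ^ 2 := by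
  obtain ⟨hS, hL⟩ := hψ
  have hW := hS.isWiener
  obtain ⟨c, hc, hgc, hc0⟩ := exists_fourier_conj_mul (f := ψ) hu
  set g := mulL2 (conjFun u) ψ with hg
  have hgW : IsWiener g := isWiener_mulL2_conjFun hu hW
  -- Substitute `D ψ = μ ψ + u Π₊(ū ψ)`. The `μ` terms cancel because `μ` is real, and
  -- multiplication by `ū` commutes with modulations, so the commutator of `D` must balance that of
  -- `Π₊`.
  have key : ∀ s : ℝ, 0 ≤ s → (s : ℂ) * inner ℂ ψ (mulL2 (expChar s) ψ) =
      ∫ η in (0 : ℝ)..(s / (2 * Real.pi)),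
        starRingEnd ℂ (c (η - s / (2 * Real.pi))) * c η := by
    intro s hs
    rw [← inner_opD_expChar hS, ← inner_szegoProj_expChar hgW hgc hs]
    have hDψ : opD ψ = (μ : ℂ) • ψ + mulL2 u (szegoProj g) := by
      rw [← hL, laxOp_eq hu hu' hW]
      abel
    rw [hDψ, inner_add_left, inner_add_right, inner_smul_left, inner_smul_right,
      inner_mulL2_left hu, inner_mulL2_right hu, mulL2_conjFun_expChar hu,
      mulL2_conjFun_expChar hu, inner_expChar_neg s ψ ψ, conj_ofReal]
    ring
  have hpi : (Real.pi : ℂ) ≠ 0 := by exact_mod_cast Real.pi_ne_zero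
  -- Rescaling the window `[0, σ]` to `[0, 1]` divides out `σ`. As `σ → 0⁺` the left side tends to
  -- `2π ‖ψ‖²` and the right side to `|c 0|² = |⟨u, ψ⟩|²`.
  have key2 : ∀ σ ∈ Set.Ioi (0 : ℝ), (2 * Real.pi : ℂ) *
      inner ℂ ψ (mulL2 (expChar (2 * Real.pi * σ)) ψ) =
      ∫ t in (0 : ℝ)..1, starRingEnd ℂ (c (t * σ - σ)) * c (t * σ) := by
    intro σ hσ
    have hσ' : σ ≠ 0 := ne_of_gt hσ
    have hσc : (σ : ℂ) ≠ 0 := by exact_mod_cast hσ'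
    have h1 := key (2 * Real.pi * σ) (by have := Set.mem_Ioi.1 hσ; positivity)
    have h2 : 2 * Real.pi * σ / (2 * Real.pi) = σ := by field_simp
    rw [h2] at h1
    have h3 := intervalIntegral.integral_comp_mul_right (a := 0) (b := 1)
      (fun η => starRingEnd ℂ (c (η - σ)) * c η) hσ'
    rw [h3, zero_mul, one_mul, ← h1]
    rw [Complex.real_smul]
    push_cast
    field_simp
  have t1 : Tendsto (fun σ : ℝ => (2 * Real.pi : ℂ) *
      inner ℂ ψ (mulL2 (expChar (2 * Real.pi * σ)) ψ)) (𝓝[>] 0)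
      (𝓝 ((2 * Real.pi : ℂ) * inner ℂ ψ (mulL2 (expChar (2 * Real.pi * 0)) ψ))) := by
    have : Continuous fun σ : ℝ => (2 * Real.pi : ℂ) *
      inner ℂ ψ (mulL2 (expChar (2 * Real.pi * σ)) ψ) :=
      continuous_const.mul ((continuous_inner_expChar ψ ψ).comp (continuous_const.mul continuous_id))
    exact (this.tendsto 0).mono_left nhdsWithin_le_nhds
  have t2 : Tendsto (fun σ : ℝ =>
      ∫ t in (0 : ℝ)..1, starRingEnd ℂ (c (t * σ - σ)) * c (t * σ)) (𝓝[>] 0)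
      (𝓝 (∫ t in (0 : ℝ)..1, starRingEnd ℂ (c (t * 0 - 0)) * c (t * 0))) := by
    have : Continuous fun σ : ℝ =>
        ∫ t in (0 : ℝ)..1, starRingEnd ℂ (c (t * σ - σ)) * c (t * σ) := by
      apply intervalIntegral.continuous_parametric_intervalIntegral_of_continuous'
      have := Complex.continuous_conj
      fun_prop
    exact (this.tendsto 0).mono_left nhdsWithin_le_nhds
  have h := tendsto_nhds_unique (t1.congr' (eventually_nhdsWithin_of_forall key2)) t2
  simp only [mul_zero, mulL2_expChar_zero, sub_zero, intervalIntegral.integral_const,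
    one_smul, hc0] at h
  rw [mul_comm (starRingEnd ℂ _), mul_conj, normSq_eq_norm_sq, inner_self_eq_norm_sq_to_K] at h
  have h' : ((2 * Real.pi * ‖ψ‖ ^ 2 : ℝ) : ℂ) = ((‖inner ℂ u ψ‖ ^ 2 : ℝ) : ℂ) := by
    rw [← h]
    push_cast
    rfl
  exact (Complex.ofReal_injective h').symm

theorem mulL2_add {b : ℝ → ℂ} {f g : LTwo} (hf : MemLp (fun x => b x * f x) 2)
    (hg : MemLp (fun x => b x * g x) 2) : mulL2 b (f + g) = mulL2 b f + mulL2 b g := by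
  have h : (fun x => b x * (f + g : LTwo) x) =ᵐ[volume]
      (fun x => b x * f x) + fun x => b x * g x := by
    filter_upwards [Lp.coeFn_add f g] with x h1
    rw [h1, Pi.add_apply, Pi.add_apply, mul_add]
  have hm := (memLp_congr_ae h).2 (hf.add hg)
  apply Lp.ext
  filter_upwards [coeFn_mulL2 hf, coeFn_mulL2 hg, coeFn_mulL2 hm, Lp.coeFn_add (mulL2 b f)
    (mulL2 b g), h] with x h1 h2 h3 h4 h5
  rw [h3, h4, h5, Pi.add_apply, Pi.add_apply, h1, h2]

theorem mulL2_smul {b : ℝ → ℂ} {f : LTwo} (c : ℂ) (hf : MemLp (fun x => b x * f x) 2) :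
    mulL2 b (c • f) = c • mulL2 b f := by
  have h : (fun x => b x * (c • f : LTwo) x) =ᵐ[volume] c • fun x => b x * f x := by
    filter_upwards [Lp.coeFn_smul c f] with x h1
    rw [h1, Pi.smul_apply, Pi.smul_apply, smul_eq_mul, smul_eq_mul]
    ring
  have hm := (memLp_congr_ae h).2 (hf.const_smul c)
  apply Lp.ext
  filter_upwards [coeFn_mulL2 hf, coeFn_mulL2 hm, Lp.coeFn_smul c (mulL2 b f), h] with x h1 h3 h4 h5
  rw [h3, h4, h5, Pi.smul_apply, Pi.smul_apply, h1]

theorem fourierL2_add (f g : LTwo) : (𝓕 (f + g) : LTwo) = 𝓕 f + 𝓕 g :=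
  (Lp.fourierTransformₗᵢ ℝ ℂ).map_add f g

theorem fourierL2_smul (c : ℂ) (f : LTwo) : (𝓕 (c • f) : LTwo) = c • 𝓕 f :=
  (Lp.fourierTransformₗᵢ ℝ ℂ).map_smul c f

theorem fourierInvL2_add (f g : LTwo) : (𝓕⁻ (f + g) : LTwo) = 𝓕⁻ f + 𝓕⁻ g :=
  (Lp.fourierTransformₗᵢ ℝ ℂ).symm.map_add f g

theorem fourierInvL2_smul (c : ℂ) (f : LTwo) : (𝓕⁻ (c • f) : LTwo) = c • 𝓕⁻ f :=
  (Lp.fourierTransformₗᵢ ℝ ℂ).symm.map_smul c f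

/-- The domain of the Fourier multiplier `m(D)`. -/
def MemMulDomain (m : ℝ → ℂ) (f : LTwo) : Prop :=
  MemLp (fun η => m (2 * Real.pi * η) * (𝓕 f : LTwo) η) 2

theorem fourierMul_add {m : ℝ → ℂ} {f g : LTwo} (hf : MemMulDomain m f) (hg : MemMulDomain m g) :
    fourierMul m (f + g) = fourierMul m f + fourierMul m g := by
  rw [fourierMul, fourierL2_add, mulL2_add hf hg, fourierInvL2_add]
  rfl

theorem fourierMul_smul {m : ℝ → ℂ} {f : LTwo} (c : ℂ) (hf : MemMulDomain m f) :
    fourierMul m (c • f) = c • fourierMul m f := by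
  rw [fourierMul, fourierL2_smul, mulL2_smul c hf, fourierInvL2_smul]
  rfl

theorem memMulDomain_szego (f : LTwo) : MemMulDomain ((Set.Ici (0 : ℝ)).indicator 1) f := by
  have h : MemLp ((Set.Ici (0 : ℝ)).indicator (𝓕 f : LTwo)) 2 :=
    (Lp.memLp _).indicator measurableSet_Ici
  refine h.ae_eq (ae_of_all _ fun η => ?_)
  by_cases h : 0 ≤ η
  · have : 0 ≤ 2 * Real.pi * η := by positivity
    simp [Set.indicator, h, this]
  · have : ¬ 0 ≤ 2 * Real.pi * η := by
      intro h'
      exact h (nonneg_of_mul_nonneg_right h' (by positivity))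
    simp [Set.indicator, h, this]

theorem szegoProj_add (f g : LTwo) : szegoProj (f + g) = szegoProj f + szegoProj g :=
  fourierMul_add (memMulDomain_szego f) (memMulDomain_szego g)

theorem szegoProj_smul (c : ℂ) (f : LTwo) : szegoProj (c • f) = c • szegoProj f :=
  fourierMul_smul c (memMulDomain_szego f)

theorem MemHardy.add {f g : LTwo} (hf : MemHardy f) (hg : MemHardy g) : MemHardy (f + g) := by
  rw [MemHardy, fourierL2_add]
  filter_upwards [Lp.coeFn_add (𝓕 f : LTwo) (𝓕 g), hf, hg] with η h1 h2 h3 h4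
  rw [h1, Pi.add_apply, h2 h4, h3 h4, add_zero]

theorem MemHardy.smul {f : LTwo} (c : ℂ) (hf : MemHardy f) : MemHardy (c • f) := by
  rw [MemHardy, fourierL2_smul]
  filter_upwards [Lp.coeFn_smul c (𝓕 f : LTwo), hf] with η h1 h2 h4
  rw [h1, Pi.smul_apply, h2 h4, smul_zero]

theorem MemHardySobolev.add {s : ℝ} {f g : LTwo} (hf : MemHardySobolev s f)
    (hg : MemHardySobolev s g) : MemHardySobolev s (f + g) := by
  refine ⟨hf.1.add hg.1, ?_⟩
  have := hf.2.add hg.2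
  rwa [← Lp.toTemperedDistributionCLM_apply, ← Lp.toTemperedDistributionCLM_apply, ← map_add,
    Lp.toTemperedDistributionCLM_apply] at this

theorem MemHardySobolev.smul {s : ℝ} {f : LTwo} (c : ℂ) (hf : MemHardySobolev s f) :
    MemHardySobolev s (c • f) := by
  refine ⟨hf.1.smul c, ?_⟩
  have := hf.2.smul c
  rwa [← Lp.toTemperedDistributionCLM_apply, ← map_smul,
    Lp.toTemperedDistributionCLM_apply] at this

theorem memMulDomain_opD {f : LTwo} (hf : MemHardySobolev 1 f) :
    MemMulDomain (fun ξ => (ξ : ℂ)) f := by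
  have h := (memSobolev_one_iff f).1 hf.2
  refine (h.const_mul (2 * Real.pi : ℂ)).ae_eq (ae_of_all _ fun η => ?_)
  simp only
  push_cast
  ring

theorem laxOp_add {u f g : LTwo} (hu : IsWiener u) (hf : MemHardySobolev 1 f)
    (hg : MemHardySobolev 1 g) : laxOp u (f + g) = laxOp u f + laxOp u g := by
  simp only [laxOp, toeplitz]
  rw [opD, fourierMul_add (memMulDomain_opD hf) (memMulDomain_opD hg), ← opD, ← opD,
    mulL2_conjFun, mulL2_add (hu.star.memLp_mul f) (hu.star.memLp_mul g), szegoProj_add,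
    mulL2_add (hu.memLp_mul _) (hu.memLp_mul _), szegoProj_add, mulL2_conjFun, mulL2_conjFun]
  abel

theorem laxOp_smul {u f : LTwo} (c : ℂ) (hu : IsWiener u) (hf : MemHardySobolev 1 f) :
    laxOp u (c • f) = c • laxOp u f := by
  simp only [laxOp, toeplitz]
  rw [opD, fourierMul_smul c (memMulDomain_opD hf), ← opD,
    mulL2_conjFun, mulL2_smul c (hu.star.memLp_mul f), szegoProj_smul,
    mulL2_smul c (hu.memLp_mul _), szegoProj_smul, mulL2_conjFun, smul_sub]

theorem MemHardySobolev.sub {s : ℝ} {f g : LTwo} (hf : MemHardySobolev s f)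
    (hg : MemHardySobolev s g) : MemHardySobolev s (f - g) := by
  have := hf.add (hg.smul (-1))
  rwa [neg_one_smul, ← sub_eq_add_neg] at this

theorem laxOp_sub {u f g : LTwo} (hu : IsWiener u) (hf : MemHardySobolev 1 f)
    (hg : MemHardySobolev 1 g) : laxOp u (f - g) = laxOp u f - laxOp u g := by
  have := laxOp_add hu hf (hg.smul (-1))
  rwa [laxOp_smul _ hu hg, neg_one_smul, neg_one_smul, ← sub_eq_add_neg, ← sub_eq_add_neg] at this

theorem SolvesEigenEq.sub {u ψ χ : LTwo} {μ : ℝ} (hu : IsWiener u)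
    (h1 : SolvesEigenEq u μ ψ) (h2 : SolvesEigenEq u μ χ) : SolvesEigenEq u μ (ψ - χ) :=
  ⟨h1.1.sub h2.1, by rw [laxOp_sub hu h1.1 h2.1, h1.2, h2.2, smul_sub]⟩

theorem SolvesEigenEq.smul {u ψ : LTwo} {μ : ℝ} (c : ℂ) (hu : IsWiener u)
    (h1 : SolvesEigenEq u μ ψ) : SolvesEigenEq u μ (c • ψ) :=
  ⟨h1.1.smul c, by rw [laxOp_smul c hu h1.1, h1.2, smul_comm]⟩

theorem SolvesEigenEq.eq_zero {u ψ : LTwo} {μ : ℝ} (hu : IsWiener u) (hu' : MemHardy u)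
    (h : SolvesEigenEq u μ ψ) (h0 : inner ℂ u ψ = 0) : ψ = 0 := by
  have := norm_inner_sq_eq hu hu' h
  rw [h0, norm_zero, zero_pow two_ne_zero] at this
  have h2 : (2 * Real.pi : ℝ) ≠ 0 := by positivity
  simpa [h2] using this.symm

theorem SolvesEigenEq.inner_eq_zero {u ψ χ : LTwo} {μ ν : ℝ} (hu : IsWiener u) (hu' : MemHardy u)
    (h1 : SolvesEigenEq u μ ψ) (h2 : SolvesEigenEq u ν χ) (hne : μ ≠ ν) : inner ℂ ψ χ = 0 := by
  have h := inner_laxOp hu hu' h1.1 h2.1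
  rw [h1.2, h2.2, inner_smul_left, inner_smul_right, conj_ofReal] at h
  have h3 : ((μ : ℂ) - ν) * inner ℂ ψ χ = 0 := by rw [sub_mul, h, sub_self]
  rcases mul_eq_zero.1 h3 with h4 | h4
  · exact absurd (by exact_mod_cast sub_eq_zero.1 h4) hne
  · exact h4

/-- The difference of two normalised eigenfunctions for the same eigenvalue solves the eigenvalue
equation and is orthogonal to `u`, so it vanishes. -/
theorem IsNormalizedEigenbasis.unique {N : ℕ} {u : LTwo} {lam : Fin N → ℝ} {ψ χ : Fin N → LTwo}
    (hu : IsWiener u) (hu' : MemHardy u) (h1 : IsNormalizedEigenbasis u lam ψ)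
    (h2 : IsNormalizedEigenbasis u lam χ) : ψ = χ := by
  ext1 j
  rw [← sub_eq_zero]
  apply ((h1 j).1.sub hu (h2 j).1).eq_zero hu hu'
  rw [inner_sub_right, ← inner_conj_symm, (h1 j).2.2, ← inner_conj_symm u, (h2 j).2.2, sub_self]

/-- Every eigenfunction can be normalised. -/
theorem SolvesEigenEq.exists_normalized {u ψ : LTwo} {μ : ℝ} (hu : IsWiener u) (hu' : MemHardy u)
    (h : SolvesEigenEq u μ ψ) (h0 : ψ ≠ 0) : ∃ α : ℂ, SolvesEigenEq u μ (α • ψ) ∧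
      ‖α • ψ‖ = 1 ∧ inner ℂ (α • ψ) u = ((√(2 * Real.pi) : ℝ) : ℂ) := by
  have hne : inner ℂ ψ u ≠ 0 := fun h1 => h0 (h.eq_zero hu hu' (by
    rw [← inner_conj_symm, h1, map_zero]))
  -- The scalar only fixes the inner product with `u` (conjugated, since it sits in the antilinear
  -- slot); the unit norm is then automatic from `norm_inner_sq_eq`.
  refine ⟨starRingEnd ℂ (((√(2 * Real.pi) : ℝ) : ℂ) / inner ℂ ψ u), h.smul _ hu, ?_⟩
  have h3 : inner ℂ (starRingEnd ℂ (((√(2 * Real.pi) : ℝ) : ℂ) / inner ℂ ψ u) • ψ) u =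
      ((√(2 * Real.pi) : ℝ) : ℂ) := by
    rw [inner_smul_left, conj_conj, div_mul_cancel₀ _ hne]
  refine ⟨?_, h3⟩
  have h4 := norm_inner_sq_eq hu hu' (h.smul (starRingEnd ℂ (((√(2 * Real.pi) : ℝ) : ℂ) /
    inner ℂ ψ u)) hu)
  rw [← inner_conj_symm, h3, conj_ofReal, norm_real, Real.norm_of_nonneg (Real.sqrt_nonneg _),
    Real.sq_sqrt (by positivity)] at h4
  have h5 : (2 * Real.pi : ℝ) ≠ 0 := by positivity
  have h6 := mul_left_cancel₀ h5 ((mul_one _).trans h4)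
  exact (pow_eq_one_iff_of_nonneg (norm_nonneg _) two_ne_zero).1 h6.symm

end

/-! ### Rational Hardy functions and their Fourier profiles -/

section

/-- The closed upper half-plane. -/
abbrev ClosedUHP : Type := {z : ℂ // 0 ≤ z.im}

/-- The inclusion of the real line in the closed upper half-plane. -/
def ofReal' (x : ℝ) : ClosedUHP := ⟨x, by simp⟩

@[simp] theorem coe_ofReal' (x : ℝ) : ((ofReal' x : ClosedUHP) : ℂ) = x := rfl

/-- The function `z ↦ (z - p)^{-(k+1)}`. -/
def pole (p : ℂ) (k : ℕ) : ClosedUHP → ℂ := fun z => (((z : ℂ) - p) ^ (k + 1))⁻¹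

/-- The Fourier profile of `pole p k`. -/
def poleProfile (p : ℂ) (k : ℕ) (η : ℝ) : ℂ :=
  (-(2 * Real.pi * I)) ^ (k + 1) / k.factorial * (η : ℂ) ^ k *
    Complex.exp (-(2 * Real.pi * I * p * η))

theorem continuous_poleProfile (p : ℂ) (k : ℕ) : Continuous (poleProfile p k) := by
  unfold poleProfile
  fun_prop

theorem norm_poleProfile (p : ℂ) (k : ℕ) {η : ℝ} (hη : 0 < η) :
    ‖poleProfile p k η‖ = (2 * Real.pi) ^ (k + 1) / k.factorial *
      (η ^ (k : ℝ) * Real.exp (-(-(2 * Real.pi * p.im)) * η ^ (1 : ℝ))) := by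
  rw [poleProfile, norm_mul, norm_mul, Complex.norm_exp, norm_div, norm_pow, norm_neg, norm_pow,
    norm_real, Real.norm_of_nonneg hη.le, Real.rpow_natCast, Real.rpow_one, mul_assoc]
  have h1 : ‖(2 * Real.pi * I : ℂ)‖ = 2 * Real.pi := by
    simp [abs_of_pos Real.pi_pos]
  have h2 : (-(2 * Real.pi * I * p * η) : ℂ).re = -(-(2 * Real.pi * p.im)) * η := by
    simp
  rw [h1, h2]
  simp

theorem integrableOn_poleProfile {p : ℂ} (hp : p.im < 0) (k : ℕ) :
    IntegrableOn (poleProfile p k) (Set.Ioi 0) := by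
  have hb : 0 < -(2 * Real.pi * p.im) := by
    have := mul_neg_of_pos_of_neg (by positivity : 0 < 2 * Real.pi) hp
    linarith
  have h := integrableOn_rpow_mul_exp_neg_mul_rpow (p := 1) (s := k)
    (by have := Nat.cast_nonneg (α := ℝ) k; linarith) one_pos hb
  refine Integrable.mono' (h.const_mul ((2 * Real.pi) ^ (k + 1) / k.factorial))
    (continuous_poleProfile p k).aestronglyMeasurable ?_
  filter_upwards [ae_restrict_mem measurableSet_Ioi] with η hη
  rw [norm_poleProfile p k hη]

theorem memLp_indicator_poleProfile {p : ℂ} (hp : p.im < 0) (k : ℕ) :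
    MemLp ((Set.Ioi (0 : ℝ)).indicator (poleProfile p k)) 2 := by
  rw [memLp_indicator_iff_restrict measurableSet_Ioi, memLp_two_iff_integrable_sq_norm
    (continuous_poleProfile p k).aestronglyMeasurable]
  have hb : 0 < 2 * (-(2 * Real.pi * p.im)) := by
    have := mul_neg_of_pos_of_neg (by positivity : 0 < 2 * Real.pi) hp
    linarith
  have h := integrableOn_rpow_mul_exp_neg_mul_rpow (p := 1) (s := (2 * k : ℕ))
    (by have := Nat.cast_nonneg (α := ℝ) (2 * k); linarith) one_pos hb
  refine (h.const_mul (((2 * Real.pi) ^ (k + 1) / k.factorial) ^ 2)).congr ?_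
  filter_upwards [ae_restrict_mem measurableSet_Ioi] with η hη
  rw [norm_poleProfile p k hη, mul_pow _ _ 2, mul_pow (η ^ (k : ℝ)), ← Real.exp_nat_mul,
    Real.rpow_natCast, Real.rpow_natCast, pow_mul' η 2 k, Real.rpow_one]
  congr 3
  push_cast
  ring

theorem integral_pow_mul_exp {s : ℂ} (hs : 0 < s.re) (k : ℕ) :
    IntegrableOn (fun η : ℝ => (η : ℂ) ^ k * Complex.exp (-(s * η))) (Set.Ioi 0) ∧
      ∫ η in Set.Ioi (0 : ℝ), (η : ℂ) ^ k * Complex.exp (-(s * η)) =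
        k.factorial / s ^ (k + 1) := by
  have hs0 : s ≠ 0 := fun h => by simp [h] at hs
  have hnorm : ∀ (m : ℕ) (η : ℝ), 0 < η → ‖(η : ℂ) ^ m * Complex.exp (-(s * η))‖ =
      η ^ (m : ℝ) * Real.exp (-s.re * η) := by
    intro m η hη
    rw [norm_mul, norm_pow, norm_real, Real.norm_of_nonneg hη.le, Complex.norm_exp,
      Real.rpow_natCast]
    simp
  have hint : ∀ m : ℕ,
      IntegrableOn (fun η : ℝ => (η : ℂ) ^ m * Complex.exp (-(s * η))) (Set.Ioi 0) := by
    intro m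
    have h := integrableOn_rpow_mul_exp_neg_mul_rpow (p := 1) (s := m)
      (by have := Nat.cast_nonneg (α := ℝ) m; linarith) one_pos hs
    refine Integrable.mono' h (Continuous.aestronglyMeasurable (by fun_prop)) ?_
    filter_upwards [ae_restrict_mem measurableSet_Ioi] with η hη
    rw [hnorm m η hη, Real.rpow_one]
  refine ⟨hint k, ?_⟩
  induction k with
  | zero =>
    have h := integral_exp_mul_complex_Ioi (a := -s) (by simpa using hs) 0
    simp only [pow_zero, one_mul, zero_add, pow_one, Nat.factorial_zero, Nat.cast_one]
    simpa using h
  | succ k ih =>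
    -- Integration by parts: the boundary term `-η^{k+1} e^{-sη} / s` vanishes at both ends and
    -- relates the exponents `k + 1` and `k`.
    have hderiv : ∀ η : ℝ, HasDerivAt
        (fun η : ℝ => -((η : ℂ) ^ (k + 1) * Complex.exp (-(s * η))) / s)
        ((η : ℂ) ^ (k + 1) * Complex.exp (-(s * η)) -
          ((k + 1 : ℕ) : ℂ) / s * ((η : ℂ) ^ k * Complex.exp (-(s * η)))) η := by
      intro η
      have h1 : HasDerivAt (fun z : ℂ => -(z ^ (k + 1) * Complex.exp (-(s * z))) / s)
          (-(((k + 1 : ℕ) : ℂ) * (η : ℂ) ^ k * Complex.exp (-(s * η)) +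
            (η : ℂ) ^ (k + 1) * (Complex.exp (-(s * η)) * -(s * 1))) / s) (η : ℂ) := by
        have h2 := (hasDerivAt_pow (k + 1) (η : ℂ)).mul
          (((hasDerivAt_id (η : ℂ)).const_mul s).neg.cexp)
        exact (h2.neg).div_const s
      convert h1.comp_ofReal using 1
      field_simp
      ring
    have hlim : Tendsto (fun η : ℝ => -((η : ℂ) ^ (k + 1) * Complex.exp (-(s * η))) / s)
        atTop (𝓝 0) := by
      have h1 : Tendsto (fun η : ℝ => (η : ℂ) ^ (k + 1) * Complex.exp (-(s * η))) atTop
          (𝓝 0) := by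
        rw [tendsto_zero_iff_norm_tendsto_zero]
        refine (tendsto_rpow_mul_exp_neg_mul_atTop_nhds_zero ((k + 1 : ℕ) : ℝ) _ hs).congr' ?_
        filter_upwards [eventually_gt_atTop 0] with η hη
        rw [hnorm _ _ hη]
      simpa using h1.neg.div_const s
    have h := integral_Ioi_of_hasDerivAt_of_tendsto' (a := 0) (fun η _ => hderiv η)
      ((hint (k + 1)).sub ((hint k).const_mul _)) hlim
    rw [integral_sub (hint (k + 1)) ((hint k).const_mul _), integral_const_mul, ih] at h
    simp only [ofReal_zero, zero_pow k.succ_ne_zero, zero_mul, neg_zero, zero_div, sub_zero] at h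
    rw [sub_eq_zero.1 h, Nat.factorial_succ]
    push_cast
    field_simp
    ring

theorem integral_exp_mul_poleProfile {p : ℂ} (hp : p.im < 0) (k : ℕ) (z : ClosedUHP) :
    ∫ η in Set.Ioi (0 : ℝ), Complex.exp (2 * Real.pi * I * z * η) * poleProfile p k η =
      pole p k z := by
  set s : ℂ := 2 * Real.pi * I * (p - z) with hs
  have hsre : 0 < s.re := by
    have : s.re = 2 * Real.pi * ((z : ℂ).im - p.im) := by
      simp [hs]
      ring
    rw [this]
    have := z.2
    have : 0 < (z : ℂ).im - p.im := by linarith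
    positivity
  have hs0 : s ≠ 0 := fun h => by simp [h] at hsre
  have h2 : ∀ η ∈ Set.Ioi (0 : ℝ), Complex.exp (2 * Real.pi * I * z * η) * poleProfile p k η =
      (-(2 * Real.pi * I)) ^ (k + 1) / k.factorial *
        ((η : ℂ) ^ k * Complex.exp (-(s * η))) := by
    intro η hη
    rw [poleProfile, mul_comm, mul_assoc, ← Complex.exp_add, mul_assoc]
    congr 3
    rw [hs]
    ring
  rw [setIntegral_congr_fun measurableSet_Ioi h2, integral_const_mul,
    (integral_pow_mul_exp hsre k).2, pole]
  have hf : (k.factorial : ℂ) ≠ 0 := by exact_mod_cast k.factorial_ne_zero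
  have hpz : (z : ℂ) - p ≠ 0 := fun h => hs0 (by rw [hs, ← neg_sub, h]; simp)
  have hpi : (Real.pi : ℂ) ≠ 0 := by exact_mod_cast Real.pi_ne_zero
  rw [hs, show 2 * Real.pi * I * (p - z) = -(2 * Real.pi * I) * ((z : ℂ) - p) by
    ring, mul_pow]
  have h3 : (-(2 * Real.pi * I) : ℂ) ^ (k + 1) ≠ 0 := by
    apply pow_ne_zero
    simp [hpi]
  have h4 : ((z : ℂ) - p) ^ (k + 1) ≠ 0 := pow_ne_zero _ hpz
  field_simp

/-- `g` is the Fourier profile of the function `f` on the closed upper half-plane. -/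
structure HasProfile (f : ClosedUHP → ℂ) (g : ℝ → ℂ) : Prop where
  cont : Continuous g
  memLp : ∀ m : ℕ, MemLp (fun η : ℝ => (η : ℂ) ^ m * (Set.Ioi (0 : ℝ)).indicator g η) 2
  integrable : IntegrableOn g (Set.Ioi 0)
  eval : ∀ z : ClosedUHP, ∫ η in Set.Ioi (0 : ℝ), Complex.exp (2 * Real.pi * I * z * η) * g η = f z
  -- The `1/x` tail of `f` measures the jump `g 0` of the profile at frequency zero.
  lead : Tendsto (fun x : ℝ => x * f (ofReal' x)) atTop (𝓝 (-(g 0) / (2 * Real.pi * I)))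

/-- A factor `η` raises the order of the pole by one, so every polynomially weighted `L²` bound
reduces to the unweighted one. -/
theorem mul_poleProfile (p : ℂ) (k : ℕ) (η : ℝ) :
    (η : ℂ) * poleProfile p k η =
      -((k + 1 : ℕ) : ℂ) / (2 * Real.pi * I) * poleProfile p (k + 1) η := by
  have hf : (k.factorial : ℂ) ≠ 0 := by exact_mod_cast k.factorial_ne_zero
  have hk : ((k : ℂ) + 1) ≠ 0 := by exact_mod_cast k.succ_ne_zero
  have hpi : (Real.pi : ℂ) ≠ 0 := by exact_mod_cast Real.pi_ne_zero
  rw [poleProfile, poleProfile, Nat.factorial_succ]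
  push_cast
  field_simp
  ring

theorem tendsto_inv_ofReal_sub (p : ℂ) :
    Tendsto (fun x : ℝ => ((x : ℂ) - p)⁻¹) atTop (𝓝 0) := by
  have h1 : Tendsto (fun x : ℝ => ‖(x : ℂ) - p‖) atTop atTop := by
    refine tendsto_atTop_mono (f := fun x : ℝ => x - ‖p‖) (fun x => ?_)
      (tendsto_atTop_add_const_right _ _ tendsto_id)
    have := norm_sub_norm_le (x : ℂ) p
    rw [norm_real] at this
    exact (sub_le_sub_right (le_abs_self x) _).trans this
  exact tendsto_inv₀_cobounded.comp (tendsto_norm_atTop_iff_cobounded.1 h1)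

theorem ofReal_sub_ne_zero {p : ℂ} (hp : p.im < 0) (x : ℝ) : (x : ℂ) - p ≠ 0 := by
  intro h
  have := congrArg Complex.im h
  simp at this
  linarith

theorem hasProfile_pole {p : ℂ} (hp : p.im < 0) (k : ℕ) :
    HasProfile (pole p k) (poleProfile p k) where
  cont := continuous_poleProfile p k
  memLp := by
    intro m
    induction m generalizing k with
    | zero => simpa using memLp_indicator_poleProfile hp k
    | succ m ih =>
      refine ((ih (k + 1)).const_mul (-((k + 1 : ℕ) : ℂ) / (2 * Real.pi * I))).ae_eq
        (ae_of_all _ fun η => ?_)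
      by_cases h : η ∈ Set.Ioi (0 : ℝ)
      · simp only [h, Set.indicator_of_mem]
        rw [pow_succ, mul_assoc ((η : ℂ) ^ m), mul_poleProfile]
        ring
      · simp [h]
  integrable := integrableOn_poleProfile hp k
  eval := integral_exp_mul_poleProfile hp k
  lead := by
    have hpi : (Real.pi : ℂ) ≠ 0 := by exact_mod_cast Real.pi_ne_zero
    have h1 : Tendsto (fun x : ℝ => 1 + p * ((x : ℂ) - p)⁻¹) atTop (𝓝 1) := by
      simpa using ((tendsto_inv_ofReal_sub p).const_mul p).const_add 1
    have h2 : ∀ x : ℝ, x * pole p k (ofReal' x) =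
        (1 + p * ((x : ℂ) - p)⁻¹) * (((x : ℂ) - p)⁻¹) ^ k := by
      intro x
      have := ofReal_sub_ne_zero hp x
      rw [pole, coe_ofReal', inv_pow, pow_succ]
      field_simp
      ring
    simp only [h2]
    have h3 := h1.mul ((tendsto_inv_ofReal_sub p).pow k)
    rw [one_mul] at h3
    convert h3 using 2
    rcases k with _ | k
    · simp [poleProfile, hpi]
    · simp [poleProfile]

/-- Proper rational functions with poles in the open lower half-plane. -/
def ratHardy : Submodule ℂ (ClosedUHP → ℂ) :=
  Submodule.span ℂ {f | ∃ (p : ℂ) (k : ℕ), p.im < 0 ∧ f = pole p k}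

theorem pole_mem {p : ℂ} (hp : p.im < 0) (k : ℕ) : pole p k ∈ ratHardy :=
  Submodule.subset_span ⟨p, k, hp, rfl⟩

theorem HasProfile.integrableOn_exp {f : ClosedUHP → ℂ} {g : ℝ → ℂ} (h : HasProfile f g)
    (z : ClosedUHP) :
    IntegrableOn (fun η : ℝ => Complex.exp (2 * Real.pi * I * z * η) * g η) (Set.Ioi 0) := by
  refine Integrable.mono' h.integrable.norm ?_ ?_
  · refine Continuous.aestronglyMeasurable ?_
    have := h.cont
    fun_prop
  · filter_upwards [ae_restrict_mem measurableSet_Ioi] with η hη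
    rw [norm_mul, Complex.norm_exp]
    refine mul_le_of_le_one_left (norm_nonneg _) ?_
    rw [Real.exp_le_one_iff]
    have : (2 * Real.pi * I * z * η : ℂ).re = -(2 * Real.pi * (z : ℂ).im * η) := by simp
    rw [this]
    have h1 := z.2
    have h2 : 0 < η := hη
    have : 0 ≤ 2 * Real.pi * (z : ℂ).im * η := by positivity
    linarith

theorem HasProfile.add {f f' : ClosedUHP → ℂ} {g g' : ℝ → ℂ} (h : HasProfile f g)
    (h' : HasProfile f' g') : HasProfile (f + f') (g + g') where
  cont := h.cont.add h'.cont
  memLp m := by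
    refine ((h.memLp m).add (h'.memLp m)).ae_eq (ae_of_all _ fun η => ?_)
    simp only [Set.indicator_add', Pi.add_apply, mul_add]
  integrable := h.integrable.add h'.integrable
  eval z := by
    rw [Pi.add_apply, ← h.eval, ← h'.eval, ← integral_add (h.integrableOn_exp z)
      (h'.integrableOn_exp z)]
    simp only [Pi.add_apply, mul_add]
  lead := by
    have := h.lead.add h'.lead
    convert this using 2
    · simp only [Pi.add_apply]; ring
    · simp only [Pi.add_apply]; ring

theorem HasProfile.smul {f : ClosedUHP → ℂ} {g : ℝ → ℂ} (c : ℂ) (h : HasProfile f g) :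
    HasProfile (c • f) (c • g) where
  cont := h.cont.const_smul c
  memLp m := by
    refine ((h.memLp m).const_mul c).ae_eq (ae_of_all _ fun η => ?_)
    by_cases hη : η ∈ Set.Ioi (0 : ℝ)
    · simp only [hη, Set.indicator_of_mem, Pi.smul_apply, smul_eq_mul]
      ring
    · simp [hη]
  integrable := h.integrable.smul c
  eval z := by
    rw [Pi.smul_apply, ← h.eval, smul_eq_mul, ← integral_const_mul]
    congr 1
    ext η
    simp only [Pi.smul_apply, smul_eq_mul]
    ring
  lead := by
    have := h.lead.const_mul c
    convert this using 2
    · simp only [Pi.smul_apply, smul_eq_mul]; ring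
    · simp only [Pi.smul_apply, smul_eq_mul]; ring

theorem hasProfile_zero : HasProfile 0 0 where
  cont := continuous_const
  memLp m := by simp
  integrable := integrableOn_zero
  eval z := by simp
  lead := by simp

theorem exists_hasProfile {f : ClosedUHP → ℂ} (hf : f ∈ ratHardy) : ∃ g, HasProfile f g := by
  induction hf using Submodule.span_induction with
  | mem f h =>
    obtain ⟨p, k, hp, rfl⟩ := h
    exact ⟨_, hasProfile_pole hp k⟩
  | zero => exact ⟨0, hasProfile_zero⟩
  | add f f' _ _ h h' =>
    obtain ⟨g, hg⟩ := h
    obtain ⟨g', hg'⟩ := h'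
    exact ⟨_, hg.add hg'⟩
  | smul c f _ h =>
    obtain ⟨g, hg⟩ := h
    exact ⟨_, hg.smul c⟩

theorem HasProfile.fourierInv {f : ClosedUHP → ℂ} {g : ℝ → ℂ} (h : HasProfile f g) (x : ℝ) :
    𝓕⁻ ((Set.Ioi (0 : ℝ)).indicator g) x = f (ofReal' x) := by
  rw [← h.eval, Real.fourierInv_eq', ← integral_indicator measurableSet_Ioi]
  congr 1
  ext η
  by_cases hη : η ∈ Set.Ioi (0 : ℝ)
  · simp only [hη, Set.indicator_of_mem, smul_eq_mul, coe_ofReal']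
    congr 2
    simp
    ring
  · simp [hη]

open Classical in
/-- The `L²` function given by the values on the real line. -/
def realize (f : ClosedUHP → ℂ) : LTwo :=
  if h : MemLp (fun x : ℝ => f (ofReal' x)) 2 (volume : Measure ℝ) then h.toLp _ else 0

/-- The inverse transform of the profile, which lies in `L¹ ∩ L²`, agrees almost everywhere with the
boundary values of `f`. Their square integrability is a by-product, so the default value in
`realize` never occurs here. -/
theorem HasProfile.realize {f : ClosedUHP → ℂ} {g : ℝ → ℂ} (h : HasProfile f g) :
    (realize f =ᵐ[volume] fun x => f (ofReal' x)) ∧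
      (𝓕 (realize f) : LTwo) =ᵐ[volume] (Set.Ioi (0 : ℝ)).indicator g := by
  have h0 : MemLp ((Set.Ioi (0 : ℝ)).indicator g) 2 := by simpa using h.memLp 0
  have hi : Integrable ((Set.Ioi (0 : ℝ)).indicator g) :=
    h.integrable.integrable_indicator measurableSet_Ioi
  have h1 : (𝓕 (𝓕⁻ (h0.toLp _) : LTwo) : LTwo) =ᵐ[volume] (Set.Ioi (0 : ℝ)).indicator g := by
    rw [FourierTransform.fourier_fourierInv_eq]
    exact h0.coeFn_toLp
  have h2 := (fourier_ae_eq_iff hi _).1 h1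
  have h3 : (fun x => f (ofReal' x)) =ᵐ[volume] (𝓕⁻ (h0.toLp _) : LTwo) := by
    filter_upwards [h2] with x hx
    rw [hx, h.fourierInv]
  have h4 : MemLp (fun x : ℝ => f (ofReal' x)) 2 (volume : Measure ℝ) :=
    (memLp_congr_ae h3).2 (Lp.memLp _)
  have h5 : CMDNLS.realize f = h4.toLp _ := by rw [CMDNLS.realize, dif_pos h4]
  have h6 : CMDNLS.realize f = 𝓕⁻ (h0.toLp _) := by
    rw [h5]
    exact Lp.ext (h4.coeFn_toLp.trans h3)
  exact ⟨h5 ▸ h4.coeFn_toLp, h6 ▸ h1⟩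

variable {f g : ClosedUHP → ℂ}

theorem realize_ae (hf : f ∈ ratHardy) : realize f =ᵐ[volume] fun x => f (ofReal' x) := by
  obtain ⟨g, hg⟩ := exists_hasProfile hf
  exact hg.realize.1

theorem eq_realize (hf : f ∈ ratHardy) {F : LTwo}
    (hF : F =ᵐ[volume] fun x => f (ofReal' x)) : F = realize f :=
  Lp.ext (hF.trans (realize_ae hf).symm)

theorem realize_add (hf : f ∈ ratHardy) (hg : g ∈ ratHardy) :
    realize (f + g) = realize f + realize g := by
  refine (eq_realize (ratHardy.add_mem hf hg) ?_).symm
  filter_upwards [realize_ae hf, realize_ae hg, Lp.coeFn_add (realize f) (realize g)] with x h1 h2 h3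
  rw [h3, Pi.add_apply, h1, h2, Pi.add_apply]

theorem realize_smul (c : ℂ) (hf : f ∈ ratHardy) : realize (c • f) = c • realize f := by
  refine (eq_realize (ratHardy.smul_mem c hf) ?_).symm
  filter_upwards [realize_ae hf, Lp.coeFn_smul c (realize f)] with x h1 h3
  rw [h3, Pi.smul_apply, h1, Pi.smul_apply]

theorem realize_zero : realize 0 = 0 := by
  refine (eq_realize ratHardy.zero_mem ?_).symm
  filter_upwards [Lp.coeFn_zero ℂ 2 (volume : Measure ℝ)] with x h
  rw [h]
  rfl

theorem isWiener_realize (hf : f ∈ ratHardy) : IsWiener (realize f) := by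
  obtain ⟨g, hg⟩ := exists_hasProfile hf
  exact isWiener_of_ae_eq (hg.integrable.integrable_indicator measurableSet_Ioi) hg.realize.2

theorem memHardy_realize (hf : f ∈ ratHardy) : MemHardy (realize f) := by
  obtain ⟨g, hg⟩ := exists_hasProfile hf
  filter_upwards [hg.realize.2] with η h hη
  rw [h]
  simp [hη.le]

theorem memHardySobolev_one_realize (hf : f ∈ ratHardy) : MemHardySobolev 1 (realize f) := by
  refine ⟨memHardy_realize hf, ?_⟩
  obtain ⟨g, hg⟩ := exists_hasProfile hf
  rw [memSobolev_one_iff]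
  refine (hg.memLp 1).ae_eq ?_
  filter_upwards [hg.realize.2] with η h
  rw [h, pow_one]

theorem memHardySobolev_two_realize (hf : f ∈ ratHardy) : MemHardySobolev 2 (realize f) := by
  refine ⟨memHardy_realize hf, ?_⟩
  obtain ⟨g, hg⟩ := exists_hasProfile hf
  rw [memSobolev_two_iff]
  refine (hg.memLp 2).ae_eq ?_
  filter_upwards [hg.realize.2] with η h
  rw [h]

theorem hardyEval_realize (hf : f ∈ ratHardy) (z : ClosedUHP) :
    hardyEval (realize f) z = f z := by
  obtain ⟨g, hg⟩ := exists_hasProfile hf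
  rw [← hg.eval z, hardyEval]
  apply setIntegral_congr_ae measurableSet_Ioi
  filter_upwards [hg.realize.2] with η h hη
  rw [h, Set.indicator_of_mem hη]

theorem exists_lead (hf : f ∈ ratHardy) :
    ∃ ℓ, Tendsto (fun x : ℝ => x * f (ofReal' x)) atTop (𝓝 ℓ) := by
  obtain ⟨g, hg⟩ := exists_hasProfile hf
  exact ⟨_, hg.lead⟩

/-- The profile is continuous, so its value at zero is the one-sided limit of the transform, and
that value is read off the `1/x` tail. -/
theorem fourierAtZeroPlus_realize (hf : f ∈ ratHardy) {ℓ : ℂ}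
    (hℓ : Tendsto (fun x : ℝ => x * f (ofReal' x)) atTop (𝓝 ℓ)) :
    FourierAtZeroPlus (realize f) (-(2 * Real.pi * I * ℓ)) := by
  obtain ⟨g, hg⟩ := exists_hasProfile hf
  have h1 := tendsto_nhds_unique hℓ hg.lead
  have hpi : (Real.pi : ℂ) ≠ 0 := by exact_mod_cast Real.pi_ne_zero
  have h2 : -(2 * Real.pi * I * ℓ) = g 0 := by
    rw [h1]
    field_simp
  rw [h2, FourierAtZeroPlus]
  have h3 : Tendsto g (𝓝[>] (0 : ℝ) ⊓ ae volume) (𝓝 (g 0)) :=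
    (hg.cont.tendsto 0).mono_left (inf_le_left.trans nhdsWithin_le_nhds)
  refine h3.congr' ?_
  have h4 : ∀ᶠ η : ℝ in 𝓝[>] (0 : ℝ) ⊓ ae volume, η ∈ Set.Ioi (0 : ℝ) :=
    Filter.le_def.1 inf_le_left _ self_mem_nhdsWithin
  have h5 : ∀ᶠ η : ℝ in 𝓝[>] (0 : ℝ) ⊓ ae volume,
      (𝓕 (realize f) : LTwo) η = (Set.Ioi (0 : ℝ)).indicator g η :=
    Filter.le_def.1 inf_le_right _ hg.realize.2
  filter_upwards [h4, h5] with η h6 h7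
  rw [h7, Set.indicator_of_mem h6]

end

/-! ### Algebra, derivative and generator `G` on rational functions -/

section

variable {f g : ClosedUHP → ℂ}

theorem coe_sub_ne_zero {p : ℂ} (hp : p.im < 0) (z : ClosedUHP) : (z : ℂ) - p ≠ 0 := by
  intro h
  have h1 := congrArg Complex.im h
  have h2 := z.2
  rw [sub_im, zero_im] at h1
  linarith

/-- For `p ≠ q`, `1/((z - p)(z - q)) = (p - q)⁻¹ (1/(z - p) - 1/(z - q))` lowers the total exponent
by one, which is the induction variable. -/
theorem inv_pow_mul_inv_pow_mem {p q : ℂ} (hp : p.im < 0) (hq : q.im < 0) (n : ℕ) :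
    ∀ a b : ℕ, a + b = n + 1 →
      (fun z : ClosedUHP => (((z : ℂ) - p)⁻¹) ^ a * (((z : ℂ) - q)⁻¹) ^ b) ∈ ratHardy := by
  have hpole : ∀ {p : ℂ}, p.im < 0 → ∀ a : ℕ,
      (fun z : ClosedUHP => (((z : ℂ) - p)⁻¹) ^ (a + 1)) ∈ ratHardy := by
    intro p hp a
    convert pole_mem hp a using 1
    ext z
    rw [pole, inv_pow]
  induction n with
  | zero =>
    intro a b hab
    obtain ⟨rfl, rfl⟩ | ⟨rfl, rfl⟩ : (a = 0 ∧ b = 1) ∨ (a = 1 ∧ b = 0) := by omega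
    · simpa using hpole hq 0
    · simpa using hpole hp 0
  | succ n ih =>
    intro a b hab
    rcases a with _ | a
    · obtain rfl : b = n + 1 + 1 := by omega
      simpa using hpole hq (n + 1)
    rcases b with _ | b
    · obtain rfl : a = n + 1 := by omega
      simpa using hpole hp (n + 1)
    by_cases hpq : p = q
    · subst hpq
      convert hpole hp (a + b + 1) using 1
      ext z
      rw [← pow_add]
      congr 1
      omega
    · have hpq' : p - q ≠ 0 := sub_ne_zero.2 hpq
      have h1 := ih (a + 1) b (by omega)
      have h2 := ih a (b + 1) (by omega)
      convert ratHardy.smul_mem (p - q)⁻¹ (ratHardy.sub_mem h1 h2) using 1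
      ext z
      simp only [Pi.smul_apply, Pi.sub_apply, smul_eq_mul]
      have e1 := coe_sub_ne_zero hp z
      have e2 := coe_sub_ne_zero hq z
      rw [pow_succ, pow_succ]
      field_simp
      ring

theorem pole_mul_mem {p q : ℂ} (hp : p.im < 0) (hq : q.im < 0) (a b : ℕ) :
    pole p a * pole q b ∈ ratHardy := by
  convert inv_pow_mul_inv_pow_mem hp hq (a + b + 1) (a + 1) (b + 1) (by omega) using 1
  ext z
  rw [Pi.mul_apply, pole, pole, inv_pow, inv_pow]

theorem ratHardy_mul_mem (hf : f ∈ ratHardy) (hg : g ∈ ratHardy) : f * g ∈ ratHardy := by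
  induction hf using Submodule.span_induction with
  | mem f h =>
    obtain ⟨p, k, hp, rfl⟩ := h
    induction hg using Submodule.span_induction with
    | mem g h =>
      obtain ⟨q, l, hq, rfl⟩ := h
      exact pole_mul_mem hp hq k l
    | zero => simp
    | add g g' _ _ h h' => rw [mul_add]; exact ratHardy.add_mem h h'
    | smul c g _ h => rw [mul_smul_comm]; exact ratHardy.smul_mem c h
  | zero => simp
  | add f f' _ _ h h' => rw [add_mul]; exact ratHardy.add_mem h h'
  | smul c f _ h => rw [smul_mul_assoc]; exact ratHardy.smul_mem c h

/-- The quotient of two polynomials as a function on the closed upper half-plane. -/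
def ratFun (A Q : Polynomial ℂ) : ClosedUHP → ℂ := fun z => A.eval (z : ℂ) / Q.eval (z : ℂ)

/-- Split a root `p` off `Q = (X - p) Q1`. The constant `c` makes `A1 = A - c Q1` lose its top
coefficient, and `A / Q = c / (z - p) + (z - p)⁻¹ · A1 / Q1` closes the induction because the class
is stable under products. -/
theorem ratFun_mem {A Q : Polynomial ℂ} (hQ : ∀ z : ℂ, Q.IsRoot z → z.im < 0)
    (hdeg : A.degree < Q.degree) : ratFun A Q ∈ ratHardy := by
  classical
  induction hn : Q.natDegree generalizing A Q with
  | zero =>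
    have hQ0 : Q ≠ 0 := by rintro rfl; simp at hdeg
    rw [Polynomial.degree_eq_natDegree hQ0, hn] at hdeg
    have : A = 0 := by
      rw [← Polynomial.degree_eq_bot]
      exact Nat.WithBot.lt_zero_iff.1 (by simpa using hdeg)
    convert ratHardy.zero_mem
    ext z
    simp [ratFun, this]
  | succ n ih =>
    have hQ0 : Q ≠ 0 := by rintro rfl; simp at hdeg
    obtain ⟨p, hp⟩ := Complex.exists_root (f := Q) (by
      rw [Polynomial.degree_eq_natDegree hQ0, hn]; exact_mod_cast n.succ_pos)
    obtain ⟨Q1, rfl⟩ := Polynomial.dvd_iff_isRoot.2 hp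
    have hQ10 : Q1 ≠ 0 := right_ne_zero_of_mul hQ0
    have hQ1 : ∀ z : ℂ, Q1.IsRoot z → z.im < 0 := fun z hz => hQ z (by
      rw [Polynomial.IsRoot, Polynomial.eval_mul, hz.eq_zero, mul_zero])
    have hpim : p.im < 0 := hQ p hp
    have hn1 : Q1.natDegree = n := by
      rw [Polynomial.natDegree_mul (Polynomial.X_sub_C_ne_zero p) hQ10,
        Polynomial.natDegree_X_sub_C] at hn
      omega
    have hlc : Q1.leadingCoeff ≠ 0 := Polynomial.leadingCoeff_ne_zero.2 hQ10
    set c := A.coeff n / Q1.leadingCoeff with hc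
    set A1 := A - Polynomial.C c * Q1 with hA1
    have hA1deg : A1.degree < Q1.degree := by
      rw [Polynomial.degree_eq_natDegree hQ10, hn1, Polynomial.degree_lt_iff_coeff_zero]
      intro m hm
      rw [hA1, Polynomial.coeff_sub, Polynomial.coeff_C_mul]
      rcases hm.eq_or_lt with rfl | hlt
      · rw [show Q1.coeff n = Q1.leadingCoeff by rw [Polynomial.leadingCoeff, hn1], hc,
          div_mul_cancel₀ _ hlc, sub_self]
      · rw [Polynomial.coeff_eq_zero_of_natDegree_lt (by omega : Q1.natDegree < m), mul_zero,
          sub_zero]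
        apply Polynomial.coeff_eq_zero_of_degree_lt
        refine hdeg.trans_le ?_
        rw [Polynomial.degree_eq_natDegree hQ0, hn]
        exact_mod_cast hlt
    have h1 := ih hQ1 hA1deg hn1
    convert ratHardy.add_mem (ratHardy.smul_mem c (pole_mem hpim 0))
      (ratHardy_mul_mem (pole_mem hpim 0) h1) using 1
    ext z
    have e1 := coe_sub_ne_zero hpim z
    have e2 : Q1.eval (z : ℂ) ≠ 0 := fun h => by
      have h3 := hQ1 _ h
      have h4 := z.2
      linarith
    simp only [ratFun, Pi.add_apply, Pi.smul_apply, Pi.mul_apply, pole, hA1, smul_eq_mul,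
      Polynomial.eval_mul, Polynomial.eval_sub, Polynomial.eval_X, Polynomial.eval_C, zero_add,
      pow_one]
    field_simp
    ring

theorem fourier_realize_pole {p : ℂ} (hp : p.im < 0) (k : ℕ) :
    (𝓕 (realize (pole p k)) : LTwo) =ᵐ[volume] (Set.Ioi (0 : ℝ)).indicator (poleProfile p k) :=
  (hasProfile_pole hp k).realize.2

theorem opD_add {f g : LTwo} (hf : MemHardySobolev 1 f) (hg : MemHardySobolev 1 g) :
    opD (f + g) = opD f + opD g :=
  fourierMul_add (memMulDomain_opD hf) (memMulDomain_opD hg)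

theorem opD_smul {f : LTwo} (c : ℂ) (hf : MemHardySobolev 1 f) : opD (c • f) = c • opD f :=
  fourierMul_smul c (memMulDomain_opD hf)

theorem opD_realize_pole {p : ℂ} (hp : p.im < 0) (k : ℕ) :
    opD (realize (pole p k)) = (-I * -((k + 1 : ℕ) : ℂ)) • realize (pole p (k + 1)) := by
  apply lTwo_ext
  rw [fourierL2_smul]
  filter_upwards [fourier_opD (memHardySobolev_one_realize (pole_mem hp k)),
    fourier_realize_pole hp k, fourier_realize_pole hp (k + 1),
    Lp.coeFn_smul (-I * -((k + 1 : ℕ) : ℂ)) (𝓕 (realize (pole p (k + 1))) : LTwo)] with η h1 h2 h3 h4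
  rw [h1, h2, h4, Pi.smul_apply, h3]
  by_cases hη : η ∈ Set.Ioi (0 : ℝ)
  · simp only [hη, Set.indicator_of_mem, smul_eq_mul]
    have hpi : (Real.pi : ℂ) ≠ 0 := by exact_mod_cast Real.pi_ne_zero
    rw [ofReal_mul, mul_assoc, mul_poleProfile, ← mul_assoc]
    congr 1
    push_cast
    field_simp
    rw [I_sq]
  · simp [hη]

/-- On rational functions, `D = -i d/dx`. -/
theorem exists_deriv_ratHardy (hf : f ∈ ratHardy) :
    ∃ f' ∈ ratHardy, (∀ x : ℝ, HasDerivAt (fun x : ℝ => f (ofReal' x)) (f' (ofReal' x)) x) ∧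
      opD (realize f) = (-I) • realize f' := by
  induction hf using Submodule.span_induction with
  | mem f h =>
    obtain ⟨p, k, hp, rfl⟩ := h
    refine ⟨(-((k + 1 : ℕ) : ℂ)) • pole p (k + 1), ratHardy.smul_mem _ (pole_mem hp _), ?_, ?_⟩
    · intro x
      have h0 := ofReal_sub_ne_zero hp x
      have h1 : HasDerivAt (fun z : ℂ => ((z - p) ^ (k + 1))⁻¹)
          (-(((k + 1 : ℕ) : ℂ) * ((x : ℂ) - p) ^ k * 1) / (((x : ℂ) - p) ^ (k + 1)) ^ 2) (x : ℂ) :=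
        (((hasDerivAt_id (x : ℂ)).sub_const p).pow (k + 1)).inv (pow_ne_zero _ h0)
      have h2 := h1.comp_ofReal
      refine HasDerivAt.congr_deriv (f := fun x : ℝ => pole p k (ofReal' x)) h2 ?_
      change _ = -((k + 1 : ℕ) : ℂ) * pole p (k + 1) (ofReal' x)
      rw [pole, coe_ofReal']
      field_simp
      ring
    · rw [opD_realize_pole hp, realize_smul _ (pole_mem hp _), smul_smul]
  | zero =>
    refine ⟨0, ratHardy.zero_mem, fun x => by simpa using hasDerivAt_const x (0 : ℂ), ?_⟩
    rw [realize_zero, smul_zero]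
    have := opD_smul 0 (memHardySobolev_one_realize ratHardy.zero_mem)
    simpa [realize_zero] using this
  | add f g hf hg h h' =>
    obtain ⟨f', h1, h2, h3⟩ := h
    obtain ⟨g', h1', h2', h3'⟩ := h'
    refine ⟨f' + g', ratHardy.add_mem h1 h1', fun x => (h2 x).add (h2' x), ?_⟩
    rw [realize_add hf hg, opD_add (memHardySobolev_one_realize hf)
      (memHardySobolev_one_realize hg), h3, h3', realize_add h1 h1', smul_add]
  | smul c f hf h =>
    obtain ⟨f', h1, h2, h3⟩ := h
    refine ⟨c • f', ratHardy.smul_mem c h1, fun x => (h2 x).const_smul c, ?_⟩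
    rw [realize_smul c hf, opD_smul c (memHardySobolev_one_realize hf), h3, realize_smul c h1,
      smul_comm]

theorem realize_congr {f g : ClosedUHP → ℂ} (h : ∀ x : ℝ, f (ofReal' x) = g (ofReal' x)) :
    realize f = realize g := by
  have : (fun x : ℝ => f (ofReal' x)) = fun x => g (ofReal' x) := funext h
  unfold realize
  split_ifs with h1 h2 h2
  · exact MemLp.toLp_congr h1 h2 (ae_of_all _ h)
  · exact absurd (this ▸ h1) h2
  · exact absurd (this.symm ▸ h2) h1
  · rfl

theorem opD_realize {f' : ClosedUHP → ℂ} (hf : f ∈ ratHardy)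
    (hd : ∀ x : ℝ, HasDerivAt (fun x : ℝ => f (ofReal' x)) (f' (ofReal' x)) x) :
    opD (realize f) = (-I) • realize f' := by
  obtain ⟨f'', h1, h2, h3⟩ := exists_deriv_ratHardy hf
  rw [h3, realize_congr fun x => (h2 x).unique (hd x)]

theorem adjSemigroup_eq (η : ℝ) (f : LTwo) :
    adjSemigroup η f = szegoProj (mulL2 (expChar η) f) := rfl

theorem adjSemigroup_add (η : ℝ) (f g : LTwo) :
    adjSemigroup η (f + g) = adjSemigroup η f + adjSemigroup η g := by
  rw [adjSemigroup_eq, mulL2_add (memLp_expChar_mul η f) (memLp_expChar_mul η g), szegoProj_add]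
  rfl

theorem adjSemigroup_smul (η : ℝ) (c : ℂ) (f : LTwo) :
    adjSemigroup η (c • f) = c • adjSemigroup η f := by
  rw [adjSemigroup_eq, mulL2_smul c (memLp_expChar_mul η f), szegoProj_smul]
  rfl

theorem GeneratorMaps.add {f f' g g' : LTwo} (h : GeneratorMaps f g) (h' : GeneratorMaps f' g') :
    GeneratorMaps (f + f') (g + g') := by
  refine ⟨h.1.add h'.1, (h.2.add h'.2).congr fun η => ?_⟩
  rw [adjSemigroup_add, ← smul_add]
  congr 1
  abel

theorem GeneratorMaps.smul {f g : LTwo} (c : ℂ) (h : GeneratorMaps f g) :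
    GeneratorMaps (c • f) (c • g) := by
  refine ⟨h.1.smul c, (h.2.const_smul c).congr fun η => ?_⟩
  rw [adjSemigroup_smul, smul_comm, smul_sub]

/-- Binomial expansion of `(η + h/2π)^k`. A frequency shift keeps the profile in the span of the
poles at `p` of order at most that of the original, so the adjoint semigroup acts there as a finite
matrix. -/
theorem poleProfile_add (p : ℂ) (k : ℕ) (η h : ℝ) :
    poleProfile p k (η + h / (2 * Real.pi)) = Complex.exp (-(I * p * h)) *
      ∑ i ∈ Finset.range (k + 1), (-(I * h)) ^ i / i.factorial * poleProfile p (k - i) η := by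
  have hpi : (Real.pi : ℂ) ≠ 0 := by exact_mod_cast Real.pi_ne_zero
  have e1 : poleProfile p k (η + h / (2 * Real.pi)) = Complex.exp (-(I * p * h)) *
      (Complex.exp (-(2 * Real.pi * I * p * η)) * ((-(2 * Real.pi * I)) *
        ((-(I * h) + -(2 * Real.pi * I) * η) ^ k / k.factorial))) := by
    have e2 : Complex.exp (-(2 * Real.pi * I * p * ((η + h / (2 * Real.pi) : ℝ) : ℂ))) =
        Complex.exp (-(I * p * h)) * Complex.exp (-(2 * Real.pi * I * p * η)) := by
      rw [← Complex.exp_add]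
      congr 1
      push_cast
      field_simp
      ring
    have e3 : (-(I * h) + -(2 * Real.pi * I) * η : ℂ) =
        (-(2 * Real.pi * I)) * ((η + h / (2 * Real.pi) : ℝ) : ℂ) := by
      push_cast
      field_simp
      ring
    rw [poleProfile, e2, e3, mul_pow, pow_succ]
    ring
  rw [e1, add_pow, Finset.sum_div, Finset.mul_sum, Finset.mul_sum]
  congr 1
  apply Finset.sum_congr rfl
  intro i hi
  have hik : i ≤ k := Nat.lt_succ_iff.1 (Finset.mem_range.1 hi)
  have hf : (k.factorial : ℂ) ≠ 0 := by exact_mod_cast k.factorial_ne_zero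
  have hf1 : (i.factorial : ℂ) ≠ 0 := by exact_mod_cast i.factorial_ne_zero
  have hf2 : ((k - i).factorial : ℂ) ≠ 0 := by exact_mod_cast (k - i).factorial_ne_zero
  have hch : (k.choose i : ℂ) * i.factorial * (k - i).factorial = k.factorial := by
    exact_mod_cast Nat.choose_mul_factorial_mul_factorial hik
  rw [poleProfile, ← hch, mul_pow, pow_succ]
  have hc0 : (k.choose i : ℂ) ≠ 0 := by exact_mod_cast (Nat.choose_pos hik).ne'
  field_simp

/-- For `h ≥ 0` the modulation moves the spectrum downwards and the projection discards what crosses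
zero; on `η > 0` what remains is the shifted profile. -/
theorem adjSemigroup_realize_pole {p : ℂ} (hp : p.im < 0) (k : ℕ) {h : ℝ} (hh : 0 ≤ h) :
    adjSemigroup h (realize (pole p k)) = Complex.exp (-(I * p * h)) •
      ∑ i ∈ Finset.range (k + 1), ((-(I * h)) ^ i / i.factorial) • realize (pole p (k - i)) := by
  have hmem : (Complex.exp (-(I * p * h)) •
      ∑ i ∈ Finset.range (k + 1), ((-(I * h)) ^ i / i.factorial : ℂ) • pole p (k - i)) ∈ ratHardy :=
    ratHardy.smul_mem _ (ratHardy.sum_mem fun i _ => ratHardy.smul_mem _ (pole_mem hp _))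
  have hprof : HasProfile (Complex.exp (-(I * p * h)) •
      ∑ i ∈ Finset.range (k + 1), ((-(I * h)) ^ i / i.factorial : ℂ) • pole p (k - i))
      (Complex.exp (-(I * p * h)) •
      ∑ i ∈ Finset.range (k + 1), ((-(I * h)) ^ i / i.factorial : ℂ) • poleProfile p (k - i)) := by
    apply HasProfile.smul
    generalize Finset.range (k + 1) = s
    induction s using Finset.induction_on with
    | empty => simpa using hasProfile_zero
    | insert a s ha ih =>
      rw [Finset.sum_insert ha, Finset.sum_insert ha]
      exact ((hasProfile_pole hp _).smul _).add ih
  have hreal : realize (Complex.exp (-(I * p * h)) •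
      ∑ i ∈ Finset.range (k + 1), ((-(I * h)) ^ i / i.factorial : ℂ) • pole p (k - i)) =
      Complex.exp (-(I * p * h)) •
      ∑ i ∈ Finset.range (k + 1), ((-(I * h)) ^ i / i.factorial) • realize (pole p (k - i)) := by
    rw [realize_smul _ (ratHardy.sum_mem fun i _ => ratHardy.smul_mem _ (pole_mem hp _))]
    congr 1
    generalize Finset.range (k + 1) = s
    induction s using Finset.induction_on with
    | empty => simpa using realize_zero
    | insert a s ha ih =>
      rw [Finset.sum_insert ha, Finset.sum_insert ha, realize_add
        (ratHardy.smul_mem _ (pole_mem hp _))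
        (ratHardy.sum_mem fun i _ => ratHardy.smul_mem _ (pole_mem hp _)), ih,
        realize_smul _ (pole_mem hp _)]
  rw [← hreal]
  apply lTwo_ext
  have hsh := (measurePreserving_add_right volume (h / (2 * Real.pi))).quasiMeasurePreserving.ae
    (fourier_realize_pole hp k)
  have h0 : ∀ᵐ η : ℝ, η ≠ 0 := by simp [ae_iff, measure_singleton]
  rw [adjSemigroup_eq]
  filter_upwards [fourier_szegoProj (mulL2 (expChar h) (realize (pole p k))),
    fourier_mulL2_expChar (isWiener_realize (pole_mem hp k)) h, hsh, h0, hprof.realize.2]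
    with η h1 h2 h3 h4 h5
  rw [h1, h5]
  by_cases hη : 0 < η
  · have hpos : 0 < η + h / (2 * Real.pi) := by positivity
    rw [Set.indicator_of_mem (Set.mem_Ici.2 hη.le), Set.indicator_of_mem (Set.mem_Ioi.2 hη), h2, h3,
      Set.indicator_of_mem (Set.mem_Ioi.2 hpos), poleProfile_add]
    simp
  · have hneg : ¬ 0 ≤ η := fun h => hη (lt_of_le_of_ne h (Ne.symm h4))
    simp [hη, hneg]

/-- `G (x - p)^{-(k+1)} = p (x - p)^{-(k+1)} + (x - p)^{-k}`, without the constant for `k = 0`. -/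
theorem generatorMaps_pole {p : ℂ} (hp : p.im < 0) (k : ℕ) :
    GeneratorMaps (realize (pole p k))
      (p • realize (pole p k) + if k = 0 then 0 else realize (pole p (k - 1))) := by
  refine ⟨memHardy_realize (pole_mem hp k), ?_⟩
  -- `F` is smooth on all of `ℝ` and agrees with the semigroup orbit for `h ≥ 0`, so the generator
  -- is `I` times the derivative of `F` at zero.
  set F : ℝ → LTwo := fun h => Complex.exp (-(I * p * h)) •
      ∑ i ∈ Finset.range (k + 1), ((-(I * h)) ^ i / i.factorial) • realize (pole p (k - i)) with hF
  have hF0 : F 0 = realize (pole p k) := by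
    simp only [hF, ofReal_zero, mul_zero, neg_zero, Complex.exp_zero, one_smul]
    rw [Finset.sum_range_succ']
    simp
  have hd : HasDerivAt F (-(I * p) • realize (pole p k) +
      if k = 0 then 0 else (-I) • realize (pole p (k - 1))) 0 := by
    have h1 : HasDerivAt (fun h : ℝ => Complex.exp (-(I * p * h))) (-(I * p)) 0 := by
      have h2 : HasDerivAt (fun z : ℂ => Complex.exp (-(I * p * z)))
          (Complex.exp (-(I * p * 0)) * -(I * p * 1)) ((0 : ℝ) : ℂ) := by
        rw [ofReal_zero]
        exact ((hasDerivAt_id (0 : ℂ)).const_mul (I * p)).neg.cexp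
      simpa using h2.comp_ofReal
    have h3 : ∀ i : ℕ, HasDerivAt (fun h : ℝ => ((-(I * h)) ^ i / i.factorial : ℂ))
        (if i = 1 then -I else 0) 0 := by
      intro i
      have h2 : HasDerivAt (fun z : ℂ => (-(I * z)) ^ i / i.factorial)
          (((i : ℂ) * (-(I * 0)) ^ (i - 1) * -(I * 1)) / i.factorial) ((0 : ℝ) : ℂ) := by
        rw [ofReal_zero]
        exact (((hasDerivAt_id (0 : ℂ)).const_mul I).neg.pow i).div_const _
      convert h2.comp_ofReal using 1
      rcases i with _ | _ | i
      · simp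
      · simp
      · simp
    have h4 := HasDerivAt.fun_sum (u := Finset.range (k + 1))
      fun i _ => (h3 i).smul_const (realize (pole p (k - i)))
    have h5 := h1.smul h4
    refine h5.congr_deriv ?_
    have e1 : ∑ i ∈ Finset.range (k + 1), ((-(I * ((0 : ℝ) : ℂ))) ^ i / i.factorial : ℂ) •
        realize (pole p (k - i)) = realize (pole p k) := by
      rw [Finset.sum_range_succ']
      simp
    have e2 : ∑ i ∈ Finset.range (k + 1), (if i = 1 then -I else 0 : ℂ) •
        realize (pole p (k - i)) = if k = 0 then 0 else (-I) • realize (pole p (k - 1)) := by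
      simp only [ite_smul, zero_smul, Finset.sum_ite_eq', Finset.mem_range]
      rcases k with _ | k <;> simp
    rw [e1, e2]
    simp [add_comm]
  have hs := (hasDerivAt_iff_tendsto_slope_zero.1 hd).mono_left
    (nhdsWithin_mono (0 : ℝ) (show Set.Ioi (0 : ℝ) ⊆ {0}ᶜ from fun x hx => ne_of_gt hx))
  have hs2 := hs.const_smul I
  have hval : I • (-(I * p) • realize (pole p k) +
      if k = 0 then 0 else (-I) • realize (pole p (k - 1))) =
      p • realize (pole p k) + if k = 0 then 0 else realize (pole p (k - 1)) := by
    rw [smul_add, smul_smul]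
    congr 1
    · congr 1
      linear_combination (-p) * I_mul_I
    · split_ifs
      · simp
      · rw [smul_smul]; simp
  rw [hval] at hs2
  refine hs2.congr' ?_
  filter_upwards [self_mem_nhdsWithin] with h hh
  rw [zero_add, hF0, adjSemigroup_realize_pole hp k (le_of_lt hh)]
  change I • h⁻¹ • (F h - _) = (I / (h : ℂ)) • (F h - _)
  rw [RCLike.real_smul_eq_coe_smul (K := ℂ), smul_smul]
  congr 1
  rw [div_eq_mul_inv]
  simp

/-- On rational functions, `G f = x f - lim x f`. -/
theorem exists_generator (hf : f ∈ ratHardy) :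
    ∃ ℓ, Tendsto (fun x : ℝ => x * f (ofReal' x)) atTop (𝓝 ℓ) ∧
      (fun z : ClosedUHP => (z : ℂ) * f z - ℓ) ∈ ratHardy ∧
      GeneratorMaps (realize f) (realize fun z : ClosedUHP => (z : ℂ) * f z - ℓ) := by
  induction hf using Submodule.span_induction with
  | mem f h =>
    obtain ⟨p, k, hp, rfl⟩ := h
    obtain ⟨ℓ, hℓ⟩ := exists_lead (pole_mem hp k)
    refine ⟨ℓ, hℓ, ?_⟩
    have hpi : (Real.pi : ℂ) ≠ 0 := by exact_mod_cast Real.pi_ne_zero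
    have hℓ' := tendsto_nhds_unique hℓ (hasProfile_pole hp k).lead
    have hG := generatorMaps_pole hp k
    rcases k with _ | k
    · have h1 : ℓ = 1 := by rw [hℓ']; simp [poleProfile, hpi]
      have h2 : (fun z : ClosedUHP => (z : ℂ) * pole p 0 z - ℓ) = p • pole p 0 := by
        ext z
        have := coe_sub_ne_zero hp z
        simp only [h1, pole, Pi.smul_apply, smul_eq_mul, zero_add, pow_one]
        field_simp
        ring
      rw [h2, realize_smul _ (pole_mem hp 0)]
      refine ⟨ratHardy.smul_mem _ (pole_mem hp 0), ?_⟩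
      simpa using hG
    · have h1 : ℓ = 0 := by rw [hℓ']; simp [poleProfile]
      have h2 : (fun z : ClosedUHP => (z : ℂ) * pole p (k + 1) z - ℓ) =
          p • pole p (k + 1) + pole p k := by
        ext z
        have := coe_sub_ne_zero hp z
        simp only [h1, pole, Pi.smul_apply, Pi.add_apply, smul_eq_mul]
        field_simp
        ring
      rw [h2, realize_add (ratHardy.smul_mem _ (pole_mem hp _)) (pole_mem hp _),
        realize_smul _ (pole_mem hp _)]
      refine ⟨ratHardy.add_mem (ratHardy.smul_mem _ (pole_mem hp _)) (pole_mem hp _), ?_⟩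
      simpa using hG
  | zero =>
    refine ⟨0, by simp, ?_⟩
    have : (fun z : ClosedUHP => (z : ℂ) * (0 : ClosedUHP → ℂ) z - 0) = 0 := by ext z; simp
    rw [this]
    refine ⟨ratHardy.zero_mem, ?_⟩
    have h := (generatorMaps_pole (p := -I) (by simp) 0).smul 0
    simpa [realize_zero] using h
  | add f g hf hg h h' =>
    obtain ⟨ℓ, h1, h2, h3⟩ := h
    obtain ⟨ℓ', h1', h2', h3'⟩ := h'
    have e : (fun z : ClosedUHP => (z : ℂ) * (f + g) z - (ℓ + ℓ')) =
        (fun z : ClosedUHP => (z : ℂ) * f z - ℓ) + fun z : ClosedUHP => (z : ℂ) * g z - ℓ' := by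
      ext z
      simp only [Pi.add_apply]
      ring
    refine ⟨ℓ + ℓ', ?_, ?_⟩
    · refine (h1.add h1').congr fun x => ?_
      simp only [Pi.add_apply]
      ring
    · rw [e, realize_add h2 h2', realize_add hf hg]
      exact ⟨ratHardy.add_mem h2 h2', h3.add h3'⟩
  | smul c f hf h =>
    obtain ⟨ℓ, h1, h2, h3⟩ := h
    have e : (fun z : ClosedUHP => (z : ℂ) * (c • f) z - c * ℓ) =
        c • (fun z : ClosedUHP => (z : ℂ) * f z - ℓ) := by
      ext z
      simp only [Pi.smul_apply, smul_eq_mul]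
      ring
    refine ⟨c * ℓ, ?_, ?_⟩
    · refine (h1.const_mul c).congr fun x => ?_
      simp only [Pi.smul_apply, smul_eq_mul]
      ring
    · rw [e, realize_smul c h2, realize_smul c hf]
      exact ⟨ratHardy.smul_mem c h2, h3.smul c⟩

theorem szegoProj_star {f : LTwo} (hf : IsWiener f) (hf' : MemHardy f) :
    szegoProj (star f) = 0 := by
  apply lTwo_ext
  -- The spectra of `f` and of its conjugate can only meet at frequency zero, which is a null set.
  have h0 : ∀ᵐ η : ℝ, η ≠ 0 := by simp [ae_iff, measure_singleton]
  have h1 : ∀ᵐ η : ℝ, -η < 0 → (𝓕 f : LTwo) (-η) = 0 :=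
    (Measure.measurePreserving_neg volume).quasiMeasurePreserving.ae hf'
  have h00 : (𝓕 (0 : LTwo) : LTwo) = 0 := (Lp.fourierTransformₗᵢ ℝ ℂ).map_zero
  rw [h00]
  filter_upwards [fourier_szegoProj (star f), fourier_star hf, h0, h1,
    Lp.coeFn_zero ℂ 2 (volume : Measure ℝ)] with η h2 h3 h4 h5 h6
  rw [h2, h6, Pi.zero_apply]
  by_cases hη : 0 ≤ η
  · have : 0 < η := lt_of_le_of_ne hη (Ne.symm h4)
    rw [Set.indicator_of_mem (Set.mem_Ici.2 hη), h3, h5 (by linarith), map_zero]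
  · simp [hη]

/-- The Szegő projection of `f + ḡ` is `f`. -/
theorem szegoProj_of_ae_eq (hf : f ∈ ratHardy) (hg : g ∈ ratHardy) {F : LTwo}
    (hF : F =ᵐ[volume] fun x => f (ofReal' x) + starRingEnd ℂ (g (ofReal' x))) :
    szegoProj F = realize f := by
  have : F = realize f + star (realize g) := by
    apply Lp.ext
    filter_upwards [hF, Lp.coeFn_add (realize f) (star (realize g)), realize_ae hf,
      star_ae_eq (realize g), realize_ae hg] with x h1 h2 h3 h4 h5
    rw [h1, h2, Pi.add_apply, h3, h4, h5]
  rw [this, szegoProj_add, szegoProj_of_memHardy (memHardy_realize hf),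
    szegoProj_star (isWiener_realize hg) (memHardy_realize hg), add_zero]

end

/-! ### The spectral matrix and its resolvent -/

section

open Matrix

variable {N : ℕ} [NeZero N] {lam γ : Fin N → ℝ} {ρ : ℝ}

/-- `M - z`, with `M` the spectral matrix. -/
def shiftMatrix (lam γ : Fin N → ℝ) (ρ : ℝ) (z : ℂ) : Matrix (Fin N) (Fin N) ℂ :=
  spectralMatrix lam γ ρ - z • (1 : Matrix (Fin N) (Fin N) ℂ)

/-- The resolvent `(M - z)⁻¹` of the spectral matrix. -/
def resolv (lam γ : Fin N → ℝ) (ρ : ℝ) (z : ℂ) : Matrix (Fin N) (Fin N) ℂ :=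
  (shiftMatrix lam γ ρ z)⁻¹

/-- `[Λ, M - z] = i (X Xᵀ - 1)`, entrywise. -/
theorem commutator_shiftMatrix (hinj : Function.Injective lam) (z : ℂ) (j k : Fin N) :
    (lam j : ℂ) * shiftMatrix lam γ ρ z j k - shiftMatrix lam γ ρ z j k * lam k =
      I * (1 - (1 : Matrix (Fin N) (Fin N) ℂ) j k) := by
  by_cases h : j = k
  · subst h
    simp
    ring
  · have h1 : ((lam j : ℂ) - lam k) ≠ 0 := by
      rw [sub_ne_zero]
      exact fun h2 => h (hinj (by exact_mod_cast h2))
    simp only [shiftMatrix, spectralMatrix, Matrix.sub_apply, Matrix.of_apply, Matrix.smul_apply,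
      Matrix.one_apply_ne h, if_neg h, smul_zero, sub_zero, mul_one]
    field_simp

/-- `(M - z)* = M - z̄ + 2iρ Y Yᵀ`, entrywise. -/
theorem conj_shiftMatrix (z : ℂ) (j k : Fin N) :
    starRingEnd ℂ (shiftMatrix lam γ ρ z k j) = shiftMatrix lam γ ρ (starRingEnd ℂ z) j k +
      if j = 0 ∧ k = 0 then 2 * I * ρ else 0 := by
  by_cases h : j = k
  · subst h
    by_cases h0 : j = 0
    · simp [shiftMatrix, spectralMatrix, h0]
      ring
    · simp [shiftMatrix, spectralMatrix, h0]
  · have h0 : ¬ (j = 0 ∧ k = 0) := fun h0 => h (h0.1.trans h0.2.symm)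
    have h' : k ≠ j := fun e => h e.symm
    simp only [shiftMatrix, spectralMatrix, Matrix.sub_apply, Matrix.of_apply, Matrix.smul_apply,
      Matrix.one_apply_ne h, Matrix.one_apply_ne h', if_neg h, if_neg h', if_neg h0, smul_zero,
      sub_zero, add_zero, map_div₀, map_sub, conj_I, conj_ofReal]
    rw [← neg_sub (lam j : ℂ), neg_div_neg_eq]

theorem sum_norm_sq_eq {n : ℕ} (w : Fin n → ℂ) :
    ∑ j, starRingEnd ℂ (w j) * w j = ((∑ j, ‖w j‖ ^ 2 : ℝ) : ℂ) := by
  push_cast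
  refine Finset.sum_congr rfl fun j _ => ?_
  rw [mul_comm, mul_conj, normSq_eq_norm_sq, ofReal_pow]

/-- Let `A = M - z` and `A w = 0` with `w ≠ 0`. The imaginary part of `w* A w` gives `Im z ‖w‖² + ρ
|w_0|² = 0`, so `w_0 = 0` and `z` is real. Put `v = Λ⁻¹ w`, legitimate since `w_0 = 0`. The
commutator identity gives `Λ A v = i (Σ v_k - v)`; its entry at `0` forces `Σ v_k = 0`. Pairing with
`w` then gives `w* A v = -i ‖v‖²`, whereas `w* A = 0` by the first step. Hence `v = 0` and `w = 0`.
-/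
theorem isUnit_shiftMatrix (hinj : Function.Injective lam) (h0 : lam 0 = 0) (hρ : 0 < ρ)
    {z : ℂ} (hz : 0 ≤ z.im) : IsUnit (shiftMatrix lam γ ρ z) := by
  set A := shiftMatrix lam γ ρ z with hA
  rw [Matrix.isUnit_iff_isUnit_det, isUnit_iff_ne_zero]
  intro hdet
  obtain ⟨w, hw0, hw⟩ := Matrix.exists_mulVec_eq_zero_iff.2 hdet
  have hwj : ∀ j, ∑ k, A j k * w k = 0 := fun j => congrFun hw j
  have hconj : ∀ j k, starRingEnd ℂ (A j k) = A k j + (if k = j then 2 * I * z.im else 0) +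
      if k = 0 ∧ j = 0 then 2 * I * ρ else 0 := by
    intro j k
    rw [hA, conj_shiftMatrix]
    congr 1
    have : (starRingEnd ℂ z) = z - 2 * I * z.im := by
      apply Complex.ext <;> simp
      ring
    by_cases h : k = j
    · subst h
      simp [shiftMatrix, this]
      ring
    · simp [shiftMatrix, Matrix.one_apply_ne h, h]
  -- This is `w* A = w* (A - A*)`, valid because `w* A* = (A w)* = 0`.
  have hleft : ∀ j, ∑ k, starRingEnd ℂ (w k) * A k j =
      -(2 * I * z.im) * starRingEnd ℂ (w j) -
        (if j = 0 then 2 * I * ρ else 0) * starRingEnd ℂ (w 0) := by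
    intro j
    have h1 := congrArg (starRingEnd ℂ) (hwj j)
    simp only [map_sum, map_mul, hconj, map_zero, add_mul, Finset.sum_add_distrib, ite_mul,
      zero_mul, Finset.sum_ite_eq', Finset.mem_univ, if_true] at h1
    have h2 : ∑ k, (if k = 0 ∧ j = 0 then 2 * I * ρ * starRingEnd ℂ (w k) else 0) =
        (if j = 0 then 2 * I * ρ else 0) * starRingEnd ℂ (w 0) := by
      by_cases hj : j = 0 <;> simp [hj]
    rw [h2] at h1
    have h3 : ∑ k, starRingEnd ℂ (w k) * A k j = ∑ k, A k j * starRingEnd ℂ (w k) :=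
      Finset.sum_congr rfl fun k _ => mul_comm _ _
    rw [h3]
    linear_combination h1
  have hpos : 0 < ∑ j, ‖w j‖ ^ 2 := by
    obtain ⟨j, hj⟩ := Function.ne_iff.1 hw0
    refine Finset.sum_pos' (fun i _ => by positivity) ⟨j, Finset.mem_univ j, ?_⟩
    have : 0 < ‖w j‖ := norm_pos_iff.2 hj
    positivity
  have hsum : z.im * ∑ j, ‖w j‖ ^ 2 + ρ * ‖w 0‖ ^ 2 = 0 := by
    have h1 : ∑ j, (∑ k, starRingEnd ℂ (w k) * A k j) * w j = 0 := by
      simp only [Finset.sum_mul]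
      rw [Finset.sum_comm]
      refine Finset.sum_eq_zero fun k _ => ?_
      simp only [mul_assoc]
      rw [← Finset.mul_sum, hwj, mul_zero]
    simp only [hleft, sub_mul, Finset.sum_sub_distrib, ite_mul, zero_mul, Finset.sum_ite_eq',
      Finset.mem_univ, if_true, mul_assoc] at h1
    rw [← Finset.mul_sum, sum_norm_sq_eq] at h1
    have h2 : starRingEnd ℂ (w 0) * w 0 = ((‖w 0‖ ^ 2 : ℝ) : ℂ) := by
      rw [mul_comm, mul_conj, normSq_eq_norm_sq]
    rw [h2] at h1
    have h3 : (-2 * I) * (((z.im * ∑ j, ‖w j‖ ^ 2 + ρ * ‖w 0‖ ^ 2 : ℝ)) : ℂ) = 0 := by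
      rw [← h1]
      push_cast
      ring
    rcases mul_eq_zero.1 h3 with h4 | h4
    · simp at h4
    · exact_mod_cast h4
  have hw00 : w 0 = 0 := by
    have h1 : 0 ≤ z.im * ∑ j, ‖w j‖ ^ 2 := by positivity
    have h2 : 0 ≤ ρ * ‖w 0‖ ^ 2 := by positivity
    have h3 : ρ * ‖w 0‖ ^ 2 = 0 := by linarith
    have h4 := (mul_eq_zero.1 h3).resolve_left hρ.ne'
    simpa using h4
  have hzim : z.im = 0 := by
    rw [hw00, norm_zero, zero_pow two_ne_zero, mul_zero, add_zero] at hsum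
    exact (mul_eq_zero.1 hsum).resolve_right hpos.ne'
  have hlam : ∀ k, k ≠ 0 → (lam k : ℂ) ≠ 0 := by
    intro k hk h
    exact hk (hinj (by rw [h0]; exact_mod_cast h))
  -- At index `0` both `w` and `lam` vanish and the quotient is `0` by convention, so the formula
  -- holds there too.
  have hw' : ∀ k, (lam k : ℂ) * (w k / lam k) = w k := by
    intro k
    by_cases hk : k = 0
    · simp [hk, hw00]
    · exact mul_div_cancel₀ _ (hlam k hk)
  have hcomm : ∀ j, (lam j : ℂ) * ∑ k, A j k * (w k / lam k) =
      I * (∑ k, w k / lam k - w j / lam j) := by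
    intro j
    have h1 : ∑ k, ((lam j : ℂ) * A j k - A j k * lam k) * (w k / lam k) =
        I * (∑ k, w k / lam k - w j / lam j) := by
      simp only [hA, commutator_shiftMatrix hinj, mul_assoc]
      rw [← Finset.mul_sum]
      simp [sub_mul, Finset.sum_sub_distrib, Matrix.one_apply]
    rw [← h1, Finset.mul_sum]
    simp only [sub_mul, Finset.sum_sub_distrib, mul_assoc, hw', hwj, sub_zero]
  have ha : ∑ k, w k / (lam k : ℂ) = 0 := by
    have h1 := hcomm 0
    rw [h0, hw00] at h1
    simpa using h1.symm
  have hfin : ∑ j, starRingEnd ℂ (w j / lam j) * (w j / lam j) = 0 := by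
    have h1 : ∑ j, starRingEnd ℂ (w j) * ∑ k, A j k * (w k / lam k) = 0 := by
      simp only [Finset.mul_sum]
      rw [Finset.sum_comm]
      refine Finset.sum_eq_zero fun k _ => ?_
      simp only [← mul_assoc]
      rw [← Finset.sum_mul, hleft, hzim, hw00]
      simp
    have h2 : ∀ j, starRingEnd ℂ (w j / lam j) * (w j / lam j) =
        I * (starRingEnd ℂ (w j) * ∑ k, A j k * (w k / lam k)) := by
      intro j
      by_cases hj : j = 0
      · simp [hj, hw00]
      · have h3 := hcomm j
        rw [ha, zero_sub] at h3
        have h4 := hlam j hj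
        have h5 : ∑ k, A j k * (w k / lam k) = I * -(w j / lam j) / lam j := by
          rw [← h3, mul_div_cancel_left₀ _ h4]
        rw [h5, map_div₀, conj_ofReal]
        field_simp
        rw [I_sq]
        ring
    simp only [h2]
    rw [← Finset.mul_sum, h1, mul_zero]
  rw [sum_norm_sq_eq] at hfin
  have h5 : ∑ j, ‖w j / (lam j : ℂ)‖ ^ 2 = 0 := by exact_mod_cast hfin
  apply hw0
  ext j
  have h6 := (Finset.sum_eq_zero_iff_of_nonneg (fun i _ => by positivity)).1 h5 j
    (Finset.mem_univ j)
  have h7 : w j / (lam j : ℂ) = 0 := by simpa using h6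
  rw [← hw' j, h7, mul_zero, Pi.zero_apply]

/-- Data for which the spectral matrix is dissipative with spectrum in the lower half-plane. -/
structure Admissible (lam : Fin N → ℝ) (ρ : ℝ) : Prop where
  inj : Function.Injective lam
  zero : lam 0 = 0
  pos : 0 < ρ

theorem Admissible.isUnit (h : Admissible lam ρ) {z : ℂ} (hz : 0 ≤ z.im) :
    IsUnit (shiftMatrix lam γ ρ z) :=
  isUnit_shiftMatrix h.inj h.zero h.pos hz

theorem Admissible.mul_resolv (h : Admissible lam ρ) {z : ℂ} (hz : 0 ≤ z.im) :
    shiftMatrix lam γ ρ z * resolv lam γ ρ z = 1 :=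
  Matrix.mul_nonsing_inv _ ((Matrix.isUnit_iff_isUnit_det _).1 (h.isUnit hz))

theorem Admissible.resolv_mul (h : Admissible lam ρ) {z : ℂ} (hz : 0 ≤ z.im) :
    resolv lam γ ρ z * shiftMatrix lam γ ρ z = 1 :=
  Matrix.nonsing_inv_mul _ ((Matrix.isUnit_iff_isUnit_det _).1 (h.isUnit hz))

/-- The matrix all of whose entries are `1`. -/
def onesMatrix (N : ℕ) : Matrix (Fin N) (Fin N) ℂ := Matrix.of fun _ _ => 1

/-- The matrix `Y Yᵀ`. -/
def cornerMatrix (N : ℕ) [NeZero N] : Matrix (Fin N) (Fin N) ℂ := Matrix.single 0 0 1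

/-- The diagonal matrix of the eigenvalues. -/
def eigenMatrix (lam : Fin N → ℝ) : Matrix (Fin N) (Fin N) ℂ := Matrix.diagonal fun j => (lam j : ℂ)

theorem eigenMatrix_commutator (hinj : Function.Injective lam) (z : ℂ) :
    eigenMatrix lam * shiftMatrix lam γ ρ z - shiftMatrix lam γ ρ z * eigenMatrix lam =
      I • (onesMatrix N - 1) := by
  ext j k
  rw [Matrix.sub_apply, eigenMatrix, Matrix.diagonal_mul, Matrix.mul_diagonal,
    commutator_shiftMatrix hinj]
  simp [onesMatrix]

theorem conjTranspose_shiftMatrix (x : ℝ) :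
    (shiftMatrix lam γ ρ x)ᴴ = shiftMatrix lam γ ρ x + (2 * I * ρ) • cornerMatrix N := by
  ext j k
  rw [Matrix.conjTranspose_apply]
  change starRingEnd ℂ _ = _
  rw [conj_shiftMatrix, conj_ofReal]
  simp [cornerMatrix, Matrix.single_apply, eq_comm]

theorem Admissible.resolv_commutator (h : Admissible lam ρ) {z : ℂ} (hz : 0 ≤ z.im) :
    resolv lam γ ρ z * eigenMatrix lam - eigenMatrix lam * resolv lam γ ρ z =
      I • (resolv lam γ ρ z * onesMatrix N * resolv lam γ ρ z -
        resolv lam γ ρ z * resolv lam γ ρ z) := by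
  have h1 := h.mul_resolv (γ := γ) hz
  have h2 := h.resolv_mul (γ := γ) hz
  have h3 := congrArg (fun B => resolv lam γ ρ z * B * resolv lam γ ρ z)
    (eigenMatrix_commutator (γ := γ) (ρ := ρ) h.inj z)
  simp only [Matrix.mul_sub, Matrix.sub_mul, Matrix.mul_smul, Matrix.smul_mul, smul_sub,
    Matrix.mul_one] at h3
  rw [← Matrix.mul_assoc, ← Matrix.mul_assoc, h2, Matrix.one_mul, Matrix.mul_assoc, Matrix.mul_assoc,
    h1, Matrix.mul_one] at h3
  rw [h3, smul_sub]

theorem mul_onesMatrix_mul_apply {n : ℕ} (B C : Matrix (Fin n) (Fin n) ℂ) (j k : Fin n) :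
    (B * onesMatrix n * C) j k = (∑ l, B j l) * ∑ l, C l k := by
  simp [Matrix.mul_apply, onesMatrix, Finset.mul_sum]

/-- Row `0` of the resolvent commutator, where `λ_0 = 0` removes one term. As `R' = R²`, this is the
eigenvalue equation of `L_u` for the entries of that row. -/
theorem Admissible.eigen_row (h : Admissible lam ρ) {z : ℂ} (hz : 0 ≤ z.im) (k : Fin N) :
    (lam k : ℂ) * resolv lam γ ρ z 0 k =
      -I * (resolv lam γ ρ z * resolv lam γ ρ z) 0 k +
        I * ((∑ j, resolv lam γ ρ z 0 j) * ∑ j, resolv lam γ ρ z j k) := by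
  have h1 := congrFun (congrFun (h.resolv_commutator (γ := γ) hz) 0) k
  rw [Matrix.sub_apply, eigenMatrix, Matrix.diagonal_mul, Matrix.mul_diagonal, h.zero,
    Matrix.smul_apply, Matrix.sub_apply, mul_onesMatrix_mul_apply] at h1
  simp only [ofReal_zero, zero_mul, sub_zero, smul_eq_mul] at h1
  linear_combination h1

/-- A commutator has trace zero, and `tr (R X Xᵀ R) = Xᵀ R² X`. -/
theorem Admissible.trace_sq (h : Admissible lam ρ) {z : ℂ} (hz : 0 ≤ z.im) :
    (resolv lam γ ρ z * resolv lam γ ρ z).trace =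
      ∑ j, ∑ k, (resolv lam γ ρ z * resolv lam γ ρ z) j k := by
  have h1 := congrArg Matrix.trace (h.resolv_commutator (γ := γ) hz)
  rw [Matrix.trace_sub, Matrix.trace_mul_comm, sub_self, Matrix.trace_smul, Matrix.trace_sub,
    smul_eq_mul] at h1
  have h2 := sub_eq_zero.1 ((mul_eq_zero.1 h1.symm).resolve_left I_ne_zero)
  rw [← h2, Matrix.trace_mul_comm, ← Matrix.mul_assoc, Matrix.trace]
  simp only [Matrix.diag_apply, Matrix.mul_apply, onesMatrix, Matrix.of_apply, mul_one]

/-- On the real line `M - x` differs from its adjoint by the rank-one matrix `2iρ Y Yᵀ`; this is the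
resulting resolvent identity. -/
theorem Admissible.resolv_eq_conjTranspose (h : Admissible lam ρ) (x : ℝ) :
    resolv lam γ ρ x = (resolv lam γ ρ x)ᴴ +
      (2 * I * ρ) • ((resolv lam γ ρ x)ᴴ * cornerMatrix N * resolv lam γ ρ x) := by
  have hx : 0 ≤ ((x : ℝ) : ℂ).im := by simp
  have h1 := h.mul_resolv (γ := γ) hx
  have h2 := congrArg Matrix.conjTranspose h1
  rw [Matrix.conjTranspose_mul, Matrix.conjTranspose_one, conjTranspose_shiftMatrix] at h2
  have h3 := congrArg (· * resolv lam γ ρ x) h2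
  simp only [Matrix.mul_add, Matrix.add_mul, Matrix.one_mul, Matrix.mul_smul, Matrix.smul_mul] at h3
  rw [Matrix.mul_assoc, h1, Matrix.mul_one] at h3
  exact h3.symm

theorem mul_cornerMatrix_mul_apply (B C : Matrix (Fin N) (Fin N) ℂ) (j k : Fin N) :
    (B * cornerMatrix N * C) j k = B j 0 * C 0 k := by
  rw [Matrix.mul_apply, Finset.sum_eq_single 0]
  · simp [cornerMatrix]
  · intro b _ hb
    simp [cornerMatrix, Matrix.mul_single_apply_of_ne, hb]
  · simp

theorem Admissible.resolv_sub_conj (h : Admissible lam ρ) (x : ℝ) (j k : Fin N) :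
    resolv lam γ ρ x j k - starRingEnd ℂ (resolv lam γ ρ x k j) =
      2 * I * ρ * (starRingEnd ℂ (resolv lam γ ρ x 0 j) * resolv lam γ ρ x 0 k) := by
  have h1 := congrFun (congrFun (h.resolv_eq_conjTranspose (γ := γ) x) j) k
  rw [Matrix.add_apply, Matrix.smul_apply, mul_cornerMatrix_mul_apply, Matrix.conjTranspose_apply,
    Matrix.conjTranspose_apply] at h1
  rw [h1]
  simp

/-- Sandwich `[Λ, M - x] = i (X Xᵀ - 1)` between `R` and `R*` and read the entry `(0, 0)`: the left
side vanishes since `Λ Y = 0`. Together with `resolv_sub_conj` this expresses `|u|²` through `tr R`.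
-/
theorem Admissible.norm_sq_row (h : Admissible lam ρ) (x : ℝ) :
    (∑ j, resolv lam γ ρ x 0 j) * starRingEnd ℂ (∑ j, resolv lam γ ρ x 0 j) =
      ∑ j, resolv lam γ ρ x 0 j * starRingEnd ℂ (resolv lam γ ρ x 0 j) := by
  have hx : 0 ≤ ((x : ℝ) : ℂ).im := by simp
  set R := resolv lam γ ρ x with hR
  set A := shiftMatrix lam γ ρ x with hA
  have h1 : A * R = 1 := h.mul_resolv (γ := γ) hx
  have h1' : R * A = 1 := h.resolv_mul (γ := γ) hx
  have h2 : A * Rᴴ = 1 - (2 * I * ρ) • (cornerMatrix N * Rᴴ) := by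
    have := congrArg Matrix.conjTranspose h1'
    rw [Matrix.conjTranspose_mul, Matrix.conjTranspose_one, hA, conjTranspose_shiftMatrix,
      Matrix.add_mul, Matrix.smul_mul] at this
    rw [← this, hA]
    abel
  have h3 := congrArg (fun B => R * B * Rᴴ)
    (eigenMatrix_commutator (γ := γ) (ρ := ρ) h.inj (x : ℂ))
  simp only [Matrix.mul_sub, Matrix.sub_mul, Matrix.mul_smul, Matrix.smul_mul, smul_sub,
    Matrix.mul_one] at h3
  rw [← hA, ← Matrix.mul_assoc R A, h1', Matrix.one_mul, ← Matrix.mul_assoc, Matrix.mul_assoc (R * _),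
    h2] at h3
  have h4 : eigenMatrix lam * cornerMatrix N = 0 := by
    ext j k
    by_cases hj : j = 0 <;> simp [eigenMatrix, cornerMatrix, h.zero, hj, Matrix.single_apply, eq_comm]
  rw [Matrix.mul_sub, Matrix.mul_one, Matrix.mul_smul, ← Matrix.mul_assoc, Matrix.mul_assoc R, h4,
    Matrix.mul_zero, Matrix.zero_mul, smul_zero, sub_zero] at h3
  have h5 := congrFun (congrFun h3 0) 0
  rw [Matrix.sub_apply, Matrix.sub_apply, Matrix.smul_apply, Matrix.smul_apply,
    mul_onesMatrix_mul_apply] at h5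
  simp only [eigenMatrix, Matrix.diagonal_mul, Matrix.mul_diagonal, h.zero, ofReal_zero, mul_zero,
    zero_mul, sub_zero, smul_eq_mul, ← mul_sub] at h5
  have h6 := sub_eq_zero.1 ((mul_eq_zero.1 h5.symm).resolve_left I_ne_zero)
  rw [map_sum]
  simpa [Matrix.mul_apply] using h6

/-- An entry of the resolvent on the closed upper half-plane. -/
def resolvFun (lam γ : Fin N → ℝ) (ρ : ℝ) (j k : Fin N) : ClosedUHP → ℂ :=
  fun z => resolv lam γ ρ z j k

theorem eval_det_X_smul_add_C {n : ℕ} (A B : Matrix (Fin n) (Fin n) ℂ) (z : ℂ) :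
    (Matrix.det ((Polynomial.X : Polynomial ℂ) • A.map Polynomial.C + B.map Polynomial.C)).eval z =
      Matrix.det (z • A + B) := by
  rw [← Polynomial.coe_evalRingHom, RingHom.map_det]
  congr 1
  ext i j
  simp
  ring

/-- Characteristic polynomial of the spectral matrix, up to sign. -/
def detPoly (lam γ : Fin N → ℝ) (ρ : ℝ) : Polynomial ℂ :=
  Matrix.det ((Polynomial.X : Polynomial ℂ) • (-1 : Matrix (Fin N) (Fin N) ℂ).map Polynomial.C +
    (spectralMatrix lam γ ρ).map Polynomial.C)

theorem eval_detPoly (z : ℂ) : (detPoly lam γ ρ).eval z = (shiftMatrix lam γ ρ z).det := by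
  rw [detPoly, eval_det_X_smul_add_C, shiftMatrix]
  congr 1
  simp [sub_eq_neg_add]

theorem degree_detPoly : (detPoly lam γ ρ).degree = N := by
  have h1 := Polynomial.natDegree_det_X_add_C_le (-1 : Matrix (Fin N) (Fin N) ℂ)
    (spectralMatrix lam γ ρ)
  have h2 := Polynomial.coeff_det_X_add_C_card (-1 : Matrix (Fin N) (Fin N) ℂ)
    (spectralMatrix lam γ ρ)
  rw [Fintype.card_fin] at h1 h2
  refine le_antisymm (Polynomial.degree_le_of_natDegree_le h1) (Polynomial.le_degree_of_ne_zero ?_)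
  rw [detPoly, h2, Matrix.det_neg, Matrix.det_one]
  simp

/-- Cramer's rule. The cofactor is the determinant of a pencil whose coefficient of `z` has a zero
row, so its degree is below `N`; the roots of `detPoly` lie in the lower half-plane by
invertibility. -/
theorem Admissible.resolvFun_mem (h : Admissible lam ρ) (j k : Fin N) :
    resolvFun lam γ ρ j k ∈ ratHardy := by
  set A' : Matrix (Fin N) (Fin N) ℂ := (-1 : Matrix (Fin N) (Fin N) ℂ).updateRow k 0
  set B' := (spectralMatrix lam γ ρ).updateRow k (Pi.single j 1)
  set P := Matrix.det ((Polynomial.X : Polynomial ℂ) • A'.map Polynomial.C + B'.map Polynomial.C)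
  have hP : ∀ z : ℂ, P.eval z = (shiftMatrix lam γ ρ z).adjugate j k := by
    intro z
    rw [eval_det_X_smul_add_C, Matrix.adjugate_apply]
    congr 1
    ext a b
    by_cases ha : a = k
    · subst ha
      simp [A', B']
    · simp [A', B', ha, shiftMatrix]
      ring
  have hQ : ∀ z : ℂ, (detPoly lam γ ρ).IsRoot z → z.im < 0 := by
    intro z hz
    by_contra hz'
    rw [Polynomial.IsRoot, eval_detPoly] at hz
    have := (Matrix.isUnit_iff_isUnit_det _).1 (h.isUnit (γ := γ) (not_lt.1 hz'))
    exact this.ne_zero hz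
  have hdeg : P.degree < (detPoly lam γ ρ).degree := by
    rw [degree_detPoly]
    have h1 := Polynomial.natDegree_det_X_add_C_le A' B'
    have h2 := Polynomial.coeff_det_X_add_C_card A' B'
    rw [Fintype.card_fin] at h1 h2
    refine lt_of_le_of_ne (Polynomial.degree_le_of_natDegree_le h1) fun hne => ?_
    have h3 : A'.det = 0 := Matrix.det_eq_zero_of_row_eq_zero k fun b => by simp [A']
    rw [h3] at h2
    exact Polynomial.coeff_ne_zero_of_eq_degree hne h2
  convert ratFun_mem hQ hdeg using 1
  ext z
  rw [ratFun, resolvFun, resolv, hP, eval_detPoly, Matrix.inv_def, Matrix.smul_apply,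
    Ring.inverse_eq_inv', smul_eq_mul, div_eq_inv_mul]

/-- From `x R = M R - 1` and `R → 0` at infinity. -/
theorem Admissible.tendsto_resolvFun (h : Admissible lam ρ) (j k : Fin N) :
    Tendsto (fun x : ℝ => x * resolvFun lam γ ρ j k (ofReal' x)) atTop
      (𝓝 (-(1 : Matrix (Fin N) (Fin N) ℂ) j k)) := by
  have h0 : ∀ l, Tendsto (fun x : ℝ => resolvFun lam γ ρ l k (ofReal' x)) atTop (𝓝 0) := by
    intro l
    obtain ⟨ℓ, hℓ⟩ := exists_lead (h.resolvFun_mem (γ := γ) l k)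
    have h1 : Tendsto (fun x : ℝ => (x : ℂ)⁻¹) atTop (𝓝 0) := by
      simpa using tendsto_inv_ofReal_sub 0
    have h2 := h1.mul hℓ
    rw [zero_mul] at h2
    refine h2.congr' ?_
    filter_upwards [eventually_ne_atTop 0] with x hx
    have : (x : ℂ) ≠ 0 := by exact_mod_cast hx
    rw [← mul_assoc, inv_mul_cancel₀ this, one_mul]
  have h1 : Tendsto (fun x : ℝ => ∑ l, spectralMatrix lam γ ρ j l *
      resolvFun lam γ ρ l k (ofReal' x) - (1 : Matrix (Fin N) (Fin N) ℂ) j k) atTop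
      (𝓝 (∑ l, spectralMatrix lam γ ρ j l * 0 - (1 : Matrix (Fin N) (Fin N) ℂ) j k)) :=
    (tendsto_finsetSum _ fun l _ => (h0 l).const_mul _).sub_const _
  simp only [mul_zero, Finset.sum_const_zero, zero_sub] at h1
  refine h1.congr fun x => ?_
  have h2 := congrFun (congrFun (h.mul_resolv (γ := γ) (z := (x : ℂ)) (by simp)) j) k
  rw [shiftMatrix, Matrix.sub_mul, Matrix.sub_apply, Matrix.smul_mul, Matrix.one_mul,
    Matrix.smul_apply, Matrix.mul_apply, smul_eq_mul] at h2
  rw [← h2]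
  simp [resolvFun]

/-- The entries are rational, hence differentiable, and differentiating `(M - x) R = 1` gives `(M -
x) R' = R`. -/
theorem Admissible.hasDerivAt_resolvFun (h : Admissible lam ρ) (j k : Fin N) (x : ℝ) :
    HasDerivAt (fun x : ℝ => resolvFun lam γ ρ j k (ofReal' x))
      ((resolv lam γ ρ x * resolv lam γ ρ x) j k) x := by
  choose f' hf' hd _ using fun j k => exists_deriv_ratHardy (h.resolvFun_mem (γ := γ) j k)
  set B : Matrix (Fin N) (Fin N) ℂ := Matrix.of fun j k => f' j k (ofReal' x) with hB
  have h1 : shiftMatrix lam γ ρ x * B = resolv lam γ ρ x := by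
    ext j k
    have h2 : HasDerivAt (fun y : ℝ => ∑ l, spectralMatrix lam γ ρ j l *
        resolvFun lam γ ρ l k (ofReal' y) - (y : ℂ) * resolvFun lam γ ρ j k (ofReal' y))
        (∑ l, spectralMatrix lam γ ρ j l * f' l k (ofReal' x) -
          (1 * resolvFun lam γ ρ j k (ofReal' x) + (x : ℂ) * f' j k (ofReal' x))) x :=
      (HasDerivAt.fun_sum fun l _ => (hd l k x).const_mul _).sub
        ((hasDerivAt_id x).ofReal_comp.mul (hd j k x))
    have h3 : (fun y : ℝ => ∑ l, spectralMatrix lam γ ρ j l *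
        resolvFun lam γ ρ l k (ofReal' y) - (y : ℂ) * resolvFun lam γ ρ j k (ofReal' y)) =
        fun _ => (1 : Matrix (Fin N) (Fin N) ℂ) j k := by
      ext y
      have h2 := congrFun (congrFun (h.mul_resolv (γ := γ) (z := (y : ℂ)) (by simp)) j) k
      rw [shiftMatrix, Matrix.sub_mul, Matrix.sub_apply, Matrix.smul_mul, Matrix.one_mul,
        Matrix.smul_apply, Matrix.mul_apply, smul_eq_mul] at h2
      rw [← h2]
      simp [resolvFun]
    rw [h3] at h2
    have h4 := h2.unique (hasDerivAt_const x _)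
    rw [shiftMatrix, Matrix.sub_mul, Matrix.sub_apply, Matrix.smul_mul, Matrix.one_mul,
      Matrix.smul_apply, Matrix.mul_apply, smul_eq_mul]
    simp only [resolvFun, coe_ofReal'] at h4
    simp only [hB, Matrix.of_apply]
    linear_combination h4
  have h5 : resolv lam γ ρ x * resolv lam γ ρ x = B := by
    calc resolv lam γ ρ x * resolv lam γ ρ x = resolv lam γ ρ x * (shiftMatrix lam γ ρ x * B) := by
          rw [h1]
      _ = B := by rw [← Matrix.mul_assoc, h.resolv_mul (by simp), Matrix.one_mul]
  rw [h5]
  exact hd j k x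

end

/-! ### The function `c Yᵀ (M - z)⁻¹ X` has the prescribed spectral data -/

section

/-- Right neighbourhoods of zero have positive measure, which makes essential one-sided limits
unique. -/
instance neBot_nhdsGT_inf_ae : (𝓝[>] (0 : ℝ) ⊓ ae (volume : Measure ℝ)).NeBot := by
  rw [inf_neBot_iff]
  intro s hs t ht
  obtain ⟨ε, hε, hsub⟩ := mem_nhdsGT_iff_exists_Ioo_subset.1 hs
  have hε' : (0 : ℝ) < ε := hε
  by_contra hne
  have h1 : Set.Ioo 0 ε ⊆ tᶜ := fun x hx hxt => hne ⟨x, hsub hx, hxt⟩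
  have h2 : volume (Set.Ioo 0 ε) = 0 := measure_mono_null h1 (mem_ae_iff.1 ht)
  rw [Real.volume_Ioo, sub_zero, ENNReal.ofReal_eq_zero] at h2
  linarith

/-- The inner product is the Fourier transform of the integrable function `ū f` at zero. That
transform is continuous, so it can be evaluated from the right, where `Π₊` does not alter it. -/
theorem inner_eq_of_fourierAtZeroPlus {u f : LTwo} (hu : IsWiener u) {a : ℂ}
    (ha : FourierAtZeroPlus (szegoProj (mulL2 (conjFun u) f)) a) : inner ℂ u f = a := by
  obtain ⟨c, hc, hc', hc0⟩ := exists_fourier_conj_mul (u := u) (f := f) hu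
  rw [← hc0]
  refine tendsto_nhds_unique (f := fun η : ℝ => (𝓕 (szegoProj (mulL2 (conjFun u) f)) : LTwo) η)
    (l := 𝓝[>] (0 : ℝ) ⊓ ae volume) ?_ ha
  have h1 : Tendsto c (𝓝[>] (0 : ℝ) ⊓ ae volume) (𝓝 (c 0)) :=
    (hc.tendsto 0).mono_left (inf_le_left.trans nhdsWithin_le_nhds)
  refine h1.congr' ?_
  have h2 : ∀ᶠ η in 𝓝[>] (0 : ℝ) ⊓ ae volume, 0 < η :=
    (eventually_mem_nhdsWithin (α := ℝ) (a := 0) (s := Set.Ioi 0)).filter_mono inf_le_left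
  have h3 : ∀ᶠ η in 𝓝[>] (0 : ℝ) ⊓ ae volume,
      (𝓕 (szegoProj (mulL2 (conjFun u) f)) : LTwo) η = (Set.Ici (0 : ℝ)).indicator
        (𝓕 (mulL2 (conjFun u) f) : LTwo) η :=
    (fourier_szegoProj (mulL2 (conjFun u) f)).filter_mono inf_le_right
  have h4 : ∀ᶠ η in 𝓝[>] (0 : ℝ) ⊓ ae volume, (𝓕 (mulL2 (conjFun u) f) : LTwo) η = c η :=
    hc'.filter_mono inf_le_right
  filter_upwards [h2, h3, h4] with η h2 h3 h4
  rw [h3, Set.indicator_of_mem (Set.mem_Ici.2 h2.le), h4]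

theorem mulL2_realize {f g : ClosedUHP → ℂ} (hf : f ∈ ratHardy) (hg : g ∈ ratHardy) :
    mulL2 (realize f) (realize g) = realize (f * g) := by
  apply eq_realize (ratHardy_mul_mem hf hg)
  filter_upwards [coeFn_mulL2_wiener (isWiener_realize hf) (realize g), realize_ae hf,
    realize_ae hg] with x h1 h2 h3
  rw [h1, h2, h3, Pi.mul_apply]

theorem realize_sub {f g : ClosedUHP → ℂ} (hf : f ∈ ratHardy) (hg : g ∈ ratHardy) :
    realize (f - g) = realize f - realize g := by
  rw [eq_sub_iff_add_eq, ← realize_add (ratHardy.sub_mem hf hg) hg, sub_add_cancel]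

theorem realize_sum {n : ℕ} (c : Fin n → ℂ) {f : Fin n → ClosedUHP → ℂ} (hf : ∀ j, f j ∈ ratHardy) :
    realize (∑ j, c j • f j) = ∑ j, c j • realize (f j) := by
  have hmem : ∀ s : Finset (Fin n), (∑ j ∈ s, c j • f j) ∈ ratHardy :=
    fun s => Submodule.sum_mem _ fun j _ => ratHardy.smul_mem _ (hf j)
  have h : ∀ s : Finset (Fin n), realize (∑ j ∈ s, c j • f j) = ∑ j ∈ s, c j • realize (f j) := by
    intro s
    induction s using Finset.induction_on with
    | empty => simp [realize_zero]
    | insert a s ha ih =>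
      rw [Finset.sum_insert ha, Finset.sum_insert ha,
        realize_add (ratHardy.smul_mem _ (hf a)) (hmem s), ih, realize_smul _ (hf a)]
  exact h _

variable {N : ℕ} [NeZero N] {lam γ : Fin N → ℝ} {ρ : ℝ} {c : ℂ}

/-- The function `c Yᵀ (M - z)⁻¹ X`. -/
def solitonFun (lam γ : Fin N → ℝ) (ρ : ℝ) (c : ℂ) : ClosedUHP → ℂ :=
  c • ∑ j, resolvFun lam γ ρ 0 j

theorem solitonFun_apply (z : ClosedUHP) :
    solitonFun lam γ ρ c z = c * ∑ j, resolv lam γ ρ z 0 j := by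
  simp [solitonFun, resolvFun]

theorem inverseFormula_eq (φ : ℝ) (z : ℂ) :
    inverseFormula lam γ ρ φ z =
      ((√(2 * ρ) : ℝ) : ℂ) * Complex.exp (I * φ) * ∑ j, resolv lam γ ρ z 0 j := by
  rw [inverseFormula]
  congr 1
  rw [dotProduct, Finset.sum_eq_single 0]
  · simp [Matrix.mulVec, dotProduct, resolv, shiftMatrix]
  · intro j _ hj
    simp [hj]
  · simp

theorem Admissible.solitonFun_mem (h : Admissible lam ρ) : solitonFun lam γ ρ c ∈ ratHardy :=
  ratHardy.smul_mem _ (Submodule.sum_mem _ fun j _ => h.resolvFun_mem 0 j)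

theorem Admissible.colSum_mem (h : Admissible lam ρ) (k : Fin N) :
    (∑ j, resolvFun lam γ ρ j k) ∈ ratHardy :=
  Submodule.sum_mem _ fun j _ => h.resolvFun_mem j k

theorem Admissible.tendsto_solitonFun (h : Admissible lam ρ) :
    Tendsto (fun x : ℝ => x * solitonFun lam γ ρ c (ofReal' x)) atTop (𝓝 (-c)) := by
  have h1 : Tendsto (fun x : ℝ => c * ∑ j, x * resolvFun lam γ ρ 0 j (ofReal' x)) atTop
      (𝓝 (c * ∑ j, -(1 : Matrix (Fin N) (Fin N) ℂ) 0 j)) :=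
    (tendsto_finsetSum _ fun j _ => h.tendsto_resolvFun 0 j).const_mul c
  have h2 : c * ∑ j, -(1 : Matrix (Fin N) (Fin N) ℂ) 0 j = -c := by
    simp [Matrix.one_apply]
  rw [h2] at h1
  refine h1.congr fun x => ?_
  rw [solitonFun_apply, ← Finset.mul_sum]
  simp only [resolvFun]
  ring

theorem Admissible.tendsto_colSum (h : Admissible lam ρ) (k : Fin N) :
    Tendsto (fun x : ℝ => x * (∑ j, resolvFun lam γ ρ j k) (ofReal' x)) atTop (𝓝 (-1)) := by
  have h1 : Tendsto (fun x : ℝ => ∑ j, x * resolvFun lam γ ρ j k (ofReal' x)) atTop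
      (𝓝 (∑ j, -(1 : Matrix (Fin N) (Fin N) ℂ) j k)) :=
    tendsto_finsetSum _ fun j _ => h.tendsto_resolvFun j k
  have h2 : ∑ j, -(1 : Matrix (Fin N) (Fin N) ℂ) j k = -1 := by
    simp [Matrix.one_apply]
  rw [h2] at h1
  refine h1.congr fun x => ?_
  rw [Finset.sum_apply, Finset.mul_sum]

/-- By `resolv_sub_conj`, `conj(R_0j) R_0k` is `(R_jk - conj(R_kj)) / (2iρ)`: a Hardy function plus
the conjugate of one, and `Π₊` keeps the former. -/
theorem Admissible.szegoProj_conj_mul_row (h : Admissible lam ρ) (k : Fin N) :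
    szegoProj (mulL2 (conjFun (realize (solitonFun lam γ ρ c))) (realize (resolvFun lam γ ρ 0 k))) =
      realize ((starRingEnd ℂ c / (2 * I * ρ)) • ∑ j, resolvFun lam γ ρ j k) := by
  have hρ : (ρ : ℂ) ≠ 0 := by exact_mod_cast h.pos.ne'
  refine szegoProj_of_ae_eq (g := (c / (2 * I * ρ)) • ∑ j, resolvFun lam γ ρ k j)
    (ratHardy.smul_mem _ (h.colSum_mem k))
    (ratHardy.smul_mem _ (Submodule.sum_mem _ fun j _ => h.resolvFun_mem k j)) ?_
  filter_upwards [coeFn_mulL2_conjFun (isWiener_realize (h.solitonFun_mem (γ := γ) (c := c)))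
    (realize (resolvFun lam γ ρ 0 k)), realize_ae (h.solitonFun_mem (γ := γ) (c := c)),
    realize_ae (h.resolvFun_mem (γ := γ) 0 k)] with x h1 h2 h3
  rw [h1, h2, h3, solitonFun_apply]
  simp only [Pi.smul_apply, Finset.sum_apply, smul_eq_mul, resolvFun, coe_ofReal', map_mul, map_sum,
    map_div₀, conj_I, conj_ofReal, map_ofNat]
  have h4 : ∑ j, starRingEnd ℂ (resolv lam γ ρ x 0 j) * resolv lam γ ρ x 0 k =
      (2 * I * ρ)⁻¹ * (∑ j, resolv lam γ ρ x j k - ∑ j, starRingEnd ℂ (resolv lam γ ρ x k j)) := by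
    rw [← Finset.sum_sub_distrib, Finset.mul_sum]
    refine Finset.sum_congr rfl fun j _ => ?_
    rw [h.resolv_sub_conj, inv_mul_cancel_left₀ (by simp [hρ])]
  rw [mul_assoc, Finset.sum_mul, h4]
  field_simp
  ring

/-- Here `D` produces `-i (R²)_0k`, and `T_u T_ū` produces a product of a row sum and a column sum
with coefficient `|c|² / (2iρ) = -i`; these are the two terms in `eigen_row`. -/
theorem Admissible.solvesEigenEq_row (h : Admissible lam ρ) (hc : c * starRingEnd ℂ c = 2 * ρ)
    (k : Fin N) :
    SolvesEigenEq (realize (solitonFun lam γ ρ c)) (lam k) (realize (resolvFun lam γ ρ 0 k)) := by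
  have hρ : (ρ : ℂ) ≠ 0 := by exact_mod_cast h.pos.ne'
  have hr := h.resolvFun_mem (γ := γ) 0 k
  have hv := h.solitonFun_mem (γ := γ) (c := c)
  have hs := h.colSum_mem (γ := γ) k
  refine ⟨memHardySobolev_one_realize hr, ?_⟩
  set f' : ClosedUHP → ℂ := fun z => (resolv lam γ ρ z * resolv lam γ ρ z) 0 k with hf'
  have hf'_mem : f' ∈ ratHardy := by
    have : f' = ∑ l, resolvFun lam γ ρ 0 l * resolvFun lam γ ρ l k := by
      ext z
      simp [hf', Matrix.mul_apply, resolvFun]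
    rw [this]
    exact Submodule.sum_mem _ fun l _ => ratHardy_mul_mem (h.resolvFun_mem _ _) (h.resolvFun_mem _ _)
  rw [laxOp_eq (isWiener_realize hv) (memHardy_realize hv) (isWiener_realize hr),
    h.szegoProj_conj_mul_row, opD_realize (f' := f') hr (h.hasDerivAt_resolvFun 0 k),
    mulL2_realize hv (ratHardy.smul_mem _ hs), ← realize_smul _ hf'_mem, ← realize_smul _ hr,
    ← realize_sub (ratHardy.smul_mem _ hf'_mem) (ratHardy_mul_mem hv (ratHardy.smul_mem _ hs))]
  congr 1
  ext z
  have h1 := h.eigen_row (γ := γ) z.2 k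
  simp only [Pi.sub_apply, Pi.smul_apply, Pi.mul_apply, smul_eq_mul, solitonFun_apply,
    Finset.sum_apply, resolvFun, hf']
  rw [h1]
  have h2 : c * (∑ j, resolv lam γ ρ z 0 j) * (starRingEnd ℂ c / (2 * I * ρ) *
      ∑ j, resolv lam γ ρ z j k) = -I * ((∑ j, resolv lam γ ρ z 0 j) *
      ∑ j, resolv lam γ ρ z j k) := by
    have : c * starRingEnd ℂ c / (2 * I * ρ) = -I := by
      rw [hc]
      field_simp
      rw [I_sq]
      ring
    rw [← this]
    ring
  rw [h2]
  ring

theorem Admissible.inner_soliton_row (h : Admissible lam ρ) (k : Fin N) :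
    inner ℂ (realize (solitonFun lam γ ρ c)) (realize (resolvFun lam γ ρ 0 k)) =
      Real.pi * starRingEnd ℂ c / ρ := by
  have hρ : (ρ : ℂ) ≠ 0 := by exact_mod_cast h.pos.ne'
  apply inner_eq_of_fourierAtZeroPlus (isWiener_realize h.solitonFun_mem)
  rw [h.szegoProj_conj_mul_row]
  have h1 : Tendsto (fun x : ℝ => x * ((starRingEnd ℂ c / (2 * I * ρ)) •
      ∑ j, resolvFun lam γ ρ j k) (ofReal' x)) atTop (𝓝 (starRingEnd ℂ c / (2 * I * ρ) * -1)) := by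
    refine ((h.tendsto_colSum (γ := γ) k).const_mul (starRingEnd ℂ c / (2 * I * ρ))).congr
      fun x => ?_
    rw [Pi.smul_apply, smul_eq_mul]
    ring
  convert fourierAtZeroPlus_realize (ratHardy.smul_mem _ (h.colSum_mem (γ := γ) k)) h1 using 1
  field_simp

/-- Row `0` of `R (M - z) = 1` reads `z R_0k + δ_0k = Σ_j M_jk R_0j`, and `-δ_0k` is exactly the
limit that `G` subtracts. -/
theorem Admissible.generatorMaps_row (h : Admissible lam ρ) (k : Fin N) :
    GeneratorMaps (realize (resolvFun lam γ ρ 0 k))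
      (∑ j, spectralMatrix lam γ ρ j k • realize (resolvFun lam γ ρ 0 j)) := by
  obtain ⟨ℓ, h1, h2, h3⟩ := exists_generator (h.resolvFun_mem (γ := γ) 0 k)
  have hℓ := tendsto_nhds_unique h1 (h.tendsto_resolvFun (γ := γ) 0 k)
  rw [← realize_sum _ fun j => h.resolvFun_mem 0 j]
  convert h3 using 2
  ext z
  have h4 := congrFun (congrFun (h.resolv_mul (γ := γ) z.2) 0) k
  rw [shiftMatrix, Matrix.mul_sub, Matrix.mul_smul, Matrix.mul_one, Matrix.sub_apply,
    Matrix.smul_apply, Matrix.mul_apply, smul_eq_mul] at h4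
  rw [hℓ, ← h4]
  simp only [Finset.sum_apply, Pi.smul_apply, smul_eq_mul, resolvFun]
  rw [Finset.sum_congr rfl fun j _ => mul_comm (spectralMatrix lam γ ρ j k) (resolv lam γ ρ z 0 j)]
  ring

theorem Admissible.exists_normalizedEigenbasis (h : Admissible lam ρ)
    (hc : c * starRingEnd ℂ c = 2 * ρ) :
    ∃ α : ℂ, IsNormalizedEigenbasis (realize (solitonFun lam γ ρ c)) lam
      fun k => α • realize (resolvFun lam γ ρ 0 k) := by
  have hρ : (ρ : ℂ) ≠ 0 := by exact_mod_cast h.pos.ne'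
  have hc0 : c ≠ 0 := by
    rintro rfl
    simp at hc
    exact h.pos.ne' hc
  have hpi : (Real.pi : ℂ) ≠ 0 := by exact_mod_cast Real.pi_ne_zero
  have hv := h.solitonFun_mem (γ := γ) (c := c)
  -- One scalar normalises all rows at once, because their inner products with the potential do not
  -- depend on `k`.
  set α := ((√(2 * Real.pi) : ℝ) : ℂ) * ρ / (Real.pi * starRingEnd ℂ c) with hα
  have hin : ∀ k, inner ℂ (realize (solitonFun lam γ ρ c))
      (α • realize (resolvFun lam γ ρ 0 k)) = ((√(2 * Real.pi) : ℝ) : ℂ) := by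
    intro k
    have : starRingEnd ℂ c ≠ 0 := by simpa using hc0
    rw [inner_smul_right, h.inner_soliton_row, hα]
    field_simp
  refine ⟨α, fun k => ?_⟩
  have h1 := (h.solvesEigenEq_row (γ := γ) hc k).smul α (isWiener_realize hv)
  refine ⟨h1, ?_, ?_⟩
  · have h2 := norm_inner_sq_eq (isWiener_realize hv) (memHardy_realize hv) h1
    rw [hin, norm_real, Real.norm_of_nonneg (Real.sqrt_nonneg _), Real.sq_sqrt (by positivity)] at h2
    have h3 : ‖α • realize (resolvFun lam γ ρ 0 k)‖ ^ 2 = 1 := by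
      have : 0 < 2 * Real.pi := by positivity
      nlinarith
    exact (pow_eq_one_iff_of_nonneg (norm_nonneg _) two_ne_zero).1 h3
  · rw [← inner_conj_symm, hin, conj_ofReal]

theorem IsNormalizedEigenbasis.inner_eq {n : ℕ} {u : LTwo} {lam : Fin n → ℝ} {ψ : Fin n → LTwo}
    (hinj : Function.Injective lam) (hu : IsWiener u) (hu' : MemHardy u)
    (h : IsNormalizedEigenbasis u lam ψ) (j k : Fin n) :
    inner ℂ (ψ j) (ψ k) = if j = k then 1 else 0 := by
  split_ifs with hjk
  · subst hjk
    rw [inner_self_eq_norm_sq_to_K, (h j).2.1]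
    simp
  · exact (h j).1.inner_eq_zero hu hu' (h k).1 (hinj.ne hjk)

/-- By uniqueness of the normalised eigenbasis one basis suffices. In it `G` has the coefficients
`M_jk`, unaffected by the common scalar, and orthonormality extracts them. -/
theorem Admissible.isGeneratorMatrix (h : Admissible lam ρ) (hc : c * starRingEnd ℂ c = 2 * ρ) :
    IsGeneratorMatrix (realize (solitonFun lam γ ρ c)) lam (spectralMatrix lam γ ρ) := by
  have hv := h.solitonFun_mem (γ := γ) (c := c)
  obtain ⟨α, hα⟩ := h.exists_normalizedEigenbasis (γ := γ) hc
  refine ⟨⟨_, hα⟩, fun ψ hψ j k => ?_⟩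
  rw [hψ.unique (isWiener_realize hv) (memHardy_realize hv) hα]
  refine ⟨_, (h.generatorMaps_row k).smul α, ?_⟩
  rw [Finset.smul_sum, inner_sum, Finset.sum_eq_single j]
  · rw [smul_comm, inner_smul_right,
      hα.inner_eq h.inj (isWiener_realize hv) (memHardy_realize hv) j j]
    simp
  · intro b _ hb
    rw [smul_comm, inner_smul_right,
      hα.inner_eq h.inj (isWiener_realize hv) (memHardy_realize hv) j b, if_neg hb.symm, mul_zero]
  · simp

theorem Admissible.hasSpectralParameters (h : Admissible lam ρ) {φ : ℝ}
    (hc : c = ((√(2 * ρ) : ℝ) : ℂ) * Complex.exp (I * φ)) :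
    HasSpectralParameters (realize (solitonFun lam γ ρ c)) lam γ ρ φ := by
  have hc' : c * starRingEnd ℂ c = 2 * ρ := by
    rw [mul_conj, normSq_eq_norm_sq, hc, norm_mul, norm_real, mul_comm I, norm_exp_ofReal_mul_I,
      mul_one, Real.norm_of_nonneg (Real.sqrt_nonneg _), Real.sq_sqrt (by linarith [h.pos])]
    push_cast
    ring
  refine ⟨h.pos, ?_, h.isGeneratorMatrix hc'⟩
  rw [← hc]
  convert fourierAtZeroPlus_realize h.solitonFun_mem (h.tendsto_solitonFun (γ := γ) (c := c)) using 1
  ring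

theorem Admissible.recoveredFrom (h : Admissible lam ρ) {φ : ℝ}
    (hc : c = ((√(2 * ρ) : ℝ) : ℂ) * Complex.exp (I * φ)) :
    RecoveredFrom (realize (solitonFun lam γ ρ c)) lam γ ρ φ := by
  refine ⟨fun z hz => ⟨h.isUnit hz, ?_⟩, ?_⟩
  · have := hardyEval_realize (h.solitonFun_mem (γ := γ) (c := c)) ⟨z, hz⟩
    rw [this, inverseFormula_eq, solitonFun_apply, hc]
  · filter_upwards [realize_ae (h.solitonFun_mem (γ := γ) (c := c))] with x hx
    rw [hx, inverseFormula_eq, solitonFun_apply, hc, coe_ofReal']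

end

/-! ### The commutator of `L_u` with `G`, and the invariant space `{A / Q}` -/

section

/-- `ℓ = lim x f(x)` as `x → +∞`. -/
def HasLead (f : ClosedUHP → ℂ) (ℓ : ℂ) : Prop :=
  Tendsto (fun x : ℝ => x * f (ofReal' x)) atTop (𝓝 ℓ)

/-- The function `z f(z) - ℓ`. -/
def shiftFun (f : ClosedUHP → ℂ) (ℓ : ℂ) : ClosedUHP → ℂ := fun z => (z : ℂ) * f z - ℓ

variable {f g p h k : ClosedUHP → ℂ} {ℓ ℓ' ℓp ℓh ℓk : ℂ}

theorem HasLead.add (hf : HasLead f ℓ) (hg : HasLead g ℓ') : HasLead (f + g) (ℓ + ℓ') := by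
  refine (Tendsto.add hf hg).congr fun x => ?_
  rw [Pi.add_apply]
  ring

theorem HasLead.smul (c : ℂ) (hf : HasLead f ℓ) : HasLead (c • f) (c * ℓ) := by
  refine (Tendsto.const_mul c hf).congr fun x => ?_
  rw [Pi.smul_apply, smul_eq_mul]
  ring

theorem HasLead.unique (hf : HasLead f ℓ) (hg : HasLead f ℓ') : ℓ = ℓ' :=
  tendsto_nhds_unique hf hg

theorem HasLead.tendsto_zero (hf : HasLead f ℓ) :
    Tendsto (fun x : ℝ => f (ofReal' x)) atTop (𝓝 0) := by
  have h1 : Tendsto (fun x : ℝ => (x : ℂ)⁻¹) atTop (𝓝 0) := by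
    simpa using tendsto_inv_ofReal_sub 0
  have h2 := h1.mul hf
  rw [zero_mul] at h2
  refine h2.congr' ?_
  filter_upwards [eventually_ne_atTop 0] with x hx
  have : (x : ℂ) ≠ 0 := by exact_mod_cast hx
  rw [← mul_assoc, inv_mul_cancel₀ this, one_mul]

theorem eq_zero_of_const_mem (hf : f ∈ ratHardy) {c : ℂ} (h : ∀ x : ℝ, f (ofReal' x) = c) :
    c = 0 := by
  obtain ⟨ℓ, hℓ⟩ := exists_lead hf
  have h1 := HasLead.tendsto_zero hℓ
  simp only [h] at h1
  exact tendsto_nhds_unique tendsto_const_nhds h1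

theorem shiftFun_mem (hf : f ∈ ratHardy) (hℓ : HasLead f ℓ) : shiftFun f ℓ ∈ ratHardy := by
  obtain ⟨ℓ', h1, h2, _⟩ := exists_generator hf
  rw [hℓ.unique h1]
  exact h2

theorem realize_injective (hf : f ∈ ratHardy) (hg : g ∈ ratHardy) (h : realize f = realize g) :
    f = g := by
  ext z
  rw [← hardyEval_realize hf, h, hardyEval_realize hg]

theorem inner_realize_of_szegoProj (hp : p ∈ ratHardy) (hh : h ∈ ratHardy) (hl : HasLead h ℓ)
    {F : LTwo} (hs : szegoProj (mulL2 (conjFun (realize p)) F) = realize h) :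
    inner ℂ (realize p) F = -(2 * Real.pi * I * ℓ) := by
  apply inner_eq_of_fourierAtZeroPlus (isWiener_realize hp)
  rw [hs]
  exact fourierAtZeroPlus_realize hh hl

/-- `p̄ f = h + k̄` on the real line. -/
def ConjMulDecomp (p f h k : ClosedUHP → ℂ) : Prop :=
  ∀ x : ℝ, starRingEnd ℂ (p (ofReal' x)) * f (ofReal' x) =
    h (ofReal' x) + starRingEnd ℂ (k (ofReal' x))

theorem ConjMulDecomp.szegoProj_eq (hd : ConjMulDecomp p f h k) (hp : p ∈ ratHardy)
    (hf : f ∈ ratHardy) (hh : h ∈ ratHardy) (hk : k ∈ ratHardy) :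
    szegoProj (mulL2 (conjFun (realize p)) (realize f)) = realize h := by
  refine szegoProj_of_ae_eq hh hk ?_
  filter_upwards [coeFn_mulL2_conjFun (isWiener_realize hp) (realize f), realize_ae hp,
    realize_ae hf] with x h1 h2 h3
  rw [h1, h2, h3, hd]

/-- The product `p̄ f` decays like `x⁻²`, so the `1/x` tails of `h` and `k̄` cancel. -/
theorem ConjMulDecomp.lead_add (hd : ConjMulDecomp p f h k) (hp : HasLead p ℓp) (hf : HasLead f ℓ)
    (hh : HasLead h ℓh) (hk : HasLead k ℓk) : ℓh + starRingEnd ℂ ℓk = 0 := by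
  have h1 : Tendsto (fun x : ℝ => x * (starRingEnd ℂ (p (ofReal' x)) * f (ofReal' x))) atTop
      (𝓝 (starRingEnd ℂ 0 * ℓ)) := by
    refine (((continuous_conj.tendsto _).comp hp.tendsto_zero).mul hf).congr fun x => ?_
    simp only [Function.comp]
    ring
  have h2 : Tendsto (fun x : ℝ => x * (h (ofReal' x) + starRingEnd ℂ (k (ofReal' x)))) atTop
      (𝓝 (ℓh + starRingEnd ℂ ℓk)) := by
    refine (Tendsto.add hh ((continuous_conj.tendsto _).comp hk)).congr fun x => ?_
    simp only [Function.comp, map_mul, conj_ofReal]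
    ring
  rw [map_zero, zero_mul] at h1
  exact tendsto_nhds_unique (h2.congr fun x => by rw [hd]) h1

/-- Multiply the decomposition by `x`. The constants cancel because `ℓh + conj ℓk = 0`, and the
extra term `-ℓ p̄` is anti-Hardy, so it joins the conjugate part. -/
theorem ConjMulDecomp.shift (hd : ConjMulDecomp p f h k) (hl : ℓh + starRingEnd ℂ ℓk = 0) :
    ConjMulDecomp p (shiftFun f ℓ) (shiftFun h ℓh)
      (shiftFun k ℓk + (-starRingEnd ℂ ℓ) • p) := by
  intro x
  have := hd x
  simp only [shiftFun, Pi.add_apply, Pi.smul_apply, smul_eq_mul, map_add, map_sub, map_mul,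
    conj_ofReal, coe_ofReal', map_neg, conj_conj]
  linear_combination (x : ℂ) * this + hl

/-- As for `shift`, but the extra term is now a multiple of `f` and joins the Hardy part. This
asymmetry is the source of the boundary term in `inner_shift_sub`. -/
theorem ConjMulDecomp.shift_left (hd : ConjMulDecomp p f h k) (hl : ℓh + starRingEnd ℂ ℓk = 0) :
    ConjMulDecomp (shiftFun p ℓp) f (shiftFun h ℓh + (-starRingEnd ℂ ℓp) • f) (shiftFun k ℓk) := by
  intro x
  have := hd x
  simp only [shiftFun, Pi.add_apply, Pi.smul_apply, smul_eq_mul, map_sub, map_mul,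
    conj_ofReal, coe_ofReal']
  linear_combination (x : ℂ) * this + hl

/-- `⟨f, G g⟩ - ⟨G f, g⟩` is a boundary term at frequency zero. -/
theorem ConjMulDecomp.inner_shift_sub (hd : ConjMulDecomp p f h k) (hp : p ∈ ratHardy)
    (hf : f ∈ ratHardy) (hh : h ∈ ratHardy) (hk : k ∈ ratHardy) (hpl : HasLead p ℓp)
    (hfl : HasLead f ℓ) :
    inner ℂ (realize p) (realize (shiftFun f ℓ)) - inner ℂ (realize (shiftFun p ℓp)) (realize f) =
      -(2 * Real.pi * I * (starRingEnd ℂ ℓp * ℓ)) := by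
  obtain ⟨ℓh, hhl⟩ : ∃ ℓh, HasLead h ℓh := exists_lead hh
  obtain ⟨ℓk, hkl⟩ : ∃ ℓk, HasLead k ℓk := exists_lead hk
  have hl := hd.lead_add hpl hfl hhl hkl
  have hsh := shiftFun_mem hh hhl
  obtain ⟨m, hm⟩ : ∃ m, HasLead (shiftFun h ℓh) m := exists_lead hsh
  rw [inner_realize_of_szegoProj hp hsh hm ((hd.shift (ℓ := ℓ) hl).szegoProj_eq hp
      (shiftFun_mem hf hfl) hsh (ratHardy.add_mem (shiftFun_mem hk hkl) (ratHardy.smul_mem _ hp))),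
    inner_realize_of_szegoProj (shiftFun_mem hp hpl) (ratHardy.add_mem hsh
      (ratHardy.smul_mem _ hf)) (hm.add (hfl.smul _)) ((hd.shift_left (ℓp := ℓp) hl).szegoProj_eq
      (shiftFun_mem hp hpl) hf (ratHardy.add_mem hsh (ratHardy.smul_mem _ hf))
      (shiftFun_mem hk hkl))]
  ring

/-- The commutator of `L_u` and `G` on a rational eigenfunction. -/
theorem ConjMulDecomp.laxOp_shift (hd : ConjMulDecomp p f h k) (hp : p ∈ ratHardy)
    (hf : f ∈ ratHardy) (hh : h ∈ ratHardy) (hk : k ∈ ratHardy) (hfl : HasLead f ℓ) {μ : ℝ}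
    (he : SolvesEigenEq (realize p) μ (realize f)) :
    (μ : ℂ) * ℓ = 0 ∧ laxOp (realize p) (realize (shiftFun f ℓ)) =
      (μ : ℂ) • realize (shiftFun f ℓ) + (-I) • realize f +
        (inner ℂ (realize p) (realize f) * I / (2 * Real.pi)) • realize p := by
  have hpi : (Real.pi : ℂ) ≠ 0 := by exact_mod_cast Real.pi_ne_zero
  obtain ⟨ℓp, hpl⟩ : ∃ ℓp, HasLead p ℓp := exists_lead hp
  obtain ⟨ℓh, hhl⟩ : ∃ ℓh, HasLead h ℓh := exists_lead hh
  obtain ⟨ℓk, hkl⟩ : ∃ ℓk, HasLead k ℓk := exists_lead hk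
  have hl := hd.lead_add hpl hfl hhl hkl
  have hsh := shiftFun_mem hh hhl
  have hsf := shiftFun_mem hf hfl
  have hS := hd.szegoProj_eq hp hf hh hk
  have hin := inner_realize_of_szegoProj hp hh hhl hS
  obtain ⟨f', hf', hder, hopD⟩ := exists_deriv_ratHardy hf
  obtain ⟨f'', hf'', hder', hopD'⟩ := exists_deriv_ratHardy hsf
  have hprod := ratHardy_mul_mem hp hh
  have h1 : (-I) • f' - p * h = (μ : ℂ) • f := by
    apply realize_injective (ratHardy.sub_mem (ratHardy.smul_mem _ hf') hprod)
      (ratHardy.smul_mem _ hf)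
    rw [realize_sub (ratHardy.smul_mem _ hf') hprod, realize_smul _ hf', realize_smul _ hf,
      ← mulL2_realize hp hh, ← hopD, ← hS, ← he.2,
      laxOp_eq (isWiener_realize hp) (memHardy_realize hp) (isWiener_realize hf)]
  have h2 : ∀ x : ℝ, f'' (ofReal' x) = f (ofReal' x) + x * f' (ofReal' x) := by
    intro x
    refine (hder' x).unique ?_
    have := (((hasDerivAt_id x).ofReal_comp.mul (hder x)).sub_const ℓ)
    simpa [shiftFun] using this
  set F := (-I) • f'' - p * shiftFun h ℓh with hF
  have hprod' := ratHardy_mul_mem hp hsh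
  have hFmem : F ∈ ratHardy := ratHardy.sub_mem (ratHardy.smul_mem _ hf'') hprod'
  have hlax : laxOp (realize p) (realize (shiftFun f ℓ)) = realize F := by
    rw [laxOp_eq (isWiener_realize hp) (memHardy_realize hp) (isWiener_realize hsf), hopD',
      (hd.shift (ℓ := ℓ) hl).szegoProj_eq hp hsf hsh (ratHardy.add_mem (shiftFun_mem hk hkl)
        (ratHardy.smul_mem _ hp)), hF, realize_sub (ratHardy.smul_mem _ hf'') hprod',
      realize_smul _ hf'', mulL2_realize hp hsh]
  have h3 : ∀ x : ℝ, F (ofReal' x) = μ * shiftFun f ℓ (ofReal' x) + (-I) * f (ofReal' x) +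
      ℓh * p (ofReal' x) + μ * ℓ := by
    intro x
    have := congrFun h1 (ofReal' x)
    simp only [Pi.sub_apply, Pi.smul_apply, Pi.mul_apply, smul_eq_mul] at this
    simp only [hF, Pi.sub_apply, Pi.smul_apply, Pi.mul_apply, smul_eq_mul, h2, shiftFun,
      coe_ofReal']
    linear_combination (x : ℂ) * this
  have hGmem : (μ : ℂ) • shiftFun f ℓ + (-I) • f + ℓh • p ∈ ratHardy :=
    ratHardy.add_mem (ratHardy.add_mem (ratHardy.smul_mem _ hsf) (ratHardy.smul_mem _ hf))
      (ratHardy.smul_mem _ hp)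
  -- On the real line the two rational functions differ by the constant `μ ℓ`; both vanish at
  -- infinity, so the constant is zero.
  have h4 : (μ : ℂ) * ℓ = 0 := by
    refine eq_zero_of_const_mem (ratHardy.sub_mem hFmem hGmem) fun x => ?_
    simp only [Pi.sub_apply, Pi.add_apply, Pi.smul_apply, smul_eq_mul, h3]
    ring
  refine ⟨h4, ?_⟩
  have h5 : inner ℂ (realize p) (realize f) * I / (2 * Real.pi) = ℓh := by
    rw [hin]
    field_simp
    rw [I_sq]
    ring
  rw [h5, hlax, ← realize_smul _ hsf, ← realize_smul _ hf, ← realize_smul _ hp,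
    ← realize_add (ratHardy.smul_mem _ hsf) (ratHardy.smul_mem _ hf),
    ← realize_add (ratHardy.add_mem (ratHardy.smul_mem _ hsf) (ratHardy.smul_mem _ hf))
      (ratHardy.smul_mem _ hp)]
  refine realize_congr fun x => ?_
  rw [h3, h4]
  simp

open Polynomial in
theorem degree_lt_of_mul_degree_lt {A Q : ℂ[X]} {d : WithBot ℕ}
    (h : (A * Q).degree < d + Q.degree) : A.degree < d := by
  rw [degree_mul] at h
  exact lt_of_add_lt_add_right h

section Poly

open Polynomial

variable {A B P Q : ℂ[X]}

theorem ne_zero_of_roots (hQ : ∀ z : ℂ, Q.IsRoot z → z.im < 0) : Q ≠ 0 := by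
  rintro rfl
  simpa using hQ 0 (by simp)

theorem eval_ne_zero (hQ : ∀ z : ℂ, Q.IsRoot z → z.im < 0) (z : ClosedUHP) :
    Q.eval (z : ℂ) ≠ 0 := fun h => not_lt.2 z.2 (hQ z h)

theorem eval_map_conj (A : ℂ[X]) (x : ℝ) :
    (A.map (starRingEnd ℂ)).eval (x : ℂ) = starRingEnd ℂ (A.eval (x : ℂ)) := by
  rw [← eval_map_apply, conj_ofReal]

theorem isCoprime_map_conj (hQ : ∀ z : ℂ, Q.IsRoot z → z.im < 0) :
    IsCoprime Q (Q.map (starRingEnd ℂ)) := by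
  rw [isCoprime_iff_aeval_ne_zero_of_isAlgClosed ℂ ℂ]
  intro a
  by_contra! h
  have h1 := hQ a h.1
  have h2 : eval a (Q.map (starRingEnd ℂ)) = 0 := h.2
  rw [← conj_conj a, eval_map_apply, map_eq_zero] at h2
  have h3 := hQ _ h2
  simp at h3
  linarith

/-- `Q` and its conjugate have roots in opposite half-planes, hence are coprime. Reducing the Bézout
coefficient modulo `Q` makes `B` small, and comparing degrees then bounds the other numerator. -/
theorem exists_partial_fractions (hQ : ∀ z : ℂ, Q.IsRoot z → z.im < 0)
    (hA : A.degree < Q.degree + Q.degree) : ∃ B C : ℂ[X], B.degree < Q.degree ∧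
      C.degree < Q.degree ∧ A = B * Q.map (starRingEnd ℂ) + C * Q := by
  obtain ⟨a, b, hab⟩ := isCoprime_map_conj hQ
  have hQ0 := ne_zero_of_roots hQ
  have hB := degree_mod_lt (A * b) hQ0
  have hdiv := EuclideanDomain.div_add_mod (A * b) Q
  set B := A * b % Q
  have h1 : A = B * Q.map (starRingEnd ℂ) + (A * a + A * b / Q * Q.map (starRingEnd ℂ)) * Q := by
    linear_combination (-A) * hab - Q.map (starRingEnd ℂ) * hdiv
  refine ⟨B, A * a + A * b / Q * Q.map (starRingEnd ℂ), hB, ?_, h1⟩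
  apply degree_lt_of_mul_degree_lt
  have h2 : (A * a + A * b / Q * Q.map (starRingEnd ℂ)) * Q = A - B * Q.map (starRingEnd ℂ) := by
    linear_combination -h1
  rw [h2]
  refine (degree_sub_le _ _).trans_lt (max_lt hA ?_)
  rw [degree_mul, degree_map]
  exact WithBot.add_lt_add_right (by simpa using hQ0) hB

theorem degree_add_lt (hQ : Q ≠ 0) {a b : WithBot ℕ} (ha : a < Q.degree) (hb : b < Q.degree) :
    a + b < Q.degree + Q.degree :=
  (add_le_add_right hb.le a).trans_lt (WithBot.add_lt_add_right (by simpa using hQ) ha)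

theorem exists_conjMulDecomp (hQ : ∀ z : ℂ, Q.IsRoot z → z.im < 0) (hA : A.degree < Q.degree)
    (hB : B.degree < Q.degree) : ∃ H K : ℂ[X], H.degree < Q.degree ∧ K.degree < Q.degree ∧
      A.map (starRingEnd ℂ) * B = H * Q.map (starRingEnd ℂ) + K.map (starRingEnd ℂ) * Q ∧
      ConjMulDecomp (ratFun A Q) (ratFun B Q) (ratFun H Q) (ratFun K Q) := by
  have hQ0 := ne_zero_of_roots hQ
  have h1 : (A.map (starRingEnd ℂ) * B).degree < Q.degree + Q.degree := by
    rw [degree_mul, degree_map]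
    exact degree_add_lt hQ0 hA hB
  obtain ⟨H, C, hH, hC, h2⟩ := exists_partial_fractions hQ h1
  have hCC : (C.map (starRingEnd ℂ)).map (starRingEnd ℂ) = C := by
    ext n
    simp
  refine ⟨H, C.map (starRingEnd ℂ), hH, by rwa [degree_map], by rw [hCC, h2], fun x => ?_⟩
  have hx : Q.eval (x : ℂ) ≠ 0 := eval_ne_zero hQ (ofReal' x)
  have hx' : starRingEnd ℂ (Q.eval (x : ℂ)) ≠ 0 := by simpa using hx
  have h3 := congrArg (eval (x : ℂ)) h2
  simp only [eval_mul, eval_add, eval_map_conj] at h3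
  simp only [ratFun, coe_ofReal', map_div₀, eval_map_conj, conj_conj]
  field_simp
  linear_combination h3

/-- The space of rational functions `A / Q` with `deg A < deg Q`. -/
def ratSpace (Q : ℂ[X]) (hQ : ∀ z : ℂ, Q.IsRoot z → z.im < 0) :
    degreeLT ℂ Q.natDegree →ₗ[ℂ] LTwo where
  toFun A := realize (ratFun A Q)
  map_add' A B := by
    have hA := mem_degreeLT.1 A.2
    have hB := mem_degreeLT.1 B.2
    rw [← degree_eq_natDegree (ne_zero_of_roots hQ)] at hA hB
    rw [← realize_add (ratFun_mem hQ hA) (ratFun_mem hQ hB)]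
    congr 1
    ext z
    simp [ratFun, add_div]
  map_smul' c A := by
    have hA := mem_degreeLT.1 A.2
    rw [← degree_eq_natDegree (ne_zero_of_roots hQ)] at hA
    rw [RingHom.id_apply, ← realize_smul _ (ratFun_mem hQ hA)]
    congr 1
    ext z
    simp [ratFun, mul_div_assoc]

theorem mem_range_ratSpace {hQ : ∀ z : ℂ, Q.IsRoot z → z.im < 0} {F : LTwo} :
    F ∈ LinearMap.range (ratSpace Q hQ) ↔
      ∃ A : ℂ[X], A.degree < Q.degree ∧ realize (ratFun A Q) = F := by
  constructor
  · rintro ⟨A, rfl⟩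
    refine ⟨A, ?_, rfl⟩
    rw [degree_eq_natDegree (ne_zero_of_roots hQ)]
    exact mem_degreeLT.1 A.2
  · rintro ⟨A, hA, rfl⟩
    rw [degree_eq_natDegree (ne_zero_of_roots hQ)] at hA
    exact ⟨⟨A, mem_degreeLT.2 hA⟩, rfl⟩

instance finiteDimensional_degreeLT (n : ℕ) : FiniteDimensional ℂ (degreeLT ℂ n) :=
  (degreeLTEquiv ℂ n).symm.finiteDimensional

theorem finrank_range_ratSpace_le (hQ : ∀ z : ℂ, Q.IsRoot z → z.im < 0) :
    Module.finrank ℂ (LinearMap.range (ratSpace Q hQ)) ≤ Q.natDegree := by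
  refine (LinearMap.finrank_range_le _).trans ?_
  rw [(degreeLTEquiv ℂ Q.natDegree).finrank_eq, Module.finrank_fin_fun]

theorem ratFun_lead (hQ : ∀ z : ℂ, Q.IsRoot z → z.im < 0) (hA : A.degree < Q.degree) :
    HasLead (ratFun A Q) ((X * A).coeff Q.natDegree / Q.leadingCoeff) ∧
      ∃ B : ℂ[X], B.degree < Q.degree ∧
        shiftFun (ratFun A Q) ((X * A).coeff Q.natDegree / Q.leadingCoeff) = ratFun B Q := by
  have hQ0 := ne_zero_of_roots hQ
  have hlc : Q.leadingCoeff ≠ 0 := leadingCoeff_ne_zero.2 hQ0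
  -- Multiplying by `X` reads the coefficient of `A` in degree `deg Q - 1` without a truncated
  -- subtraction; subtracting `c Q` removes the top term of `X A`.
  set c := (X * A).coeff Q.natDegree / Q.leadingCoeff with hc
  have hB : (X * A - C c * Q).degree < Q.degree := by
    rw [degree_eq_natDegree hQ0] at hA ⊢
    rw [degree_lt_iff_coeff_zero] at hA ⊢
    intro m hm
    rcases hm.eq_or_lt with rfl | hm
    · rw [coeff_sub, coeff_C_mul, coeff_natDegree, hc, div_mul_cancel₀ _ hlc, sub_self]
    · obtain ⟨m, rfl⟩ := Nat.exists_eq_succ_of_ne_zero (by omega : m ≠ 0)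
      rw [coeff_sub, coeff_C_mul, coeff_X_mul, hA m (by omega), coeff_eq_zero_of_natDegree_lt hm]
      simp
  have h1 : shiftFun (ratFun A Q) c = ratFun (X * A - C c * Q) Q := by
    ext z
    have := eval_ne_zero hQ z
    simp only [shiftFun, ratFun, eval_sub, eval_mul, eval_X, eval_C]
    field_simp
  refine ⟨?_, _, hB, h1⟩
  obtain ⟨ℓ, hℓ⟩ : ∃ ℓ, HasLead (ratFun A Q) ℓ := exists_lead (ratFun_mem hQ hA)
  have h2 := ratHardy.sub_mem (shiftFun_mem (ratFun_mem hQ hA) hℓ) (ratFun_mem hQ hB)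
  rw [← h1] at h2
  have h3 := eq_zero_of_const_mem (c := c - ℓ) h2 fun x => by
    simp only [Pi.sub_apply, shiftFun]
    ring
  rw [sub_eq_zero.1 h3]
  exact hℓ

/-- For a multi-soliton potential `P / Q` the space `{A / Q}` is invariant under the Lax operator. -/
theorem laxOp_mem_ratSpace (hQ : ∀ z : ℂ, Q.IsRoot z → z.im < 0) (hP : P.degree < Q.degree)
    (hPQ : P * P.map (starRingEnd ℂ) = Polynomial.C I *
      (Q.derivative * Q.map (starRingEnd ℂ) - (Q.map (starRingEnd ℂ)).derivative * Q))
    {F : LTwo} (hF : F ∈ LinearMap.range (ratSpace Q hQ)) :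
    laxOp (realize (ratFun P Q)) F ∈ LinearMap.range (ratSpace Q hQ) := by
  rw [mem_range_ratSpace] at hF
  obtain ⟨A, hA, rfl⟩ := hF
  have hQ0 := ne_zero_of_roots hQ
  obtain ⟨H, K, hH, hK, hpf, hd⟩ := exists_conjMulDecomp hQ hP hA
  have hp := ratFun_mem hQ hP
  have hf := ratFun_mem hQ hA
  have hh := ratFun_mem hQ hH
  -- The numerator of `L_u (A / Q)` over `Q²` is `i A Q' - P H` modulo `Q`. Modulo `Q` one has `P̄ A
  -- = H Q̄` and `P P̄ = i Q' Q̄`, so `Q̄ (P H - i A Q') = 0`; as `Q̄` is prime to `Q`, one factor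
  -- `Q` cancels.
  have hdvd : Q ∣ P * H - Polynomial.C I * A * Q.derivative := by
    refine (isCoprime_map_conj hQ).dvd_of_dvd_mul_right
      (y := P * H - Polynomial.C I * A * Q.derivative) ?_
    refine ⟨-(P * K.map (starRingEnd ℂ)) - Polynomial.C I * A * (Q.map (starRingEnd ℂ)).derivative, ?_⟩
    linear_combination (-P) * hpf + A * hPQ
  obtain ⟨E, hE⟩ := hdvd
  set E' := -(Polynomial.C I * A.derivative) - E with hE'
  have hE2 : E' * Q = -(Polynomial.C I * (A.derivative * Q - A * Q.derivative)) - P * H := by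
    rw [hE']
    linear_combination hE
  have hdegE : E'.degree < Q.degree := by
    apply degree_lt_of_mul_degree_lt
    rw [hE2]
    refine (degree_sub_le _ _).trans_lt (max_lt ?_ ?_)
    · rw [degree_neg, degree_C_mul I_ne_zero]
      refine (degree_sub_le _ _).trans_lt (max_lt ?_ ?_)
      · rw [degree_mul]
        exact WithBot.add_lt_add_right (by simpa using hQ0)
          ((degree_derivative_le).trans_lt hA)
      · rw [degree_mul]
        exact degree_add_lt hQ0 hA (degree_derivative_lt hQ0)
    · rw [degree_mul]
      exact degree_add_lt hQ0 hP hH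
  have hE'mem := ratFun_mem hQ hdegE
  rw [mem_range_ratSpace]
  refine ⟨E', hdegE, ?_⟩
  obtain ⟨f', hf', hder, hopD⟩ := exists_deriv_ratHardy hf
  rw [laxOp_eq (isWiener_realize hp) (memHardy_realize hp) (isWiener_realize hf), hopD,
    hd.szegoProj_eq hp hf hh (ratFun_mem hQ hK), mulL2_realize hp hh, ← realize_smul _ hf',
    ← realize_sub (ratHardy.smul_mem _ hf') (ratHardy_mul_mem hp hh)]
  refine realize_congr fun x => ?_
  have hx : Q.eval (x : ℂ) ≠ 0 := eval_ne_zero hQ (ofReal' x)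
  have h1 : f' (ofReal' x) = (A.derivative.eval (x : ℂ) * Q.eval (x : ℂ) -
      A.eval (x : ℂ) * Q.derivative.eval (x : ℂ)) / Q.eval (x : ℂ) ^ 2 :=
    (hder x).unique (((A.hasDerivAt (x : ℂ)).div (Q.hasDerivAt (x : ℂ)) hx).comp_ofReal)
  have h2 := congrArg (eval (x : ℂ)) hE2
  simp only [eval_mul, eval_sub, eval_neg, eval_C] at h2
  simp only [Pi.sub_apply, Pi.smul_apply, Pi.mul_apply, smul_eq_mul, h1, ratFun, coe_ofReal']
  field_simp
  linear_combination h2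

end Poly

end

/-! ### Multi-soliton potentials are given by the inverse spectral formula -/

section

open Polynomial

variable {P Q : ℂ[X]}

/-- Eigenfunctions of the Lax operator of a multi-soliton potential `P / Q` are of the form
`A / Q`. -/
theorem SolvesEigenEq.mem_ratSpace (hQ : ∀ z : ℂ, Q.IsRoot z → z.im < 0)
    (hP : P.degree < Q.degree)
    (hPQ : P * P.map (starRingEnd ℂ) = Polynomial.C I *
      (Q.derivative * Q.map (starRingEnd ℂ) - (Q.map (starRingEnd ℂ)).derivative * Q))
    {ψ : LTwo} {μ : ℝ} (h : SolvesEigenEq (realize (ratFun P Q)) μ ψ) :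
    ψ ∈ LinearMap.range (ratSpace Q hQ) := by
  set V := LinearMap.range (ratSpace Q hQ) with hV
  have hp := ratFun_mem hQ hP
  have hu := isWiener_realize hp
  have hu' := memHardy_realize hp
  have hsob : ∀ F ∈ V, MemHardySobolev 1 F := by
    intro F hF
    obtain ⟨A, hA, rfl⟩ := mem_range_ratSpace.1 hF
    exact memHardySobolev_one_realize (ratFun_mem hQ hA)
  obtain ⟨y, hy, z, hz, rfl⟩ := V.exists_add_mem_mem_orthogonal ψ
  have hz1 : MemHardySobolev 1 z := by
    have := h.1.sub (hsob y hy)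
    rwa [add_sub_cancel_left] at this
  have h1 : laxOp (realize (ratFun P Q)) z - (μ : ℂ) • z =
      (μ : ℂ) • y - laxOp (realize (ratFun P Q)) y := by
    have := h.2
    rw [laxOp_add hu (hsob y hy) hz1, smul_add] at this
    rw [sub_eq_sub_iff_add_eq_add, add_comm, this]
  have h2 : (μ : ℂ) • y - laxOp (realize (ratFun P Q)) y ∈ V :=
    V.sub_mem (V.smul_mem _ hy) (laxOp_mem_ratSpace hQ hP hPQ hy)
  have h3 : laxOp (realize (ratFun P Q)) z - (μ : ℂ) • z ∈ Vᗮ := by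
    refine Vᗮ.sub_mem ?_ (Vᗮ.smul_mem _ hz)
    rw [Submodule.mem_orthogonal]
    intro F hF
    rw [← inner_laxOp hu hu' (hsob F hF) hz1]
    exact (Submodule.mem_orthogonal _ _).1 hz _ (laxOp_mem_ratSpace hQ hP hPQ hF)
  -- The vector lies in `V` by `h1` and in `Vᗮ` by symmetry of `L_u`, hence is zero.
  have h4 : laxOp (realize (ratFun P Q)) z - (μ : ℂ) • z = 0 := by
    have h5 := (Submodule.mem_orthogonal _ _).1 h3 _ (h1 ▸ h2)
    exact inner_self_eq_zero.1 h5
  have h5 : SolvesEigenEq (realize (ratFun P Q)) μ z := ⟨hz1, sub_eq_zero.1 h4⟩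
  -- The potential `P / Q` belongs to `V`, so `z` is orthogonal to it.
  have h6 := h5.eq_zero hu hu' ((Submodule.mem_orthogonal _ _).1 hz _
    (mem_range_ratSpace.2 ⟨P, hP, rfl⟩))
  rw [h6, add_zero]
  exact hy

theorem eq_sum_inner_of_orthonormal {n : ℕ} {V : Submodule ℂ LTwo} [FiniteDimensional ℂ V]
    (hV : Module.finrank ℂ V ≤ n) {ψ : Fin n → LTwo} (hψ : ∀ j, ψ j ∈ V)
    (ho : ∀ j k, inner ℂ (ψ j) (ψ k) = if j = k then (1 : ℂ) else 0) {v : LTwo} (hv : v ∈ V) :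
    v = ∑ j, inner ℂ (ψ j) v • ψ j := by
  have hon : Orthonormal ℂ ψ := orthonormal_iff_ite.2 ho
  have hspan : Submodule.span ℂ (Set.range ψ) = V := by
    refine Submodule.eq_of_le_of_finrank_le (Submodule.span_le.2 ?_) ?_
    · rintro _ ⟨j, rfl⟩
      exact hψ j
    · rw [finrank_span_eq_card hon.linearIndependent, Fintype.card_fin]
      exact hV
  set w := v - ∑ j, inner ℂ (ψ j) v • ψ j with hw
  have hwV : w ∈ Submodule.span ℂ (Set.range ψ) := by
    rw [hspan]
    exact V.sub_mem hv (V.sum_mem fun j _ => V.smul_mem _ (hψ j))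
  have h1 : ∀ j, inner ℂ (ψ j) w = 0 := by
    intro j
    simp [hw, inner_sub_right, inner_sum, inner_smul_right, ho]
  have h2 : ∀ x ∈ Submodule.span ℂ (Set.range ψ), inner ℂ x w = 0 := by
    intro x hx
    induction hx using Submodule.span_induction with
    | mem x hx =>
      obtain ⟨j, rfl⟩ := hx
      exact h1 j
    | zero => exact inner_zero_left _
    | add x y _ _ hx hy => rw [inner_add_left, hx, hy, add_zero]
    | smul c x _ hx => rw [inner_smul_left, hx, mul_zero]
  exact sub_eq_zero.1 (inner_self_eq_zero.1 (h2 w hwV))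

theorem exists_normalizedEigenbasis_of_isLaxEigenvalue {n : ℕ} {u : LTwo} {lam : Fin n → ℝ}
    (hu : IsWiener u) (hu' : MemHardy u) (h : ∀ j, IsLaxEigenvalue u (lam j)) :
    ∃ ψ, IsNormalizedEigenbasis u lam ψ := by
  choose χ h0 h1 using h
  choose α h2 using fun j => (h1 j).exists_normalized hu hu' (h0 j)
  exact ⟨_, h2⟩

/-- A multi-soliton potential is given by the inverse spectral formula. -/
theorem IsMultiSolitonPotential.exists_eq_realize {N : ℕ} [NeZero N] {lam : Fin N → ℝ}
    (hinj : Function.Injective lam) (h0 : lam 0 = 0) {u : LTwo}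
    (hu : IsMultiSolitonPotential N u) (hev : ∀ j, IsLaxEigenvalue u (lam j)) :
    ∃ (γ : Fin N → ℝ) (ρ : ℝ) (c : ℂ), Admissible lam ρ ∧ c * starRingEnd ℂ c = 2 * ρ ∧
      u = realize (solitonFun lam γ ρ c) := by
  obtain ⟨P, Q, hQN, hPN, hQ, hPQ, hae⟩ := hu
  have hP : P.degree < Q.degree := by rwa [hQN]
  have hp := ratFun_mem hQ hP
  obtain rfl : u = realize (ratFun P Q) := eq_realize hp hae
  have hW := isWiener_realize hp
  have hH := memHardy_realize hp
  have hnat : Q.natDegree = N := natDegree_eq_of_degree_eq_some hQN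
  obtain ⟨ψ, hψ⟩ := exists_normalizedEigenbasis_of_isLaxEigenvalue hW hH hev
  have ho := hψ.inner_eq hinj hW hH
  have hψV : ∀ j, ψ j ∈ LinearMap.range (ratSpace Q hQ) :=
    fun j => (hψ j).1.mem_ratSpace hQ hP hPQ
  have hexp : ∀ v ∈ LinearMap.range (ratSpace Q hQ), v = ∑ j, inner ℂ (ψ j) v • ψ j :=
    fun v hv => eq_sum_inner_of_orthonormal ((finrank_range_ratSpace_le hQ).trans hnat.le) hψV ho hv
  choose A hA hAψ using fun j => mem_range_ratSpace.1 (hψV j)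
  have hf : ∀ j, ratFun (A j) Q ∈ ratHardy := fun j => ratFun_mem hQ (hA j)
  choose ℓ hℓ B hB hsh using fun j => show ∃ ℓ, HasLead (ratFun (A j) Q) ℓ ∧ ∃ B : ℂ[X],
    B.degree < Q.degree ∧ shiftFun (ratFun (A j) Q) ℓ = ratFun B Q from ⟨_, ratFun_lead hQ (hA j)⟩
  set g : Fin N → LTwo := fun k => realize (shiftFun (ratFun (A k) Q) (ℓ k)) with hg
  have hgV : ∀ k, g k ∈ LinearMap.range (ratSpace Q hQ) := fun k =>
    mem_range_ratSpace.2 ⟨B k, hB k, by rw [hg]; simp only [hsh]⟩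
  have hsob : ∀ k, MemHardySobolev 1 (g k) := fun k =>
    memHardySobolev_one_realize (shiftFun_mem (hf k) (hℓ k))
  set σ : ℂ := ((√(2 * Real.pi) : ℝ) : ℂ) with hσ
  have hσ2 : σ * σ = 2 * Real.pi := by
    rw [hσ, ← ofReal_mul, Real.mul_self_sqrt (by positivity)]
    push_cast
    ring
  have hpi : (Real.pi : ℂ) ≠ 0 := by exact_mod_cast Real.pi_ne_zero
  have hψu : ∀ j, inner ℂ (ψ j) (realize (ratFun P Q)) = σ := fun j => (hψ j).2.2
  have huψ : ∀ j, inner ℂ (realize (ratFun P Q)) (ψ j) = σ := fun j => by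
    rw [← inner_conj_symm, hψu, hσ, conj_ofReal]
  have hcomm : ∀ k, (lam k : ℂ) * ℓ k = 0 ∧ laxOp (realize (ratFun P Q)) (g k) =
      (lam k : ℂ) • g k + (-I) • ψ k + (σ * I / (2 * Real.pi)) • realize (ratFun P Q) := by
    intro k
    obtain ⟨H, K, hH', hK', _, hd⟩ := exists_conjMulDecomp hQ hP (hA k)
    have := hd.laxOp_shift hp (hf k) (ratFun_mem hQ hH') (ratFun_mem hQ hK') (hℓ k) (μ := lam k)
      (by rw [hAψ]; exact (hψ k).1)
    rw [hAψ, huψ] at this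
    exact this
  set M : Fin N → Fin N → ℂ := fun j k => inner ℂ (ψ j) (g k) with hM
  -- Pair the commutator relation with `ψ j` and move `L_u` to the left. The normalisation `σ² = 2π`
  -- turns the source term into exactly `i`.
  have hoff : ∀ j k, ((lam j : ℂ) - lam k) * M j k = I * (1 - if j = k then 1 else 0) := by
    intro j k
    have h1 := congrArg (fun F => inner ℂ (ψ j) F) (hcomm k).2
    simp only [inner_add_right, inner_smul_right, ho, hψu] at h1
    rw [← inner_laxOp hW hH (hψ j).1.1 (hsob k), (hψ j).1.2, inner_smul_left, conj_ofReal] at h1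
    have h2 : σ * I / (2 * Real.pi) * σ = I := by
      have : σ * I / (2 * Real.pi) * σ = σ * σ * I / (2 * Real.pi) := by ring
      rw [this, hσ2]
      field_simp
    rw [h2] at h1
    linear_combination h1
  have hdiag : ∀ k, M k k - starRingEnd ℂ (M k k) =
      -(2 * Real.pi * I * (starRingEnd ℂ (ℓ k) * ℓ k)) := by
    intro k
    obtain ⟨H, K, hH', hK', _, hd⟩ := exists_conjMulDecomp hQ (hA k) (hA k)
    have := hd.inner_shift_sub (hf k) (hf k) (ratFun_mem hQ hH') (ratFun_mem hQ hK') (hℓ k) (hℓ k)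
    rw [hAψ, ← inner_conj_symm (g k) (ψ k)] at this
    exact this
  have hℓ0 : ∀ k, k ≠ 0 → ℓ k = 0 := by
    intro k hk
    refine (mul_eq_zero.1 (hcomm k).1).resolve_left fun h => hk (hinj ?_)
    rw [h0]
    exact_mod_cast h
  have hexpf : ∀ {D : ℂ[X]}, D.degree < Q.degree →
      ratFun D Q = ∑ j, inner ℂ (ψ j) (realize (ratFun D Q)) • ratFun (A j) Q := by
    intro D hD
    apply realize_injective (ratFun_mem hQ hD)
      (Submodule.sum_mem _ fun j _ => ratHardy.smul_mem _ (hf j))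
    rw [realize_sum _ hf]
    simp only [hAψ]
    exact hexp _ (mem_range_ratSpace.2 ⟨D, hD, rfl⟩)
  have hlead : ∀ c : Fin N → ℂ, HasLead (∑ j, c j • ratFun (A j) Q) (c 0 * ℓ 0) := by
    intro c
    have h1 : Tendsto (fun x : ℝ => ∑ j, x * (c j • ratFun (A j) Q) (ofReal' x)) atTop
        (𝓝 (∑ j, c j * ℓ j)) := tendsto_finsetSum _ fun j _ => (hℓ j).smul (c j)
    have h2 : ∑ j, c j * ℓ j = c 0 * ℓ 0 := by
      rw [Finset.sum_eq_single 0]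
      · intro j _ hj
        rw [hℓ0 j hj, mul_zero]
      · simp
    rw [h2] at h1
    refine h1.congr fun x => ?_
    rw [Finset.sum_apply, Finset.mul_sum]
  -- `X^{N-1} / Q` lies in `V` and has a nonzero `1/x` tail. If `ℓ 0` vanished, no element of `V`
  -- would have one.
  have hℓne : ℓ 0 ≠ 0 := by
    intro hz
    obtain ⟨n, rfl⟩ := Nat.exists_eq_succ_of_ne_zero (NeZero.ne N)
    have hD : ((X : ℂ[X]) ^ n).degree < Q.degree := by
      rw [hQN, degree_X_pow]
      exact_mod_cast Nat.lt_succ_self n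
    have h1 := (ratFun_lead hQ hD).1
    rw [hexpf hD] at h1
    have h2 := h1.unique (hlead _)
    rw [hz, mul_zero, ← pow_succ', hnat, coeff_X_pow_self] at h2
    exact one_div_ne_zero (leadingCoeff_ne_zero.2 (ne_zero_of_roots hQ)) h2
  set ρ : ℝ := Real.pi * ‖ℓ 0‖ ^ 2 with hρ
  have hρpos : 0 < ρ := by
    have := norm_pos_iff.2 hℓne
    positivity
  have hnorm : starRingEnd ℂ (ℓ 0) * ℓ 0 = ((‖ℓ 0‖ ^ 2 : ℝ) : ℂ) := by
    rw [mul_comm, mul_conj, normSq_eq_norm_sq]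
  have hMeq : ∀ j k, M j k = spectralMatrix lam (fun j => (M j j).re) ρ j k := by
    intro j k
    by_cases hjk : j = k
    · subst hjk
      have h1 := congrArg Complex.im (hdiag j)
      simp only [spectralMatrix, Matrix.of_apply, if_true]
      by_cases hj : j = 0
      · subst hj
        rw [hnorm] at h1
        apply Complex.ext
        · simp
        · simp [-ofReal_pow] at h1 ⊢
          rw [hρ]
          linarith
      · rw [hℓ0 j hj] at h1
        apply Complex.ext
        · simp [hj]
        · simp [hj] at h1 ⊢
          linarith
    · have h1 := hoff j k
      have h2 : ((lam j : ℂ) - lam k) ≠ 0 := by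
        rw [sub_ne_zero]
        exact fun h => hjk (hinj (by exact_mod_cast h))
      simp only [spectralMatrix, Matrix.of_apply, if_neg hjk, sub_zero, mul_one] at h1 ⊢
      rw [eq_div_iff h2, mul_comm, h1]
  have hadm : Admissible lam ρ := ⟨hinj, h0, hρpos⟩
  set γ : Fin N → ℝ := fun j => (M j j).re with hγ
  -- Evaluating `G ψ_k = Σ_j M_jk ψ_j` at `z` gives the row equation `ψ(z) (M - z) = -ℓ`, where only
  -- `ℓ 0` is nonzero.
  have hshift : ∀ (k : Fin N) (z : ClosedUHP), ∑ j, ratFun (A j) Q z * shiftMatrix lam γ ρ z j k =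
      -ℓ k := by
    intro k z
    have h1 : shiftFun (ratFun (A k) Q) (ℓ k) z =
        ∑ j, spectralMatrix lam γ ρ j k * ratFun (A j) Q z := by
      have h2 := congrFun (hexpf (hB k)) z
      rw [← hsh k, Finset.sum_apply] at h2
      rw [h2]
      exact Finset.sum_congr rfl fun j _ => by rw [← hMeq]; rfl
    simp only [shiftFun] at h1
    change ∑ j, ratFun (A j) Q z * (spectralMatrix lam γ ρ j k -
      z * (1 : Matrix (Fin N) (Fin N) ℂ) j k) = -ℓ k
    simp only [mul_sub, Finset.sum_sub_distrib, Matrix.one_apply, mul_ite, mul_one, mul_zero, Finset.sum_ite_eq',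
      Finset.mem_univ, if_true]
    rw [Finset.sum_congr rfl fun j _ => mul_comm (ratFun (A j) Q z) (spectralMatrix lam γ ρ j k),
      ← h1]
    ring
  have hrow : ∀ k, ratFun (A k) Q = (-ℓ 0) • resolvFun lam γ ρ 0 k := by
    intro k
    ext z
    have h1 := hadm.mul_resolv (γ := γ) z.2
    have h2 : Matrix.vecMul (fun j => ratFun (A j) Q z) (shiftMatrix lam γ ρ z) =
        fun k => -ℓ k := funext fun k => hshift k z
    have h3 := congrArg (fun v => Matrix.vecMul v (resolv lam γ ρ z)) h2
    simp only [Matrix.vecMul_vecMul, h1, Matrix.vecMul_one] at h3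
    have h4 := congrFun h3 k
    rw [h4, Matrix.vecMul, dotProduct, Finset.sum_eq_single 0]
    · simp [resolvFun]
    · intro j _ hj
      rw [hℓ0 j hj]
      simp
    · simp
  -- Since `u = σ Σ ψ_j` and `ψ_j = -ℓ_0 R_0j`, the constant is `c = -σ ℓ_0`, and `|c|² = 2π |ℓ_0|²
  -- = 2ρ`.
  refine ⟨γ, ρ, -(σ * ℓ 0), hadm, ?_, ?_⟩
  · rw [map_neg, map_mul, neg_mul_neg, hσ, conj_ofReal, ← hσ]
    have : σ * ℓ 0 * (σ * starRingEnd ℂ (ℓ 0)) = σ * σ * (starRingEnd ℂ (ℓ 0) * ℓ 0) := by ring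
    rw [this, hσ2, hnorm, hρ]
    push_cast
    ring
  · congr 1
    rw [hexpf hP]
    ext z
    simp only [hψu, hrow, solitonFun, Finset.sum_apply, Pi.smul_apply, smul_eq_mul, Finset.mul_sum]
    refine Finset.sum_congr rfl fun j _ => ?_
    ring

end

/-! ### Estimates for the nonlinearity -/

section

/-- The norm of the Fourier transform in `L¹`. -/
def wienerNorm (f : LTwo) : ℝ := ∫ η, ‖(𝓕 f : LTwo) η‖

theorem wienerNorm_nonneg (f : LTwo) : 0 ≤ wienerNorm f := integral_nonneg fun _ => norm_nonneg _

theorem norm_mulL2_le {f : LTwo} (hf : IsWiener f) (g : LTwo) :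
    ‖mulL2 f g‖ ≤ wienerNorm f * ‖g‖ := by
  refine Lp.norm_le_mul_norm_of_ae_le_mul ?_
  filter_upwards [coeFn_mulL2_wiener hf g, hf.norm_le] with x h1 h2
  rw [h1, norm_mul]
  exact mul_le_mul_of_nonneg_right h2 (norm_nonneg _)

theorem norm_conv_le (a b : ℝ → ℂ) (η : ℝ) : ‖conv a b η‖ ≤ ∫ s, ‖a s‖ * ‖b (η - s)‖ := by
  refine (norm_integral_le_integral_norm _).trans_eq ?_
  simp only [norm_mul]

theorem integral_norm_conv_le {a b : ℝ → ℂ} (ha : Integrable a) (hb : Integrable b) :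
    ∫ η, ‖conv a b η‖ ≤ (∫ η, ‖a η‖) * ∫ η, ‖b η‖ := by
  have h1 : Integrable (convolution (fun η => ‖a η‖) (fun η => ‖b η‖)
      (ContinuousLinearMap.mul ℝ ℝ) volume) := ha.norm.integrable_convolution _ hb.norm
  have h2 : ∫ η, convolution (fun η => ‖a η‖) (fun η => ‖b η‖)
      (ContinuousLinearMap.mul ℝ ℝ) volume η = (∫ η, ‖a η‖) * ∫ η, ‖b η‖ := by
    rw [integral_convolution _ ha.norm hb.norm]
    rfl
  rw [← h2]
  exact integral_mono (integrable_conv ha hb).norm h1 fun η => norm_conv_le a b η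

theorem wienerNorm_mulL2_le {f g : LTwo} (hf : IsWiener f) (hg : IsWiener g) :
    wienerNorm (mulL2 f g) ≤ wienerNorm f * wienerNorm g := by
  refine le_trans (le_of_eq ?_) (integral_norm_conv_le hf hg)
  refine integral_congr_ae ?_
  filter_upwards [fourier_mulL2 hf hg] with η h
  rw [h]

theorem wienerNorm_star {f : LTwo} (hf : IsWiener f) : wienerNorm (star f) = wienerNorm f := by
  rw [wienerNorm, wienerNorm, ← integral_neg_eq_self fun η => ‖(𝓕 f : LTwo) η‖]
  refine integral_congr_ae ?_
  filter_upwards [fourier_star hf] with η h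
  rw [h]
  simp

theorem norm_star_lTwo (f : LTwo) : ‖star f‖ = ‖f‖ := by
  have h : ∀ᵐ x, ‖(star f : LTwo) x‖ = ‖f x‖ := by
    filter_upwards [star_ae_eq f] with x h
    rw [h, RCLike.norm_conj]
  exact le_antisymm (Lp.norm_le_norm_of_ae_le (h.mono fun _ h => h.le))
    (Lp.norm_le_norm_of_ae_le (h.mono fun _ h => h.ge))

/-- A function whose Fourier transform is the absolute value of the one of `f`. -/
theorem exists_absFourier (f : LTwo) : ∃ F : LTwo,
    (𝓕 F : LTwo) =ᵐ[volume] (fun η => ((‖(𝓕 f : LTwo) η‖ : ℝ) : ℂ)) ∧ ‖F‖ = ‖f‖ := by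
  have h : MemLp (fun η => ((‖(𝓕 f : LTwo) η‖ : ℝ) : ℂ)) 2 := (Lp.memLp (𝓕 f : LTwo)).norm.ofReal
  have h1 : (𝓕 (𝓕⁻ (h.toLp _) : LTwo) : LTwo) = h.toLp _ := FourierTransform.fourier_fourierInv_eq _
  refine ⟨𝓕⁻ (h.toLp _), ?_, ?_⟩
  · rw [h1]
    exact h.coeFn_toLp
  · rw [← Lp.norm_fourier_eq, h1, ← Lp.norm_fourier_eq f]
    have h2 : ∀ᵐ η, ‖(h.toLp _ : LTwo) η‖ = ‖(𝓕 f : LTwo) η‖ := by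
      filter_upwards [h.coeFn_toLp] with η h3
      rw [h3, norm_real, norm_norm]
    exact le_antisymm (Lp.norm_le_norm_of_ae_le (h2.mono fun _ h => h.le))
      (Lp.norm_le_norm_of_ae_le (h2.mono fun _ h => h.ge))

theorem integrable_norm_mul_norm_sub {a b : ℝ → ℂ} (ha : MemLp a 2) (hb : MemLp b 2) (η : ℝ) :
    Integrable fun s => ‖a s‖ * ‖b (η - s)‖ :=
  MemLp.integrable_mul (p := 2) (q := 2) ha.norm
    (hb.comp_measurePreserving (Measure.measurePreserving_sub_left volume η)).norm

/-- The low-frequency output of `b̄ a` is controlled by the frequencies of `a`. -/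
theorem norm_mul_conv_le {a b : ℝ → ℂ} (ha : MemLp (fun s : ℝ => (s : ℂ) * a s) 2) (hb : MemLp b 2)
    (hb0 : ∀ y, 0 < y → b y = 0) (η : ℝ) :
    ‖((η + |η| : ℝ) : ℂ) * conv a b η‖ ≤ 2 * ∫ s : ℝ, ‖(s : ℂ) * a s‖ * ‖b (η - s)‖ := by
  rw [norm_mul, ← integral_const_mul]
  refine (mul_le_mul_of_nonneg_left (norm_conv_le a b η) (norm_nonneg _)).trans ?_
  rw [← integral_const_mul]
  refine integral_mono_of_nonneg (ae_of_all _ fun s => by positivity)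
    ((integrable_norm_mul_norm_sub ha hb η).const_mul 2) (ae_of_all _ fun s => ?_)
  -- Where `b (η - s)` can be nonzero one has `η ≤ s`. The weight is `2η` for `η > 0` and zero
  -- otherwise, hence at most `2|s|`.
  rcases lt_or_ge 0 (η - s) with h | h
  · simp [hb0 _ h]
  · have h1 : ‖((η + |η| : ℝ) : ℂ)‖ ≤ 2 * |s| := by
      rw [norm_real, Real.norm_eq_abs]
      rcases le_or_gt η 0 with h2 | h2
      · rw [abs_of_nonpos h2, add_neg_cancel, abs_zero]
        positivity
      · rw [abs_of_pos h2, abs_of_pos (by linarith), abs_of_pos (by linarith)]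
        linarith
    calc ‖((η + |η| : ℝ) : ℂ)‖ * (‖a s‖ * ‖b (η - s)‖) ≤ 2 * |s| * (‖a s‖ * ‖b (η - s)‖) := by
          gcongr
      _ = 2 * (‖(s : ℂ) * a s‖ * ‖b (η - s)‖) := by
          rw [norm_mul, norm_real, Real.norm_eq_abs]
          ring

theorem isWiener_opD {a : LTwo} (ha : MemHardySobolev 2 a) : IsWiener (opD a) := by
  refine isWiener_of_ae_eq (ha.integrable_mul_fourier.1.const_mul (2 * Real.pi)) ?_
  filter_upwards [fourier_opD ha.one_of_two] with η h
  rw [h]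
  push_cast
  ring

theorem wienerNorm_opD_le {a : LTwo} (ha : MemHardySobolev 2 a) :
    wienerNorm (opD a) ≤ 2 * Real.pi * (‖invSqrt‖ * (‖a‖ + ‖opDxx a‖)) := by
  have h1 : wienerNorm (opD a) = 2 * Real.pi * ∫ η : ℝ, ‖(η : ℂ) * (𝓕 a : LTwo) η‖ := by
    rw [← integral_const_mul]
    refine integral_congr_ae ?_
    filter_upwards [fourier_opD ha.one_of_two] with η h
    rw [h, ofReal_mul, mul_assoc, norm_mul, norm_real, Real.norm_of_nonneg (by positivity)]
  rw [h1]
  gcongr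
  exact ha.integrable_mul_fourier.2.2

theorem wienerNorm_le {a : LTwo} (ha : MemHardySobolev 2 a) :
    wienerNorm a ≤ ‖invSqrt‖ * (‖a‖ + ‖opDxx a‖) := ha.integrable_mul_fourier.2.1

/-- The quadratic expression `(D + |D|)(a b̄)`. -/
def quadForm (a b : LTwo) : LTwo := opDAbsD (mulL2 (conjFun b) a)

section

variable {a b : LTwo}

/-- The conjugate `b̄` has no positive frequencies, so an output frequency `η > 0` of `a b̄` comes
from frequencies of `a` above `η`: the symbol of `D + |D|` costs a derivative on `a` and none on
`b`. The majorant `F` is the product of the functions whose transforms are the absolute values of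
those of `D a` and `b̄`, so its norms are controlled by product estimates. -/
theorem exists_majorant (ha : MemHardySobolev 2 a) (hb : IsWiener b) (hb' : MemHardy b) :
    ∃ F : LTwo, IsWiener F ∧ ‖F‖ ≤ wienerNorm (opD a) * ‖b‖ ∧
      wienerNorm F ≤ wienerNorm (opD a) * wienerNorm b ∧
      ∀ᵐ η : ℝ, ‖((2 * Real.pi * η + |2 * Real.pi * η| : ℝ) : ℂ) *
        (𝓕 (mulL2 (conjFun b) a) : LTwo) η‖ ≤ 2 * ‖(𝓕 F : LTwo) η‖ := by
  obtain ⟨f, hf, hfn⟩ := exists_absFourier (opD a)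
  obtain ⟨g, hg, hgn⟩ := exists_absFourier (star b)
  have hDW := isWiener_opD ha
  have hfW : IsWiener f := isWiener_of_ae_eq hDW.norm.ofReal hf
  have hgW : IsWiener g := isWiener_of_ae_eq hb.star.norm.ofReal hg
  have hfw : wienerNorm f = wienerNorm (opD a) := by
    refine integral_congr_ae ?_
    filter_upwards [hf] with η h
    rw [h, norm_real, norm_norm]
  have hgw : wienerNorm g = wienerNorm b := by
    rw [← wienerNorm_star hb]
    refine integral_congr_ae ?_
    filter_upwards [hg] with η h
    rw [h, norm_real, norm_norm]
  refine ⟨mulL2 f g, hfW.mulL2 hgW, ?_, ?_, ?_⟩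
  · refine (norm_mulL2_le hfW g).trans_eq ?_
    rw [hfw, hgn, norm_star_lTwo]
  · refine (wienerNorm_mulL2_le hfW hgW).trans_eq ?_
    rw [hfw, hgw]
  -- A representative that vanishes at every positive frequency, as the pointwise bound
  -- `norm_mul_conv_le` requires.
  set β : ℝ → ℂ := (Set.Iic (0 : ℝ)).indicator (𝓕 (star b) : LTwo) with hβ
  have hβae : (𝓕 (star b) : LTwo) =ᵐ[volume] β := by
    have h1 : ∀ᵐ η : ℝ, -η < 0 → (𝓕 b : LTwo) (-η) = 0 :=
      (Measure.measurePreserving_neg (volume : Measure ℝ)).quasiMeasurePreserving.ae hb'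
    filter_upwards [h1, fourier_star hb] with η h1 h2
    by_cases h : 0 < η
    · rw [hβ, Set.indicator_of_notMem (by simpa using h), h2, h1 (by linarith), map_zero]
    · rw [hβ, Set.indicator_of_mem (by simpa using h)]
  have hβ0 : ∀ y, 0 < y → β y = 0 := fun y hy => Set.indicator_of_notMem (by simpa using hy) _
  have hβ2 : MemLp β 2 := (Lp.memLp _).ae_eq hβae
  have hα2 : MemLp (fun s : ℝ => (s : ℂ) * (𝓕 a : LTwo) s) 2 :=
    (memSobolev_one_iff a).1 ha.one_of_two.2
  have haW := ha.one_of_two.isWiener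
  have hprod : (𝓕 (mulL2 (conjFun b) a) : LTwo) =ᵐ[volume] conv (𝓕 a : LTwo) β := by
    have h1 := fourier_of_ae_eq_mul haW hb.star (F := mulL2 (conjFun b) a) (by
      filter_upwards [coeFn_mulL2_conjFun hb a, star_ae_eq b] with x h1 h2
      rw [h1, h2, mul_comm])
    rwa [conv_congr_ae (Filter.EventuallyEq.refl _ _) hβae] at h1
  have hF : (𝓕 (mulL2 f g) : LTwo) =ᵐ[volume] fun η =>
      ((2 * Real.pi * ∫ s : ℝ, ‖(s : ℂ) * (𝓕 a : LTwo) s‖ * ‖β (η - s)‖ : ℝ) : ℂ) := by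
    refine (fourier_mulL2 hfW hgW).trans (ae_of_all _ fun η => ?_)
    have h1 : (𝓕 f : LTwo) =ᵐ[volume]
        fun s : ℝ => ((2 * Real.pi * ‖(s : ℂ) * (𝓕 a : LTwo) s‖ : ℝ) : ℂ) := by
      filter_upwards [hf, fourier_opD ha.one_of_two] with s h1 h2
      rw [h1, h2, ofReal_mul (2 * Real.pi), mul_assoc, norm_mul, norm_real,
        Real.norm_of_nonneg (by positivity)]
    have h2 : (𝓕 g : LTwo) =ᵐ[volume] fun s : ℝ => ((‖β s‖ : ℝ) : ℂ) := by
      filter_upwards [hg, hβae] with s h1 h2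
      rw [h1, h2]
    dsimp only
    rw [conv_congr_ae h1 h2, conv, ← integral_const_mul, ← integral_complex_ofReal]
    refine integral_congr_ae (ae_of_all _ fun s => ?_)
    dsimp only
    rw [← ofReal_mul, mul_assoc]
  filter_upwards [hprod, hF] with η h1 h2
  rw [h1, h2, norm_real, Real.norm_of_nonneg (by positivity)]
  have h3 := norm_mul_conv_le hα2 hβ2 hβ0 η
  have h4 : ((2 * Real.pi * η + |2 * Real.pi * η| : ℝ) : ℂ) =
      ((2 * Real.pi : ℝ) : ℂ) * ((η + |η| : ℝ) : ℂ) := by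
    rw [abs_mul, abs_of_nonneg (by positivity), ← ofReal_mul, mul_add]
  rw [h4, mul_assoc, norm_mul, norm_real, Real.norm_of_nonneg (by positivity)]
  exact (mul_le_mul_of_nonneg_left h3 (by positivity)).trans_eq (by ring)

theorem memMulDomain_quadForm (ha : MemHardySobolev 2 a) (hb : IsWiener b) (hb' : MemHardy b) :
    MemMulDomain (fun ξ => ((ξ + |ξ| : ℝ) : ℂ)) (mulL2 (conjFun b) a) := by
  obtain ⟨F, -, -, -, hF⟩ := exists_majorant ha hb hb'
  refine MemLp.of_le_mul (c := 2) (Lp.memLp (𝓕 F : LTwo)) ?_ hF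
  exact aestronglyMeasurable_mul_fourier
    (m := fun η : ℝ => ((2 * Real.pi * η + |2 * Real.pi * η| : ℝ) : ℂ)) (by fun_prop) _

theorem isWiener_quadForm (ha : MemHardySobolev 2 a) (hb : IsWiener b) (hb' : MemHardy b) :
    IsWiener (quadForm a b) ∧ wienerNorm (quadForm a b) ≤ 2 * (wienerNorm (opD a) * wienerNorm b) ∧
      ‖quadForm a b‖ ≤ 2 * (wienerNorm (opD a) * ‖b‖) := by
  obtain ⟨F, hFW, h1, h2, hF⟩ := exists_majorant ha hb hb'
  have h3 : ∀ᵐ η : ℝ, ‖(𝓕 (quadForm a b) : LTwo) η‖ ≤ 2 * ‖(𝓕 F : LTwo) η‖ := by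
    filter_upwards [fourier_fourierMul (m := fun ξ => ((ξ + |ξ| : ℝ) : ℂ))
      (memMulDomain_quadForm ha hb hb'), hF] with η h3 h4
    rw [quadForm, opDAbsD, h3]
    exact h4
  have hW : IsWiener (quadForm a b) :=
    Integrable.mono' (hFW.norm.const_mul 2) (Lp.aestronglyMeasurable _) h3
  refine ⟨hW, ?_, ?_⟩
  · refine (integral_mono_ae hW.norm (hFW.norm.const_mul 2) h3).trans ?_
    rw [integral_const_mul]
    exact mul_le_mul_of_nonneg_left h2 zero_le_two
  · rw [← Lp.norm_fourier_eq]
    refine (Lp.norm_le_mul_norm_of_ae_le_mul h3).trans ?_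
    rw [Lp.norm_fourier_eq]
    exact mul_le_mul_of_nonneg_left h1 zero_le_two

end

theorem inner_fourierMul_im {m : ℝ → ℂ} {f : LTwo} (hm : ∀ ξ, starRingEnd ℂ (m ξ) = m ξ)
    (hf : MemMulDomain m f) : (inner ℂ f (fourierMul m f) : ℂ).im = 0 := by
  rw [← Complex.conj_eq_iff_im, inner_eq_fourier, ← integral_conj]
  refine integral_congr_ae ?_
  filter_upwards [fourier_fourierMul hf] with η h
  rw [h, map_mul, map_mul, conj_conj, hm]
  ring

theorem memMulDomain_opDxx {f : LTwo} (hf : MemHardySobolev 2 f) :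
    MemMulDomain (fun ξ => -(ξ : ℂ) ^ 2) f := by
  refine (((memSobolev_two_iff f).1 hf.2).const_mul (-(2 * Real.pi) ^ 2)).ae_eq
    (ae_of_all _ fun η => ?_)
  push_cast
  ring

end

/-! ### Uniqueness of solutions -/

section

theorem mulL2_add_left {f g : LTwo} (hf : IsWiener f) (hg : IsWiener g) (hfg : IsWiener (f + g))
    (h : LTwo) : mulL2 ((f + g : LTwo) : ℝ → ℂ) h = mulL2 f h + mulL2 g h := by
  apply Lp.ext
  filter_upwards [coeFn_mulL2_wiener hfg h, Lp.coeFn_add (mulL2 f h) (mulL2 g h), Lp.coeFn_add f g,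
    coeFn_mulL2_wiener hf h, coeFn_mulL2_wiener hg h] with x h1 h2 h3 h4 h5
  rw [h1, h2, h3, Pi.add_apply, Pi.add_apply, h4, h5, add_mul]

theorem mulL2_comm {f g : LTwo} (hf : IsWiener f) (hg : IsWiener g) : mulL2 f g = mulL2 g f := by
  apply Lp.ext
  filter_upwards [coeFn_mulL2_wiener hf g, coeFn_mulL2_wiener hg f] with x h1 h2
  rw [h1, h2, mul_comm]

variable {a a' b b' u v : LTwo}

theorem quadForm_add_left (ha : MemHardySobolev 2 a) (ha' : MemHardySobolev 2 a')
    (hb : IsWiener b) (hb' : MemHardy b) :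
    quadForm (a + a') b = quadForm a b + quadForm a' b := by
  rw [quadForm, mulL2_conjFun, mulL2_add (hb.star.memLp_mul a) (hb.star.memLp_mul a'),
    ← mulL2_conjFun, ← mulL2_conjFun]
  exact fourierMul_add (memMulDomain_quadForm ha hb hb') (memMulDomain_quadForm ha' hb hb')

theorem quadForm_add_right (ha : MemHardySobolev 2 a) (hb : MemHardySobolev 2 b)
    (hb' : MemHardySobolev 2 b') :
    quadForm a (b + b') = quadForm a b + quadForm a b' := by
  have h1 := hb.one_of_two.isWiener
  have h2 := hb'.one_of_two.isWiener
  have h3 := (hb.add hb').one_of_two.isWiener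
  have h4 : mulL2 (conjFun (b + b' : LTwo)) a = mulL2 (conjFun b) a + mulL2 (conjFun b') a := by
    have : star (b + b') = star b + star b' := by
      apply Lp.ext
      filter_upwards [star_ae_eq (b + b'), star_ae_eq b, star_ae_eq b', Lp.coeFn_add b b',
        Lp.coeFn_add (star b) (star b')] with x h1 h2 h3 h4 h5
      rw [h1, h5, Pi.add_apply, h2, h3, h4, Pi.add_apply, map_add]
    rw [mulL2_conjFun, mulL2_conjFun, mulL2_conjFun, this,
      mulL2_add_left h1.star h2.star (this ▸ h3.star)]
  rw [quadForm, h4]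
  exact fourierMul_add (memMulDomain_quadForm ha h1 hb.1) (memMulDomain_quadForm ha h2 hb'.1)

/-- The nonlinearity of (CM-DNLS). -/
def cubic (u : LTwo) : LTwo := mulL2 (quadForm u u) u

/-- Telescoping, ordered so that in the first two terms the derivative falls on `u`; only the last
has a derivative on the difference, and that one is removed by `inner_mulL2_quadForm_im`. -/
theorem cubic_sub (hu : MemHardySobolev 2 u) (hv : MemHardySobolev 2 v) :
    cubic u - cubic v = mulL2 (quadForm u u) (u - v) + mulL2 (quadForm u (u - v)) v +
      mulL2 (quadForm (u - v) v) v := by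
  have hw := hu.sub hv
  have hu1 := hu.one_of_two.isWiener
  have hv1 := hv.one_of_two.isWiener
  have hw1 := hw.one_of_two.isWiener
  obtain ⟨w, rfl⟩ : ∃ w, u = w + v := ⟨u - v, (sub_add_cancel u v).symm⟩
  rw [add_sub_cancel_right] at hw hw1 ⊢
  have q1 := (isWiener_quadForm hu hu1 hu.1).1
  have q2 := (isWiener_quadForm hu hw1 hw.1).1
  have q3 := (isWiener_quadForm hu hv1 hv.1).1
  have q4 := (isWiener_quadForm hw hv1 hv.1).1
  have q5 := (isWiener_quadForm hv hv1 hv.1).1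
  have e1 := quadForm_add_right hu hw hv
  have e2 := quadForm_add_left hw hv hv1 hv.1
  have m1 : mulL2 (quadForm (w + v) (w + v)) v =
      mulL2 (quadForm (w + v) w) v + mulL2 (quadForm (w + v) v) v := by
    rw [e1, mulL2_add_left q2 q3 (e1 ▸ q1)]
  have m2 : mulL2 (quadForm (w + v) v) v = mulL2 (quadForm w v) v + mulL2 (quadForm v v) v := by
    rw [e2, mulL2_add_left q4 q5 (e2 ▸ q3)]
  rw [cubic, cubic, mulL2_add (q1.memLp_mul w) (q1.memLp_mul v), m1, m2]
  abel

/-- The most singular part of the linearised nonlinearity is skew-symmetric. -/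
theorem inner_mulL2_quadForm_im (hu : MemHardySobolev 2 u) (hv : MemHardySobolev 2 v) :
    (inner ℂ u (mulL2 (quadForm u v) v) : ℂ).im = 0 := by
  have hv1 := hv.one_of_two.isWiener
  have h1 : inner ℂ u (mulL2 (quadForm u v) v) =
      inner ℂ (mulL2 (conjFun v) u) (quadForm u v) := by
    rw [inner_eq_integral, inner_eq_integral]
    refine integral_congr_ae ?_
    filter_upwards [coeFn_mulL2_wiener (isWiener_quadForm hu hv1 hv.1).1 v,
      coeFn_mulL2_conjFun hv1 u] with x h1 h2
    rw [h1, h2, map_mul, conj_conj]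
    ring
  rw [h1, quadForm, opDAbsD]
  exact inner_fourierMul_im (fun ξ => conj_ofReal _) (memMulDomain_quadForm hu hv1 hv.1)

theorem opDxx_sub (hu : MemHardySobolev 2 u) (hv : MemHardySobolev 2 v) :
    opDxx (u - v) = opDxx u - opDxx v := by
  rw [eq_sub_iff_add_eq]
  have := fourierMul_add (memMulDomain_opDxx (hu.sub hv)) (memMulDomain_opDxx hv)
  rw [sub_add_cancel] at this
  exact this.symm

/-- The energy estimate for the difference of two solutions. -/
theorem abs_inner_im_le (hu : MemHardySobolev 2 u) (hv : MemHardySobolev 2 v) :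
    |(inner ℂ (u - v) ((opDxx u + cubic u) - (opDxx v + cubic v)) : ℂ).im| ≤
      2 * wienerNorm (opD u) * (wienerNorm u + wienerNorm v) * ‖u - v‖ ^ 2 := by
  have hw := hu.sub hv
  have hu1 := hu.one_of_two.isWiener
  have hv1 := hv.one_of_two.isWiener
  have hw1 := hw.one_of_two.isWiener
  have e : (opDxx u + cubic u) - (opDxx v + cubic v) = opDxx (u - v) +
      (mulL2 (quadForm u u) (u - v) + mulL2 (quadForm u (u - v)) v +
      mulL2 (quadForm (u - v) v) v) := by
    rw [← cubic_sub hu hv, opDxx_sub hu hv]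
    abel
  have h1 : (inner ℂ (u - v) (opDxx (u - v)) : ℂ).im = 0 :=
    inner_fourierMul_im (fun ξ => by rw [map_neg, map_pow, conj_ofReal]) (memMulDomain_opDxx hw)
  have h2 := inner_mulL2_quadForm_im hw hv
  rw [e, inner_add_right, inner_add_right, inner_add_right, add_im, add_im, add_im, h1, h2, zero_add,
    add_zero]
  have q1 := isWiener_quadForm hu hu1 hu.1
  have q2 := isWiener_quadForm hu hw1 hw.1
  have b1 : ‖(inner ℂ (u - v) (mulL2 (quadForm u u) (u - v)) : ℂ)‖ ≤
      2 * (wienerNorm (opD u) * wienerNorm u) * ‖u - v‖ ^ 2 := by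
    refine (norm_inner_le_norm _ _).trans ?_
    calc ‖u - v‖ * ‖mulL2 (quadForm u u) (u - v)‖
        ≤ ‖u - v‖ * (2 * (wienerNorm (opD u) * wienerNorm u) * ‖u - v‖) := by
          gcongr
          exact (norm_mulL2_le q1.1 _).trans (by gcongr; exact q1.2.1)
      _ = _ := by ring
  have b2 : ‖(inner ℂ (u - v) (mulL2 (quadForm u (u - v)) v) : ℂ)‖ ≤
      2 * (wienerNorm (opD u) * wienerNorm v) * ‖u - v‖ ^ 2 := by
    refine (norm_inner_le_norm _ _).trans ?_
    calc ‖u - v‖ * ‖mulL2 (quadForm u (u - v)) v‖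
        ≤ ‖u - v‖ * (wienerNorm v * (2 * (wienerNorm (opD u) * ‖u - v‖))) := by
          gcongr
          rw [mulL2_comm q2.1 hv1]
          exact (norm_mulL2_le hv1 _).trans
            (mul_le_mul_of_nonneg_left q2.2.2 (wienerNorm_nonneg v))
      _ = _ := by ring
  refine (abs_add_le _ _).trans ?_
  have c1 := (Complex.abs_im_le_norm _).trans b1
  have c2 := (Complex.abs_im_le_norm _).trans b2
  linarith

/-- Gronwall on compact subintervals, where the constant may depend on the subinterval; times before
`t₀` are reached by reversing time. -/
theorem eq_zero_of_gronwall {f f' : ℝ → ℂ} {J : Set ℝ} (hJ : J.OrdConnected) {t₀ : ℝ} (ht₀ : t₀ ∈ J)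
    (hf : ∀ t ∈ J, HasDerivWithinAt f (f' t) J t) (h0 : f t₀ = 0)
    (hb : ∀ a ∈ J, ∀ b ∈ J, ∃ K : ℝ, ∀ t ∈ Set.Icc a b, ‖f' t‖ ≤ K * ‖f t‖) :
    ∀ t ∈ J, f t = 0 := by
  intro t ht
  rcases le_total t₀ t with hle | hle
  · obtain ⟨K, hK⟩ := hb t₀ ht₀ t ht
    have hsub : Set.Icc t₀ t ⊆ J := hJ.out ht₀ ht
    refine eq_zero_of_abs_deriv_le_mul_abs_self_of_eq_zero_right (f' := f') (K := K) (a := t₀)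
      (fun s hs => ((hf s (hsub hs)).mono hsub).continuousWithinAt) (fun s hs => ?_) h0
      (fun s hs => hK s ⟨hs.1, hs.2.le⟩) t ⟨hle, le_rfl⟩
    exact ((hf s (hsub ⟨hs.1, hs.2.le⟩)).mono hsub).mono_of_mem_nhdsWithin
      (Icc_mem_nhdsGE_of_mem hs)
  · obtain ⟨K, hK⟩ := hb t ht t₀ ht₀
    have hsub : Set.Icc t t₀ ⊆ J := hJ.out ht ht₀
    have hd : ∀ s ∈ Set.Icc (-t₀) (-t), HasDerivWithinAt (fun s => f (-s)) (-f' (-s))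
        (Set.Icc (-t₀) (-t)) s := by
      intro s hs
      have hs' : -s ∈ Set.Icc t t₀ := ⟨by linarith [hs.2], by linarith [hs.1]⟩
      have h1 := ((hf (-s) (hsub hs')).mono hsub).scomp s (h := fun s : ℝ => -s)
        (s := Set.Icc (-t₀) (-t)) (h' := -1) ((hasDerivAt_neg s).hasDerivWithinAt)
        (fun r hr => ⟨by linarith [hr.2], by linarith [hr.1]⟩)
      simpa [Function.comp_def] using h1
    have := eq_zero_of_abs_deriv_le_mul_abs_self_of_eq_zero_right (f := fun s => f (-s))
      (f' := fun s => -f' (-s)) (K := K) (a := -t₀) (b := -t)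
      (fun s hs => (hd s hs).continuousWithinAt) (fun s hs => ?_) (by simpa using h0)
      (fun s hs => ?_) (-t) ⟨by linarith, le_rfl⟩
    · simpa using this
    · exact (hd s ⟨hs.1, hs.2.le⟩).mono_of_mem_nhdsWithin (Icc_mem_nhdsGE_of_mem hs)
    · rw [norm_neg]
      exact hK _ ⟨by linarith [hs.2], by linarith [hs.1]⟩

/-- Uniqueness of solutions of (CM-DNLS) in `C(J; H²₊)`. -/
theorem IsSolutionOn.unique {u v : ℝ → LTwo} {J : Set ℝ} (hu : IsSolutionOn u J)
    (hv : IsSolutionOn v J) (hJ : J.OrdConnected) {t₀ : ℝ} (ht₀ : t₀ ∈ J) (h0 : u t₀ = v t₀) :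
    ∀ t ∈ J, u t = v t := by
  obtain ⟨hu2, huc, hucc, hud⟩ := hu
  obtain ⟨hv2, hvc, hvcc, hvd⟩ := hv
  choose! u' hu' hueq using hud
  choose! v' hv' hveq using hvd
  set E' : ℝ → ℂ := fun t => inner ℂ (u t - v t) (u' t - v' t) + inner ℂ (u' t - v' t) (u t - v t)
    with hE'
  have hder : ∀ t ∈ J, HasDerivWithinAt (fun t => inner ℂ (u t - v t) (u t - v t)) (E' t) J t :=
    fun t ht => HasDerivWithinAt.inner ℂ ((hu' t ht).sub (hv' t ht)) ((hu' t ht).sub (hv' t ht))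
  have hbound : ∀ t ∈ J, ‖E' t‖ ≤ 2 * (2 * wienerNorm (opD (u t)) *
      (wienerNorm (u t) + wienerNorm (v t)) * ‖u t - v t‖ ^ 2) := by
    intro t ht
    set Z : ℂ := inner ℂ (u t - v t) ((opDxx (u t) + cubic (u t)) - (opDxx (v t) + cubic (v t)))
      with hZ
    have e1 : u' t - v' t = I • ((opDxx (u t) + cubic (u t)) - (opDxx (v t) + cubic (v t))) := by
      have h1 : ∀ {a b c : LTwo}, I • a + b + c = 0 → a = I • (b + c) := by
        intro a b c h
        rw [add_assoc] at h
        rw [eq_neg_of_add_eq_zero_right h, smul_neg, smul_smul, I_mul_I, neg_one_smul, neg_neg]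
      rw [h1 (hueq t ht), h1 (hveq t ht), ← smul_sub]
      rfl
    -- With `u' - v' = i (…)`, the derivative of `‖u - v‖²` is `-2 Im Z`, so only the imaginary part
    -- has to be estimated.
    have e2 : E' t = ((-(2 * Z.im) : ℝ) : ℂ) := by
      have h1 : inner ℂ (u t - v t) (u' t - v' t) = I * Z := by rw [e1, inner_smul_right]
      rw [hE']
      dsimp only
      rw [← inner_conj_symm (u' t - v' t), h1]
      apply Complex.ext <;> simp
      ring
    rw [e2, norm_real, norm_neg, Real.norm_eq_abs, abs_mul, abs_two]
    gcongr
    exact abs_inner_im_le (hu2 t ht) (hv2 t ht)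
  intro t ht
  have key := eq_zero_of_gronwall hJ ht₀ hder (by rw [h0, sub_self, inner_zero_left]) ?_ t ht
  · exact sub_eq_zero.1 (inner_self_eq_zero.1 key)
  intro a ha b hb
  have hsub : Set.Icc a b ⊆ J := hJ.out ha hb
  have hcont : ContinuousOn (fun t => (‖u t‖ + ‖opDxx (u t)‖) + (‖v t‖ + ‖opDxx (v t)‖))
      (Set.Icc a b) :=
    ((huc.mono hsub).norm.add (hucc.mono hsub).norm).add
      ((hvc.mono hsub).norm.add (hvcc.mono hsub).norm)
  obtain ⟨B, hB⟩ := isCompact_Icc.exists_bound_of_continuousOn hcont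
  -- `B` bounds `‖·‖ + ‖∂ₓₓ·‖` for both solutions on the compact interval. The Wiener norms of `u`
  -- and `v` are then at most `‖invSqrt‖ B`, and that of `D u` at most `2π ‖invSqrt‖ B`.
  refine ⟨2 * (2 * (2 * Real.pi * (‖invSqrt‖ * B)) * (‖invSqrt‖ * B + ‖invSqrt‖ * B)),
    fun t ht => ?_⟩
  have hBt := hB t ht
  rw [Real.norm_of_nonneg (by positivity)] at hBt
  have n1 : 0 ≤ ‖u t‖ + ‖opDxx (u t)‖ := by positivity
  have n2 : 0 ≤ ‖v t‖ + ‖opDxx (v t)‖ := by positivity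
  have hBu : ‖u t‖ + ‖opDxx (u t)‖ ≤ B := by linarith
  have hBv : ‖v t‖ + ‖opDxx (v t)‖ ≤ B := by linarith
  have hB0 : 0 ≤ B := n1.trans hBu
  refine (hbound t (hsub ht)).trans ?_
  have w1 : wienerNorm (opD (u t)) ≤ 2 * Real.pi * (‖invSqrt‖ * B) :=
    (wienerNorm_opD_le (hu2 t (hsub ht))).trans (by gcongr)
  have w2 : wienerNorm (u t) ≤ ‖invSqrt‖ * B :=
    (wienerNorm_le (hu2 t (hsub ht))).trans (by gcongr)
  have w3 : wienerNorm (v t) ≤ ‖invSqrt‖ * B :=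
    (wienerNorm_le (hv2 t (hsub ht))).trans (by gcongr)
  have p1 := wienerNorm_nonneg (u t)
  have p2 := wienerNorm_nonneg (v t)
  have hn : ‖(inner ℂ (u t - v t) (u t - v t) : ℂ)‖ = ‖u t - v t‖ ^ 2 := by
    rw [inner_self_eq_norm_sq_to_K]
    simp
  rw [hn, mul_assoc 2 (2 * _ * _)]
  gcongr

end

/-! ### Time dependence of the resolvent under `γ_j ↦ γ_j + 2 λ_j t` -/

section

/-- Multiplication by a function with integrable Fourier transform. -/
def mulCLM (f : LTwo) (hf : IsWiener f) : LTwo →L[ℂ] LTwo :=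
  LinearMap.mkContinuous
    { toFun := fun g => mulL2 f g
      map_add' := fun g h => mulL2_add (hf.memLp_mul g) (hf.memLp_mul h)
      map_smul' := fun c g => mulL2_smul c (hf.memLp_mul g) }
    (wienerNorm f) (fun g => norm_mulL2_le hf g)

section Bootstrap

variable {E : Type*} [NormedAddCommGroup E] [NormedSpace ℂ E]

/-- Once `|t - s| ‖T‖ ≤ 1/2` the last term is absorbed, giving `‖a t‖ ≤ 2 ‖b t‖`; the correction is
then `O(|t - s|)` and disappears in the limit. -/
theorem tendsto_of_eq_add_smul {a b : ℝ → E} {s : ℝ} {T : E →L[ℂ] E} (hb : ContinuousAt b s)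
    (h : ∀ t, a t = b t + ((t - s : ℝ) : ℂ) • T (a t)) : ContinuousAt a s := by
  have hs : a s = b s := by simpa using h s
  have h1 : ∀ᶠ t in 𝓝 s, |t - s| * ‖T‖ ≤ 1 / 2 := by
    have : Tendsto (fun t : ℝ => |t - s| * ‖T‖) (𝓝 s) (𝓝 (|s - s| * ‖T‖)) := by
      apply Continuous.tendsto
      fun_prop
    rw [sub_self, abs_zero, zero_mul] at this
    exact (this.eventually_lt_const (by norm_num : (0 : ℝ) < 1 / 2)).mono fun _ h => h.le
  have hle : ∀ t, ‖((t - s : ℝ) : ℂ) • T (a t)‖ ≤ |t - s| * ‖T‖ * ‖a t‖ := by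
    intro t
    rw [norm_smul, norm_real, Real.norm_eq_abs, mul_assoc]
    gcongr
    exact T.le_opNorm _
  have h2 : ∀ᶠ t in 𝓝 s, ‖a t‖ ≤ 2 * ‖b t‖ := by
    filter_upwards [h1] with t ht
    have h3 : ‖a t‖ ≤ ‖b t‖ + |t - s| * ‖T‖ * ‖a t‖ := by
      conv_lhs => rw [h t]
      exact (norm_add_le _ _).trans (by gcongr; exact hle t)
    have h4 : |t - s| * ‖T‖ * ‖a t‖ ≤ 1 / 2 * ‖a t‖ :=
      mul_le_mul_of_nonneg_right ht (norm_nonneg _)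
    linarith
  have h5 : Tendsto (fun t => ((t - s : ℝ) : ℂ) • T (a t)) (𝓝 s) (𝓝 0) := by
    have h6 : Tendsto (fun t => |t - s| * ‖T‖ * (2 * ‖b t‖)) (𝓝 s) (𝓝 0) := by
      have h7 : Tendsto (fun t : ℝ => |t - s| * ‖T‖) (𝓝 s) (𝓝 0) := by
        have : Tendsto (fun t : ℝ => |t - s| * ‖T‖) (𝓝 s) (𝓝 (|s - s| * ‖T‖)) := by
          apply Continuous.tendsto
          fun_prop
        simpa using this
      have := h7.mul ((hb.norm.tendsto).const_mul 2)
      rwa [zero_mul] at this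
    refine squeeze_zero_norm' ?_ h6
    filter_upwards [h2] with t ht
    exact (hle t).trans (by gcongr)
  have h8 := hb.tendsto.add h5
  rw [add_zero, ← hs] at h8
  exact h8.congr fun t => (h t).symm

/-- The difference quotient is exactly `T (a t)`, so continuity of `a` at `s` already gives the
derivative. -/
theorem hasDerivAt_of_eq_add_smul [NormedSpace ℝ E] [IsScalarTower ℝ ℂ E] {a : ℝ → E} {s : ℝ}
    {T : E →L[ℂ] E} (h : ∀ t, a t = a s + ((t - s : ℝ) : ℂ) • T (a t)) :
    HasDerivAt a (T (a s)) s := by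
  have hc : ContinuousAt a s := tendsto_of_eq_add_smul (b := fun _ => a s) continuousAt_const h
  rw [hasDerivAt_iff_tendsto_slope]
  have h1 : Tendsto (fun t => T (a t)) (𝓝[≠] s) (𝓝 (T (a s))) :=
    ((T.continuous.tendsto _).comp hc.tendsto).mono_left nhdsWithin_le_nhds
  refine h1.congr' ?_
  filter_upwards [self_mem_nhdsWithin] with t ht
  have hne : t - s ≠ 0 := sub_ne_zero.2 ht
  have h2 : a t - a s = (t - s) • T (a t) := by
    rw [sub_eq_iff_eq_add', RCLike.real_smul_eq_coe_smul (K := ℂ)]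
    exact h t
  rw [slope_def_module, h2, smul_smul, inv_mul_cancel₀ hne, one_smul]

end Bootstrap

/-- The action of a matrix of rational functions on row vectors. -/
def rowOp {N : ℕ} (F : Fin N → Fin N → ClosedUHP → ℂ) (hF : ∀ l k, F l k ∈ ratHardy) :
    (Fin N → LTwo) →L[ℂ] (Fin N → LTwo) :=
  ContinuousLinearMap.pi fun k =>
    ∑ l, (mulCLM (realize (F l k)) (isWiener_realize (hF l k))).comp (ContinuousLinearMap.proj l)

theorem rowOp_realize {N : ℕ} {F : Fin N → Fin N → ClosedUHP → ℂ} (hF : ∀ l k, F l k ∈ ratHardy)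
    {g : Fin N → ClosedUHP → ℂ} (hg : ∀ l, g l ∈ ratHardy) :
    rowOp F hF (fun l => realize (g l)) = fun k => realize (∑ l, F l k * g l) := by
  ext1 k
  have h1 := realize_sum (fun _ : Fin N => (1 : ℂ)) fun l => ratHardy_mul_mem (hF l k) (hg l)
  simp only [one_smul] at h1
  rw [h1]
  simp only [rowOp, ContinuousLinearMap.pi_apply, _root_.sum_apply,
    ContinuousLinearMap.comp_apply, ContinuousLinearMap.proj_apply]
  refine Finset.sum_congr rfl fun l _ => ?_
  exact mulL2_realize (hF l k) (hg l)

variable {N : ℕ} [NeZero N] {lam γ : Fin N → ℝ} {ρ : ℝ} {c : ℂ}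

/-- Entries of the powers of the resolvent. -/
def resolvPow (lam γ : Fin N → ℝ) (ρ : ℝ) (m : ℕ) (j k : Fin N) : ClosedUHP → ℂ :=
  fun z => (resolv lam γ ρ z ^ (m + 1)) j k

theorem Admissible.resolvPow_mem (h : Admissible lam ρ) (m : ℕ) (j k : Fin N) :
    resolvPow lam γ ρ m j k ∈ ratHardy := by
  induction m generalizing k with
  | zero =>
    convert h.resolvFun_mem (γ := γ) j k using 1
    ext z
    rw [resolvPow, zero_add, pow_one, resolvFun]
  | succ m ih =>
    have : resolvPow lam γ ρ (m + 1) j k =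
        ∑ l, resolvPow lam γ ρ m j l * resolvFun lam γ ρ l k := by
      ext z
      rw [resolvPow, pow_succ, Matrix.mul_apply]
      simp [resolvPow, resolvFun]
    rw [this]
    exact Submodule.sum_mem _ fun l _ => ratHardy_mul_mem (ih l) (h.resolvFun_mem l k)

/-- The evolution of `γ` under the flow. -/
def flow (lam γ : Fin N → ℝ) (t : ℝ) : Fin N → ℝ := fun j => γ j + 2 * lam j * t

theorem shiftMatrix_flow_sub (t s : ℝ) (z : ℂ) :
    shiftMatrix lam (flow lam γ t) ρ z - shiftMatrix lam (flow lam γ s) ρ z =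
      (2 * (t - s) : ℂ) • eigenMatrix lam := by
  ext j k
  by_cases hjk : j = k
  · subst hjk
    simp [shiftMatrix, spectralMatrix, eigenMatrix, flow]
    ring
  · simp [shiftMatrix, spectralMatrix, eigenMatrix, flow, hjk]

/-- The resolvent identity for `M(t) - M(s) = 2 (t - s) Λ`, written with `R(s)` on the right: the
operator acting on the rows of `R(t)` is then independent of `t`. -/
theorem Admissible.resolv_flow (h : Admissible lam ρ) (t s : ℝ) {z : ℂ} (hz : 0 ≤ z.im) :
    resolv lam (flow lam γ t) ρ z = resolv lam (flow lam γ s) ρ z +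
      ((t - s : ℝ) : ℂ) • (resolv lam (flow lam γ t) ρ z * ((-2 : ℂ) • eigenMatrix lam) *
        resolv lam (flow lam γ s) ρ z) := by
  have h1 := h.resolv_mul (γ := flow lam γ t) hz
  have h2 := h.mul_resolv (γ := flow lam γ s) hz
  have h3 := congrArg (fun B => resolv lam (flow lam γ t) ρ z * B * resolv lam (flow lam γ s) ρ z)
    (shiftMatrix_flow_sub (lam := lam) (γ := γ) (ρ := ρ) t s z)
  simp only [Matrix.mul_sub, Matrix.sub_mul] at h3
  rw [h1, Matrix.one_mul, Matrix.mul_assoc, h2, Matrix.mul_one] at h3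
  rw [← sub_eq_iff_eq_add', ← neg_sub, h3]
  simp only [Matrix.mul_smul, Matrix.smul_mul, smul_smul, ← neg_smul]
  congr 1
  push_cast
  ring

/-- The rows of the powers of the resolvent, as functions on the line. -/
def resolvRow (lam γ : Fin N → ℝ) (ρ : ℝ) (m : ℕ) (j : Fin N) : Fin N → LTwo :=
  fun k => realize (resolvPow lam γ ρ m j k)

theorem Admissible.flowCoeff_mem (h : Admissible lam ρ) (l k : Fin N) :
    (-2 * lam l : ℂ) • resolvFun lam γ ρ l k ∈ ratHardy :=
  ratHardy.smul_mem _ (h.resolvFun_mem l k)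

theorem mul_eigen_mul_apply {n : ℕ} {lam : Fin n → ℝ} (a b : ℂ) (B C : Matrix (Fin n) (Fin n) ℂ)
    (j k : Fin n) :
    (a • (B * (b • eigenMatrix lam) * C)) j k = a * ∑ l, (b * lam l * C l k) * B j l := by
  rw [Matrix.smul_apply, Matrix.mul_apply, smul_eq_mul]
  congr 1
  refine Finset.sum_congr rfl fun l _ => ?_
  rw [Matrix.mul_smul, Matrix.smul_apply, eigenMatrix, Matrix.mul_diagonal, smul_eq_mul]
  ring

theorem Admissible.resolvRow_zero_flow (h : Admissible lam ρ) (t s : ℝ) (j : Fin N) :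
    resolvRow lam (flow lam γ t) ρ 0 j = resolvRow lam (flow lam γ s) ρ 0 j +
      ((t - s : ℝ) : ℂ) • rowOp _ (h.flowCoeff_mem (γ := flow lam γ s))
        (resolvRow lam (flow lam γ t) ρ 0 j) := by
  have h1 := rowOp_realize (h.flowCoeff_mem (γ := flow lam γ s))
    (h.resolvPow_mem (γ := flow lam γ t) 0 j)
  rw [show resolvRow lam (flow lam γ t) ρ 0 j =
    fun k => realize (resolvPow lam (flow lam γ t) ρ 0 j k) from rfl, h1]
  ext1 k
  have hmem : (∑ l, ((-2 * lam l : ℂ) • resolvFun lam (flow lam γ s) ρ l k) *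
      resolvPow lam (flow lam γ t) ρ 0 j l) ∈ ratHardy :=
    Submodule.sum_mem _ fun l _ => ratHardy_mul_mem (h.flowCoeff_mem l k) (h.resolvPow_mem 0 j l)
  rw [Pi.add_apply, Pi.smul_apply, resolvRow, ← realize_smul _ hmem,
    ← realize_add (h.resolvPow_mem 0 j k) (ratHardy.smul_mem _ hmem)]
  congr 1
  ext z
  have h2 := congrFun (congrFun (h.resolv_flow (γ := γ) t s z.2) j) k
  rw [Matrix.add_apply, mul_eigen_mul_apply] at h2
  simpa [resolvPow, resolvFun, mul_assoc] using h2

/-- Multiplying the resolvent identity on the left by a power of `R(t)` deduces continuity of each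
power from that of the previous one. The cube is needed, since `∂ₓₓ` of the soliton is `2c Yᵀ R³ X`.
-/
theorem Admissible.resolvRow_succ_flow (h : Admissible lam ρ) (m : ℕ) (t s : ℝ) (j : Fin N) :
    resolvRow lam (flow lam γ t) ρ (m + 1) j =
      rowOp _ (h.resolvFun_mem (γ := flow lam γ s)) (resolvRow lam (flow lam γ t) ρ m j) +
      ((t - s : ℝ) : ℂ) • rowOp _ (h.flowCoeff_mem (γ := flow lam γ s))
        (resolvRow lam (flow lam γ t) ρ (m + 1) j) := by
  have h1 := rowOp_realize (h.flowCoeff_mem (γ := flow lam γ s))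
    (h.resolvPow_mem (γ := flow lam γ t) (m + 1) j)
  have h1' := rowOp_realize (h.resolvFun_mem (γ := flow lam γ s))
    (h.resolvPow_mem (γ := flow lam γ t) m j)
  rw [show resolvRow lam (flow lam γ t) ρ (m + 1) j =
    fun k => realize (resolvPow lam (flow lam γ t) ρ (m + 1) j k) from rfl,
    show resolvRow lam (flow lam γ t) ρ m j =
    fun k => realize (resolvPow lam (flow lam γ t) ρ m j k) from rfl, h1, h1']
  ext1 k
  have hmem : (∑ l, ((-2 * lam l : ℂ) • resolvFun lam (flow lam γ s) ρ l k) *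
      resolvPow lam (flow lam γ t) ρ (m + 1) j l) ∈ ratHardy :=
    Submodule.sum_mem _ fun l _ =>
      ratHardy_mul_mem (h.flowCoeff_mem l k) (h.resolvPow_mem (m + 1) j l)
  have hmem' : (∑ l, resolvFun lam (flow lam γ s) ρ l k *
      resolvPow lam (flow lam γ t) ρ m j l) ∈ ratHardy :=
    Submodule.sum_mem _ fun l _ => ratHardy_mul_mem (h.resolvFun_mem l k) (h.resolvPow_mem m j l)
  rw [Pi.add_apply, Pi.smul_apply, ← realize_smul _ hmem,
    ← realize_add hmem' (ratHardy.smul_mem _ hmem)]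
  congr 1
  ext z
  have h2 : resolv lam (flow lam γ t) ρ z ^ (m + 1 + 1) =
      resolv lam (flow lam γ t) ρ z ^ (m + 1) * resolv lam (flow lam γ s) ρ z +
      ((t - s : ℝ) : ℂ) • (resolv lam (flow lam γ t) ρ z ^ (m + 1 + 1) *
        ((-2 : ℂ) • eigenMatrix lam) * resolv lam (flow lam γ s) ρ z) := by
    generalize hL : (-2 : ℂ) • eigenMatrix lam = L
    have := h.resolv_flow (γ := γ) t s z.2
    rw [hL] at this
    refine (pow_succ _ _).trans ((congrArg (resolv lam (flow lam γ t) ρ z ^ (m + 1) * ·) this).trans ?_)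
    rw [Matrix.mul_add, Matrix.mul_smul, pow_succ _ (m + 1), Matrix.mul_assoc, Matrix.mul_assoc,
      Matrix.mul_assoc]
  have h3 := congrFun (congrFun h2 j) k
  rw [Matrix.add_apply, mul_eigen_mul_apply, Matrix.mul_apply] at h3
  rw [resolvPow, h3]
  simp [resolvPow, resolvFun, mul_comm, mul_left_comm, mul_assoc]

theorem Admissible.continuous_resolvRow (h : Admissible lam ρ) (m : ℕ) (j : Fin N) :
    Continuous fun t => resolvRow lam (flow lam γ t) ρ m j := by
  rw [continuous_iff_continuousAt]
  induction m with
  | zero =>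
    exact fun s => tendsto_of_eq_add_smul (b := fun _ => resolvRow lam (flow lam γ s) ρ 0 j)
      continuousAt_const fun t => h.resolvRow_zero_flow t s j
  | succ m ih =>
    exact fun s => tendsto_of_eq_add_smul
      (((ContinuousLinearMap.continuous _).continuousAt).comp (ih s))
      fun t => h.resolvRow_succ_flow m t s j

theorem Admissible.hasDerivAt_resolvRow (h : Admissible lam ρ) (s : ℝ) (j : Fin N) :
    HasDerivAt (fun t => resolvRow lam (flow lam γ t) ρ 0 j)
      (rowOp _ (h.flowCoeff_mem (γ := flow lam γ s)) (resolvRow lam (flow lam γ s) ρ 0 j)) s :=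
  hasDerivAt_of_eq_add_smul fun t => h.resolvRow_zero_flow t s j

end

/-! ### The moving soliton solves (CM-DNLS) -/

section

theorem opDxx_realize {f f' f'' : ClosedUHP → ℂ} (hf : f ∈ ratHardy) (hf' : f' ∈ ratHardy)
    (hd : ∀ x : ℝ, HasDerivAt (fun x : ℝ => f (ofReal' x)) (f' (ofReal' x)) x)
    (hd' : ∀ x : ℝ, HasDerivAt (fun x : ℝ => f' (ofReal' x)) (f'' (ofReal' x)) x) :
    opDxx (realize f) = realize f'' := by
  have h1 : opD (opD (realize f)) = -realize f'' := by
    rw [opD_realize hf hd, opD_smul _ (memHardySobolev_one_realize hf'), opD_realize hf' hd',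
      smul_smul, neg_mul_neg, I_mul_I, neg_one_smul]
  have h2 : opDxx (realize f) = (-1 : ℂ) • opD (opD (realize f)) := by
    apply lTwo_ext
    have h3 : MemHardySobolev 1 (opD (realize f)) := by
      rw [opD_realize hf hd]
      exact (memHardySobolev_one_realize hf').smul _
    rw [fourierL2_smul]
    filter_upwards [fourier_opDxx (memHardySobolev_two_realize hf), fourier_opD h3,
      fourier_opD (memHardySobolev_one_realize hf),
      Lp.coeFn_smul (-1 : ℂ) (𝓕 (opD (opD (realize f))) : LTwo)] with η e1 e2 e3 e4
    rw [e1, e4, Pi.smul_apply, e2, e3, smul_eq_mul]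
    ring
  rw [h2, h1, neg_one_smul, neg_neg]

/-- `(D + |D|)(h + h̄) = 2 D h` for `h` in the Hardy space. -/
theorem opDAbsD_of_ae_eq {h : ClosedUHP → ℂ} (hh : h ∈ ratHardy) {F : LTwo}
    (hF : F =ᵐ[volume] fun x => h (ofReal' x) + starRingEnd ℂ (h (ofReal' x)))
    (hdom : MemMulDomain (fun ξ => ((ξ + |ξ| : ℝ) : ℂ)) F) :
    opDAbsD F = (2 : ℂ) • opD (realize h) := by
  have h1 : F = realize h + star (realize h) := by
    apply Lp.ext
    filter_upwards [hF, Lp.coeFn_add (realize h) (star (realize h)), realize_ae hh,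
      star_ae_eq (realize h)] with x e1 e2 e3 e4
    rw [e1, e2, Pi.add_apply, e4, e3]
  have h2 : (𝓕 F : LTwo) =ᵐ[volume] fun η => (𝓕 (realize h) : LTwo) η +
      starRingEnd ℂ ((𝓕 (realize h) : LTwo) (-η)) := by
    rw [h1, fourierL2_add]
    filter_upwards [Lp.coeFn_add (𝓕 (realize h) : LTwo) (𝓕 (star (realize h))),
      fourier_star (isWiener_realize hh)] with η e1 e2
    rw [e1, Pi.add_apply, e2]
  have hneg : ∀ᵐ η : ℝ, -η < 0 → (𝓕 (realize h) : LTwo) (-η) = 0 :=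
    (Measure.measurePreserving_neg (volume : Measure ℝ)).quasiMeasurePreserving.ae
      (memHardy_realize hh)
  apply lTwo_ext
  rw [fourierL2_smul, opDAbsD]
  filter_upwards [fourier_fourierMul (m := fun ξ => ((ξ + |ξ| : ℝ) : ℂ)) hdom, h2,
    Lp.coeFn_smul (2 : ℂ) (𝓕 (opD (realize h)) : LTwo),
    fourier_opD (memHardySobolev_one_realize hh), hneg, memHardy_realize hh] with η e1 e2 e3 e4 e5 e6
  rw [e1, e2, e3, Pi.smul_apply, e4, smul_eq_mul]
  rcases lt_trichotomy η 0 with hη | hη | hη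
  · have : 2 * Real.pi * η < 0 := mul_neg_of_pos_of_neg (by positivity) hη
    rw [e6 hη, abs_of_neg this, add_neg_cancel]
    simp
  · simp [hη]
  · have : 0 < 2 * Real.pi * η := by positivity
    rw [e5 (by linarith), abs_of_pos this, map_zero]
    push_cast
    ring

theorem realize_sum_one {n : ℕ} {f : Fin n → ClosedUHP → ℂ} (hf : ∀ j, f j ∈ ratHardy) :
    realize (∑ j, f j) = ∑ j, realize (f j) := by
  simpa using realize_sum (fun _ : Fin n => (1 : ℂ)) hf

variable {N : ℕ} [NeZero N] {lam γ : Fin N → ℝ} {ρ : ℝ} {c : ℂ}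

theorem resolvPow_zero (j k : Fin N) : resolvPow lam γ ρ 0 j k = resolvFun lam γ ρ j k := by
  ext z
  rw [resolvPow, zero_add, pow_one, resolvFun]

theorem Admissible.hasDerivAt_resolvPow_zero (h : Admissible lam ρ) (j k : Fin N) (x : ℝ) :
    HasDerivAt (fun x : ℝ => resolvPow lam γ ρ 0 j k (ofReal' x))
      (resolvPow lam γ ρ 1 j k (ofReal' x)) x := by
  rw [resolvPow_zero]
  have h1 := h.hasDerivAt_resolvFun (γ := γ) j k x
  rwa [← sq] at h1

theorem Admissible.hasDerivAt_resolvPow_one (h : Admissible lam ρ) (j k : Fin N) (x : ℝ) :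
    HasDerivAt (fun x : ℝ => resolvPow lam γ ρ 1 j k (ofReal' x))
      (2 * resolvPow lam γ ρ 2 j k (ofReal' x)) x := by
  have h1 : (fun x : ℝ => resolvPow lam γ ρ 1 j k (ofReal' x)) = fun x : ℝ =>
      ∑ l, resolvPow lam γ ρ 0 j l (ofReal' x) * resolvPow lam γ ρ 0 l k (ofReal' x) := by
    ext y
    simp only [resolvPow, zero_add, pow_one, one_add_one_eq_two, sq, Matrix.mul_apply]
  rw [h1]
  have h2 : HasDerivAt (fun x : ℝ =>
      ∑ l, resolvPow lam γ ρ 0 j l (ofReal' x) * resolvPow lam γ ρ 0 l k (ofReal' x))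
      (∑ l, (resolvPow lam γ ρ 1 j l (ofReal' x) * resolvPow lam γ ρ 0 l k (ofReal' x) +
        resolvPow lam γ ρ 0 j l (ofReal' x) * resolvPow lam γ ρ 1 l k (ofReal' x))) x :=
    HasDerivAt.fun_sum fun l _ =>
      (h.hasDerivAt_resolvPow_zero j l x).mul (h.hasDerivAt_resolvPow_zero l k x)
  convert h2 using 1
  rw [Finset.sum_add_distrib, two_mul]
  congr 1
  · change (resolv lam γ ρ x ^ (2 + 1)) j k = _
    rw [pow_succ, Matrix.mul_apply]
    simp [resolvPow]
  · change (resolv lam γ ρ x ^ (2 + 1)) j k = _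
    rw [pow_succ', Matrix.mul_apply]
    simp [resolvPow]

theorem Admissible.realize_solitonFun (h : Admissible lam ρ) :
    realize (solitonFun lam γ ρ c) = c • ∑ k, resolvRow lam γ ρ 0 0 k := by
  rw [solitonFun, realize_smul _ (Submodule.sum_mem _ fun j _ => h.resolvFun_mem 0 j),
    realize_sum_one (h.resolvFun_mem 0)]
  simp only [resolvRow, resolvPow_zero]

theorem Admissible.opDxx_solitonFun (h : Admissible lam ρ) :
    opDxx (realize (solitonFun lam γ ρ c)) = realize ((2 * c) • ∑ k, resolvPow lam γ ρ 2 0 k) := by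
  have hv' : c • ∑ k, resolvPow lam γ ρ 1 0 k ∈ ratHardy :=
    ratHardy.smul_mem _ (Submodule.sum_mem _ fun j _ => h.resolvPow_mem 1 0 j)
  refine opDxx_realize h.solitonFun_mem hv' (fun x => ?_) (fun x => ?_)
  · have := (HasDerivAt.fun_sum (u := Finset.univ) fun k _ =>
      h.hasDerivAt_resolvPow_zero (γ := γ) 0 k x).const_mul c
    simpa only [resolvPow_zero, solitonFun, Pi.smul_apply, Finset.sum_apply, smul_eq_mul] using this
  · have := (HasDerivAt.fun_sum (u := Finset.univ) fun k _ =>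
      h.hasDerivAt_resolvPow_one (γ := γ) 0 k x).const_mul c
    simp only [← Finset.mul_sum] at this
    simp only [Pi.smul_apply, Finset.sum_apply, smul_eq_mul]
    rwa [mul_left_comm, ← mul_assoc] at this

/-- `(D + |D|)(|v|²) = -2 tr (M - x)⁻²` for the soliton with resolvent `(M - x)⁻¹`. -/
theorem Admissible.quadForm_solitonFun (h : Admissible lam ρ) (hc : c * starRingEnd ℂ c = 2 * ρ) :
    quadForm (realize (solitonFun lam γ ρ c)) (realize (solitonFun lam γ ρ c)) =
      realize ((-2 : ℂ) • ∑ j, resolvPow lam γ ρ 1 j j) := by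
  have hv := h.solitonFun_mem (γ := γ) (c := c)
  have htr : (∑ j, resolvPow lam γ ρ 0 j j) ∈ ratHardy :=
    Submodule.sum_mem _ fun j _ => h.resolvPow_mem 0 j j
  have htr' : (∑ j, resolvPow lam γ ρ 1 j j) ∈ ratHardy :=
    Submodule.sum_mem _ fun j _ => h.resolvPow_mem 1 j j
  -- Here `|v|² = 2ρ |Yᵀ R X|² = 2ρ ‖Yᵀ R‖² = -i (tr R - conj (tr R))`, which is `h + h̄` with `h =
  -- -i tr R`.
  rw [quadForm, opDAbsD_of_ae_eq (h := (-I) • ∑ j, resolvPow lam γ ρ 0 j j)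
    (ratHardy.smul_mem _ htr) ?_ (memMulDomain_quadForm (memHardySobolev_two_realize hv)
      (isWiener_realize hv) (memHardy_realize hv)),
    opD_realize (f' := (-I) • ∑ j, resolvPow lam γ ρ 1 j j) (ratHardy.smul_mem _ htr) ?_,
    realize_smul _ htr', realize_smul _ htr', smul_smul, smul_smul]
  · congr 1
    rw [mul_assoc, neg_mul_neg, I_mul_I]
    norm_num
  · intro x
    have := (HasDerivAt.fun_sum (u := Finset.univ) fun j _ =>
      h.hasDerivAt_resolvPow_zero (γ := γ) j j x).const_mul (-I)
    simpa only [Pi.smul_apply, Finset.sum_apply, smul_eq_mul] using this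
  · filter_upwards [coeFn_mulL2_conjFun (isWiener_realize hv) (realize (solitonFun lam γ ρ c)),
      realize_ae hv] with x h1 h2
    rw [h1, h2, solitonFun_apply]
    simp only [Pi.smul_apply, Finset.sum_apply, smul_eq_mul, resolvPow_zero, resolvFun,
      coe_ofReal', map_mul, map_neg, conj_I, neg_neg]
    have h3 := h.norm_sq_row (γ := γ) x
    have h4 : ∑ j, resolv lam γ ρ x j j - ∑ j, starRingEnd ℂ (resolv lam γ ρ x j j) =
        2 * I * ρ * ∑ j, resolv lam γ ρ x 0 j * starRingEnd ℂ (resolv lam γ ρ x 0 j) := by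
      rw [← Finset.sum_sub_distrib, Finset.mul_sum]
      refine Finset.sum_congr rfl fun j _ => ?_
      rw [h.resolv_sub_conj, mul_comm (starRingEnd ℂ _)]
    rw [map_sum (starRingEnd ℂ) (fun j => resolv lam γ ρ x j j)]
    rw [← h3] at h4
    linear_combination (∑ j, resolv lam γ ρ x 0 j) *
      starRingEnd ℂ (∑ j, resolv lam γ ρ x 0 j) * hc + I * h4 +
      2 * ρ * ((∑ j, resolv lam γ ρ x 0 j) * starRingEnd ℂ (∑ j, resolv lam γ ρ x 0 j)) * I_sq

/-- The algebraic content of the equation: multiply the resolvent commutator by `R`, read row `0`,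
where `Yᵀ Λ = 0`, sum over the columns, and replace `Xᵀ R² X` by `tr R²`. -/
theorem Admissible.sum_row_eigen (h : Admissible lam ρ) {z : ℂ} (hz : 0 ≤ z.im) :
    ∑ k, ∑ l, (lam l : ℂ) * resolv lam γ ρ z l k * resolv lam γ ρ z 0 l =
      I * ((∑ l, resolv lam γ ρ z 0 l) * ∑ j, (resolv lam γ ρ z ^ 2) j j -
        ∑ k, (resolv lam γ ρ z ^ 3) 0 k) := by
  have h1 := congrArg (· * resolv lam γ ρ z) (h.resolv_commutator (γ := γ) hz)
  simp only [Matrix.sub_mul, Matrix.smul_mul] at h1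
  have h2 : ∀ k, ∑ l, (lam l : ℂ) * resolv lam γ ρ z l k * resolv lam γ ρ z 0 l =
      I * ((∑ l, resolv lam γ ρ z 0 l) * ∑ l, (resolv lam γ ρ z ^ 2) l k -
        (resolv lam γ ρ z ^ 3) 0 k) := by
    intro k
    have h3 := congrFun (congrFun h1 0) k
    rw [Matrix.mul_assoc (eigenMatrix lam), Matrix.mul_assoc (resolv lam γ ρ z * onesMatrix N),
      Matrix.sub_apply, Matrix.smul_apply, Matrix.sub_apply, mul_onesMatrix_mul_apply] at h3
    rw [sq, pow_succ _ 2, sq]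
    rw [eigenMatrix, Matrix.diagonal_mul, h.zero, ofReal_zero, zero_mul, sub_zero, smul_eq_mul,
      Matrix.mul_apply] at h3
    rw [← h3]
    refine Finset.sum_congr rfl fun l _ => ?_
    rw [Matrix.mul_diagonal]
    ring
  have h4 := h.trace_sq (γ := γ) hz
  rw [Finset.sum_congr rfl fun k _ => h2 k, ← Finset.mul_sum, Finset.sum_sub_distrib,
    ← Finset.mul_sum]
  rw [← sq] at h4
  rw [Finset.sum_comm.trans h4.symm]
  rfl

/-- The time derivative of the soliton. -/
def flowDeriv (lam γ : Fin N → ℝ) (ρ : ℝ) (c : ℂ) : ClosedUHP → ℂ :=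
  c • ∑ k, ∑ l, ((-2 * lam l : ℂ) • resolvFun lam γ ρ l k) * resolvPow lam γ ρ 0 0 l

theorem Admissible.flowDeriv_mem (h : Admissible lam ρ) : flowDeriv lam γ ρ c ∈ ratHardy :=
  ratHardy.smul_mem _ (Submodule.sum_mem _ fun k _ => Submodule.sum_mem _ fun l _ =>
    ratHardy_mul_mem (h.flowCoeff_mem l k) (h.resolvPow_mem 0 0 l))

theorem Admissible.hasDerivAt_soliton (h : Admissible lam ρ) (s : ℝ) :
    HasDerivAt (fun t => realize (solitonFun lam (flow lam γ t) ρ c))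
      (realize (flowDeriv lam (flow lam γ s) ρ c)) s := by
  have hmem : ∀ k, (∑ l, ((-2 * lam l : ℂ) • resolvFun lam (flow lam γ s) ρ l k) *
      resolvPow lam (flow lam γ s) ρ 0 0 l) ∈ ratHardy := fun k =>
    Submodule.sum_mem _ fun l _ => ratHardy_mul_mem (h.flowCoeff_mem l k) (h.resolvPow_mem 0 0 l)
  have h1 := h.hasDerivAt_resolvRow (γ := γ) s 0
  have h2 := rowOp_realize (h.flowCoeff_mem (γ := flow lam γ s))
    (h.resolvPow_mem (γ := flow lam γ s) 0 0)
  rw [show resolvRow lam (flow lam γ s) ρ 0 0 =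
    fun k => realize (resolvPow lam (flow lam γ s) ρ 0 0 k) from rfl, h2] at h1
  have h3 : HasDerivAt (fun t => c • ∑ k, resolvRow lam (flow lam γ t) ρ 0 0 k)
      (c • ∑ k, realize (∑ l, ((-2 * lam l : ℂ) • resolvFun lam (flow lam γ s) ρ l k) *
        resolvPow lam (flow lam γ s) ρ 0 0 l)) s :=
    (HasDerivAt.fun_sum fun k _ => hasDerivAt_pi.1 h1 k).const_smul c
  rw [flowDeriv, realize_smul _ (Submodule.sum_mem _ fun k _ => hmem k), realize_sum_one hmem]
  simpa only [h.realize_solitonFun] using h3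

/-- The soliton with parameters moving along the flow solves (CM-DNLS). -/
theorem Admissible.isSolutionOn (h : Admissible lam ρ) (hc : c * starRingEnd ℂ c = 2 * ρ)
    (J : Set ℝ) : IsSolutionOn (fun t => realize (solitonFun lam (flow lam γ t) ρ c)) J := by
  refine ⟨fun t _ => memHardySobolev_two_realize h.solitonFun_mem,
    fun t _ => (h.hasDerivAt_soliton t).continuousAt.continuousWithinAt, ?_,
    fun t _ => ⟨_, (h.hasDerivAt_soliton t).hasDerivWithinAt, ?_⟩⟩
  · have h1 : (fun t => opDxx (realize (solitonFun lam (flow lam γ t) ρ c))) =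
        fun t => (2 * c) • ∑ k, resolvRow lam (flow lam γ t) ρ 2 0 k := by
      ext1 t
      rw [h.opDxx_solitonFun, realize_smul _ (Submodule.sum_mem _ fun j _ => h.resolvPow_mem 2 0 j),
        realize_sum_one (h.resolvPow_mem 2 0)]
      rfl
    rw [h1]
    exact ((continuous_finsetSum _ fun k _ =>
      (continuous_apply k).comp (h.continuous_resolvRow 2 0)).const_smul (2 * c)).continuousOn
  · have hv := h.solitonFun_mem (γ := flow lam γ t) (c := c)
    have hd := h.flowDeriv_mem (γ := flow lam γ t) (c := c)
    have h2 : (2 * c) • ∑ k, resolvPow lam (flow lam γ t) ρ 2 0 k ∈ ratHardy :=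
      ratHardy.smul_mem _ (Submodule.sum_mem _ fun j _ => h.resolvPow_mem 2 0 j)
    have h3 : (-2 : ℂ) • ∑ j, resolvPow lam (flow lam γ t) ρ 1 j j ∈ ratHardy :=
      ratHardy.smul_mem _ (Submodule.sum_mem _ fun j _ => h.resolvPow_mem 1 j j)
    have h4 := h.quadForm_solitonFun (γ := flow lam γ t) hc
    rw [quadForm] at h4
    rw [h4, h.opDxx_solitonFun, mulL2_realize h3 hv, ← realize_smul _ hd,
      ← realize_add (ratHardy.smul_mem _ hd) h2,
      ← realize_add (ratHardy.add_mem (ratHardy.smul_mem _ hd) h2) (ratHardy_mul_mem h3 hv),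
      ← realize_zero]
    congr 1
    ext z
    have h5 := h.sum_row_eigen (γ := flow lam γ t) z.2
    have h6 : flowDeriv lam (flow lam γ t) ρ c z = c * (-2 * ∑ k, ∑ l, (lam l : ℂ) *
        resolv lam (flow lam γ t) ρ z l k * resolv lam (flow lam γ t) ρ z 0 l) := by
      simp only [flowDeriv, resolvPow_zero, resolvFun, Pi.smul_apply, Finset.sum_apply,
        Pi.mul_apply, smul_eq_mul, Finset.mul_sum, mul_assoc]
    simp only [Pi.add_apply, Pi.smul_apply, Pi.mul_apply, Finset.sum_apply, smul_eq_mul, h6,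
      solitonFun_apply, resolvPow, Pi.zero_apply, h5]
    norm_num only
    linear_combination (-2 * c * ((∑ l, resolv lam (flow lam γ t) ρ z 0 l) *
      ∑ j, (resolv lam (flow lam γ t) ρ z ^ 2) j j -
        ∑ k, (resolv lam (flow lam γ t) ρ z ^ 3) 0 k)) * I_sq

theorem eq_sqrt_mul_exp_arg (hc : c * starRingEnd ℂ c = 2 * ρ) :
    c = ((√(2 * ρ) : ℝ) : ℂ) * Complex.exp (I * Complex.arg c) := by
  have h1 : √(2 * ρ) = ‖c‖ := by
    rw [mul_conj, normSq_eq_norm_sq] at hc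
    have h2 : ‖c‖ ^ 2 = 2 * ρ := by exact_mod_cast hc
    rw [← h2, Real.sqrt_sq (norm_nonneg c)]
  rw [h1, mul_comm I, norm_mul_exp_arg_mul_I]

end

end CMDNLS

end

/-! ### The proposition -/

theorem mainTheorem9 (N : ℕ) [NeZero N] (lam : Fin N → ℝ) (hinj : Function.Injective lam)
    (h0 : lam 0 = 0) :
    (∀ u : CMDNLS.LTwo, CMDNLS.IsMultiSolitonPotential N u →
      (∀ j, CMDNLS.IsLaxEigenvalue u (lam j)) →
      ∃ (φ ρ : ℝ) (γ : Fin N → ℝ),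
        CMDNLS.HasSpectralParameters u lam γ ρ φ ∧ CMDNLS.RecoveredFrom u lam γ ρ φ) ∧
    (∀ (J : Set ℝ) (t₀ : ℝ) (u : ℝ → CMDNLS.LTwo), J.OrdConnected → t₀ ∈ J →
      CMDNLS.IsSolutionOn u J → CMDNLS.IsMultiSolitonPotential N (u t₀) →
      (∀ j, CMDNLS.IsLaxEigenvalue (u t₀) (lam j)) →
      ∃ (φ ρ : ℝ → ℝ) (γ : Fin N → ℝ → ℝ), ∀ t ∈ J,
        CMDNLS.HasSpectralParameters (u t) lam (fun j => γ j t) (ρ t) (φ t) ∧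
        CMDNLS.RecoveredFrom (u t) lam (fun j => γ j t) (ρ t) (φ t) ∧
        HasDerivWithinAt φ 0 J t ∧ HasDerivWithinAt ρ 0 J t ∧
        ∀ j, HasDerivWithinAt (γ j) (2 * lam j) J t) := by
  refine ⟨fun u hu hev => ?_, fun J t₀ u hJ ht₀ hsol hu hev => ?_⟩
  · obtain ⟨γ, ρ, c, hadm, hc, rfl⟩ := hu.exists_eq_realize hinj h0 hev
    have hc' := CMDNLS.eq_sqrt_mul_exp_arg hc
    exact ⟨c.arg, ρ, γ, hadm.hasSpectralParameters hc', hadm.recoveredFrom hc'⟩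
  · obtain ⟨γ, ρ, c, hadm, hc, hut⟩ := hu.exists_eq_realize hinj h0 hev
    have hc' := CMDNLS.eq_sqrt_mul_exp_arg hc
    -- Shifted so that the linear flow passes through the parameters of `u t₀` at time `t₀`.
    set γ' : Fin N → ℝ := fun j => γ j - 2 * lam j * t₀ with hγ'
    have hflow : CMDNLS.flow lam γ' t₀ = γ := by
      ext j
      rw [CMDNLS.flow, hγ', sub_add_cancel]
    have heq : ∀ t ∈ J, u t = CMDNLS.realize (CMDNLS.solitonFun lam (CMDNLS.flow lam γ' t) ρ c) :=
      hsol.unique (hadm.isSolutionOn hc J) hJ ht₀ (by rw [hut, hflow])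
    refine ⟨fun _ => c.arg, fun _ => ρ, fun j t => CMDNLS.flow lam γ' t j, fun t ht => ?_⟩
    rw [heq t ht]
    refine ⟨hadm.hasSpectralParameters hc', hadm.recoveredFrom hc', hasDerivWithinAt_const _ _ _,
      hasDerivWithinAt_const _ _ _, fun j => ?_⟩
    have h1 := ((hasDerivAt_id t).const_mul (2 * lam j)).const_add (γ' j)
    rw [mul_one] at h1
    exact h1.hasDerivWithinAt
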